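/- Let $\mathbb{Z}/4$ act on $\mathbb{C}^3$ with its generator acting by $\kappa(z_1,z_2,z_3)=(-z_1,iz_2,iz_3)$. This preserves the lattice $\mathbb{Z}[i]^3\cong\mathbb{Z}^6$ and hence induces an action on the torus $\mathbb{T}^6=\mathbb{C}^3/\mathbb{Z}[i]^3$. Let $\Gamma=\mathbb{Z}^6\rtimes\mathbb{Z}/4$ be the corresponding semidirect product. Then the integral cohomology of $\Gamma$ (trivial coefficients $\mathbb{Z}$) is, up to isomorphism of abelian groups, \[ H^i(\mathbb{Z}^6\rtimes\mathbb{Z}/4,\mathbb{Z})\cong\begin{cases} \mathbb{Z} & i=0,\\ 0 & i=1,\\ \mathbb{Z}^5\oplus\mathbb{Z}/4\oplus(\mathbb{Z}/2)^4 & i=2,\\ \mathbb{Z}^4\oplus(\mathbb{Z}/2)^4 & i=3,\\ \mathbb{Z}^5\oplus(\mathbb{Z}/4)^4\oplus(\mathbb{Z}/2)^{14} & i=4,\\ (\mathbb{Z}/2)^{12} & i=5,\\ \mathbb{Z}\oplus(\mathbb{Z}/4)^7\oplus(\mathbb{Z}/2)^{20} & i=6,\\ (\mathbb{Z}/2)^{12}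 & i=2k+1,\ k>1,\\ (\mathbb{Z}/4)^8\oplus(\mathbb{Z}/2)^{20} & i=2k,\ k>3. \end{cases} \] Moreover, let $E$ be a contractible Hausdorff space with a free continuous action of $G=\mathbb{Z}/4$ (a model of $EG$), let $E\times_G\mathbb{T}^6$ be the orbit space of the diagonal action on $E\times\mathbb{T}^6$, and for the orbifold $Y_1=\mathbb{T}^6/(\mathbb{Z}/4)$ define the groups of isomorphism classes of flat gerbes and of gerbes by the singular cohomology groups $FGb(Y_1)=H^2(E\times_G\mathbb{T}^6,U(1))$, with $U(1)$ discrete, and $Gb(Y_1)=H^3(E\times_G\mathbb{T}^6,\mathbb{Z})$. Then, as abelian groups, \[ FGb(Y_1)\cong U(1)^5\oplus(\mathbb{Z}/2)^4,\qquad Gb(Y_1)\cong\mathbb{Z}^4\oplus(\mathbb{Z}/2)^4 . \] -/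

import Mathlib

open CategoryTheory

noncomputable section

namespace ToroidalOrbifold

/-! ### The action of `ℤ/4` on `ℂ³`, on the lattice `ℤ[i]³ ≅ ℤ⁶` and on the torus -/

/-- The cyclic group `ℤ/4`, written multiplicatively. -/
abbrev C4 : Type := Multiplicative (ZMod 4)

/-- The eigenvalues of the generator on `ℂ³`. -/
def weight : Fin 3 → ℂ := ![-1, Complex.I, Complex.I]

theorem weight_pow_four (j : Fin 3) : weight j ^ 4 = 1 := by
  fin_cases j <;> norm_num [weight]

theorem weight_pow_add (j : Fin 3) (a b : ZMod 4) :
    weight j ^ (a + b).val = weight j ^ a.val * weight j ^ b.val := by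
  rw [ZMod.val_add, ← pow_add, ← pow_eq_pow_mod _ (weight_pow_four j)]

/-- `κ ^ g` on `ℂ³`, where `κ (z₁, z₂, z₃) = (-z₁, i z₂, i z₃)`. -/
def rotFun (g : C4) (z : Fin 3 → ℂ) : Fin 3 → ℂ :=
  fun j => weight j ^ (Multiplicative.toAdd g).val * z j

theorem rotFun_one (z : Fin 3 → ℂ) : rotFun 1 z = z := by
  funext j
  simp [rotFun]

theorem rotFun_mul (g h : C4) (z : Fin 3 → ℂ) : rotFun (g * h) z = rotFun g (rotFun h z) := by
  funext j
  simp only [rotFun, toAdd_mul, weight_pow_add, mul_assoc]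

theorem rotFun_add (g : C4) (z w : Fin 3 → ℂ) :
    rotFun g (z + w) = rotFun g z + rotFun g w := by
  funext j
  simp [rotFun, mul_add]

/-- The generator of `ℤ/4` acts by `(z₁, z₂, z₃) ↦ (-z₁, i z₂, i z₃)`. -/
theorem rotFun_generator (z : Fin 3 → ℂ) :
    rotFun (Multiplicative.ofAdd 1) z = ![-z 0, Complex.I * z 1, Complex.I * z 2] := by
  have h : (1 : ZMod 4).val = 1 := rfl
  funext j
  fin_cases j <;> simp [rotFun, weight, h]

/-- The lattice `ℤ[i]³ ⊆ ℂ³`, a free abelian group of rank six. -/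
def lattice : AddSubgroup (Fin 3 → ℂ) where
  carrier := {z | ∀ j, ∃ a b : ℤ, z j = a + b * Complex.I}
  zero_mem' := fun _ => ⟨0, 0, by simp⟩
  add_mem' := by
    intro z w hz hw j
    obtain ⟨a, b, h⟩ := hz j
    obtain ⟨c, d, h'⟩ := hw j
    exact ⟨a + c, b + d, by rw [Pi.add_apply, h, h']; push_cast; ring⟩
  neg_mem' := by
    intro z hz j
    obtain ⟨a, b, h⟩ := hz j
    exact ⟨-a, -b, by rw [Pi.neg_apply, h]; push_cast; ring⟩

theorem weight_pow_mul_mem (j : Fin 3) (n : ℕ) (x : ℂ) (hx : ∃ a b : ℤ, x = a + b * Complex.I) :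
    ∃ a b : ℤ, weight j ^ n * x = a + b * Complex.I := by
  induction n with
  | zero => simpa using hx
  | succ n ih =>
    obtain ⟨a, b, h⟩ := ih
    rw [pow_succ', mul_assoc, h]
    have hI : Complex.I * Complex.I = -1 := Complex.I_mul_I
    fin_cases j
    · exact ⟨-a, -b, by simp [weight]; ring⟩
    · exact ⟨-b, a, by simp [weight]; linear_combination (b : ℂ) * hI⟩
    · exact ⟨-b, a, by simp [weight]; linear_combination (b : ℂ) * hI⟩

theorem rotFun_mem (g : C4) {z : Fin 3 → ℂ} (hz : z ∈ lattice) : rotFun g z ∈ lattice :=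
  fun j => weight_pow_mul_mem j _ _ (hz j)

/-- The automorphism of the lattice by which an element of `ℤ/4` acts. -/
def latticeAut (g : C4) : lattice ≃+ lattice where
  toFun z := ⟨rotFun g z, rotFun_mem g z.2⟩
  invFun z := ⟨rotFun g⁻¹ z, rotFun_mem g⁻¹ z.2⟩
  left_inv z := Subtype.ext (by
    change rotFun g⁻¹ (rotFun g z) = z
    rw [← rotFun_mul, inv_mul_cancel, rotFun_one])
  right_inv z := Subtype.ext (by
    change rotFun g (rotFun g⁻¹ z) = z
    rw [← rotFun_mul, mul_inv_cancel, rotFun_one])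
  map_add' z w := Subtype.ext (rotFun_add g z w)

/-- The action of `ℤ/4` on the lattice, with the lattice written multiplicatively. -/
def latticeMulAut : C4 →* MulAut (Multiplicative lattice) where
  toFun g := AddEquiv.toMultiplicative (latticeAut g)
  map_one' := MulEquiv.ext fun z => congrArg Multiplicative.ofAdd
    (Subtype.ext (rotFun_one z.toAdd.1))
  map_mul' g h := MulEquiv.ext fun z => congrArg Multiplicative.ofAdd
    (Subtype.ext (rotFun_mul g h z.toAdd.1))

/-- The group `ℤ⁶ ⋊ ℤ/4`. -/
abbrev Gamma : Type := Multiplicative lattice ⋊[latticeMulAut] C4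

/-- The six-dimensional torus `ℂ³ / ℤ[i]³`, with the quotient topology. -/
abbrev Torus : Type := (Fin 3 → ℂ) ⧸ lattice

/-- The action of `ℤ/4` on the torus induced from `ℂ³`. -/
instance torusAction : MulAction C4 Torus where
  smul g := Quotient.map' (s₁ := QuotientAddGroup.leftRel lattice)
    (s₂ := QuotientAddGroup.leftRel lattice) (rotFun g) (by
      intro z w h
      rw [QuotientAddGroup.leftRel_apply] at h ⊢
      have h1 := rotFun_mem g h
      rw [rotFun_add] at h1
      have h2 : rotFun g (-z) = -rotFun g z := by
        funext j
        simp [rotFun]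
      rwa [h2] at h1)
  one_smul x := by
    induction x using Quotient.inductionOn'
    exact congrArg _ (rotFun_one _)
  mul_smul g h x := by
    induction x using Quotient.inductionOn'
    exact congrArg _ (rotFun_mul _ _ _)

/-! ### Singular cohomology, the Borel construction and gerbes -/

/-- Singular cohomology `Hⁿ(X; A)`: the cohomology of `Hom(C_*(X), A)`, where `C_*(X)` is the
integral singular chain complex of `X`. The abelian group `A` is discrete. -/
def singularCohomology (X : Type) [TopologicalSpace X] (A : Type) [AddCommGroup A] (n : ℕ) :
    ModuleCat ℤ :=
  ((((AlgebraicTopology.singularChainComplexFunctor (ModuleCat.{0} ℤ)).obj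
    (ModuleCat.of ℤ ℤ)).obj (TopCat.of X)).linearYonedaObj ℤ (ModuleCat.of ℤ A)).homology n

/-- `E` is a space `EG` for the finite group `G`: a contractible Hausdorff space with a free
continuous action of `G`. -/
structure IsUniversalSpace (G : Type) [Group G] (E : Type) [TopologicalSpace E]
    [MulAction G E] : Prop where
  hausdorff : T2Space E
  contractible : ContractibleSpace E
  continuous_smul : ∀ g : G, Continuous fun e : E => g • e
  free : ∀ (g : G) (e : E), g • e = e → g = 1

/-- The Borel construction `E ×_G X`: the orbit space of the diagonal action on `E × X`,
with the quotient topology. -/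
abbrev Borel (G : Type) [Group G] (E X : Type) [MulAction G E] [MulAction G X] : Type :=
  Quotient (MulAction.orbitRel G (E × X))

/-- Isomorphism classes of gerbes on the orbifold `X/G`, computed with the model `E` of `EG`:
`H³(EG ×_G X; ℤ)`. -/
def Gb (G : Type) [Group G] (E X : Type) [TopologicalSpace E] [TopologicalSpace X]
    [MulAction G E] [MulAction G X] : ModuleCat ℤ :=
  singularCohomology (Borel G E X) ℤ 3

/-- Isomorphism classes of flat gerbes on the orbifold `X/G`, computed with the model `E` of `EG`:
`H²(EG ×_G X; U(1))`, with `U(1)` discrete. -/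
def FGb (G : Type) [Group G] (E X : Type) [TopologicalSpace E] [TopologicalSpace X]
    [MulAction G E] [MulAction G X] : ModuleCat ℤ :=
  singularCohomology (Borel G E X) (Additive Circle) 2

/-- Integral group cohomology `Hⁿ(ℤ⁶ ⋊ ℤ/4; ℤ)`, with trivial action on `ℤ`. -/
abbrev HGamma (n : ℕ) : ModuleCat ℤ := groupCohomology (Rep.trivial ℤ Gamma ℤ) n

end ToroidalOrbifold

end

open CategoryTheory

noncomputable section

namespace ToroidalOrbifold

/-! ### Projective resolutions of the trivial representation -/

/-! Topological reduction. The group `Gamma` acts on the contractible space `E × ℂ³` by affine maps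
`(e, z) ↦ (g e, κ^g z + l)`. The action is free and properly discontinuous, and its quotient is the
Borel construction. Singular chains of `E × ℂ³` are therefore a free resolution of `ℤ` over `Gamma`,
and cochains on the quotient are the invariant cochains upstairs, because simplices lift. So `Hⁿ(E
×_G 𝕋⁶; A) ≅ Hⁿ(Gamma; A)` (`singularCohomology_borel_equiv`), and only group cohomology has to be
computed.

Explicit resolution. Tensor the periodic resolution of `ℤ/4` with the cellular chains of `ℝ⁶`, where
`ℝ⁶` has the product cell structure with vertices at the lattice points. Translations act freely on
the cells of `ℝ⁶`; the periodic factor makes the rotations act freely too. The generator permutes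
cells up to sign, so signed permutation bases suffice (`projective_of_signed_free_basis`,
`gammaResolution`).

Collapse. The induced cell structure on the torus has 64 cells, one for each set of coordinate
directions, and its cellular differential is zero. Hence only the `ℤ/4` direction of the
differential survives on invariant cochains, and `Hⁿ(Gamma; A)` is the direct sum over `q` of
`H^(n-q)(ℤ/4; A^{q-cells})`. The Lyndon–Hochschild–Serre spectral sequence thus degenerates at the
level of cochains, with no extension problem (`invariant_d`, `homology_equiv`).

Orbits. The square of the rotation fixes every torus cell up to sign, so the coefficient module
splits over orbits of size one or two (`exists_globalHom`). Over `ℤ` there are four kinds of orbit.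
With `j = n - q`: a fixed cell with sign `+` gives `ℤ` for `j = 0` and `ℤ/4` for even `j > 0`; a
fixed cell with sign `-` gives `ℤ/2` for odd `j`; a swapped pair with equal signs gives `ℤ` for `j =
0` and `ℤ/2` for even `j > 0`; a swapped pair with opposite signs gives `ℤ/2` for odd `j`. All other
contributions vanish. For `U(1)` in degree two, divisibility kills everything coming from cells of
dimension below two. It remains to count orbits, a finite computation, together with two-periodicity
above dimension six (`integralFactor_add_two`). -/

/-- A representation that permutes a basis freely, up to signs, is projective. -/
theorem projective_of_signed_free_basis {k Γ V X : Type} [CommRing k] [CharZero k] [Group Γ]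
    [AddCommGroup V] [Module k V] (ρ : Representation k Γ V) (b : Module.Basis X k V)
    (hperm : ∀ γ x, ∃ y, ∃ u : ℤˣ, ρ γ (b x) = u • b y)
    (hfree : ∀ γ x, ∀ u : ℤˣ, ρ γ (b x) = u • b x → γ = 1) : Projective (Rep.of ρ) := by
  have hsmul : ∀ (u : ℤˣ) γ v, ρ γ (u • v) = u • ρ γ v := fun u γ v => by
    simp [Units.smul_def]
  have huu : ∀ (u : ℤˣ) (v : V), u • u • v = v := fun u v => by
    rw [smul_smul, Int.units_mul_self, one_smul]
  -- Orbits of basis elements up to sign: a lift needs to be chosen only at one representative of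
  -- each and is then transported.
  let r : Setoid X :=
    { r := fun x y => ∃ γ, ∃ u : ℤˣ, ρ γ (b x) = u • b y
      iseqv :=
        { refl := fun x => ⟨1, 1, by simp⟩
          symm := by
            rintro x y ⟨γ, u, h⟩
            refine ⟨γ⁻¹, u, ?_⟩
            have h' := congrArg (ρ γ⁻¹) h
            rw [hsmul] at h'
            rw [← huu u (ρ γ⁻¹ (b y)), ← h', ← Module.End.mul_apply, ← map_mul]
            simp
          trans := by
            rintro x y z ⟨γ, u, h⟩ ⟨γ', u', h'⟩
            refine ⟨γ' * γ, u * u', ?_⟩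
            rw [map_mul, Module.End.mul_apply, h, hsmul, h', smul_smul] } }
  let rep : X → X := fun x => (Quotient.mk r x).out
  have hrep : ∀ x, ∃ γ, ∃ u : ℤˣ, ρ γ (b (rep x)) = u • b x := fun x =>
    Quotient.exact (Quotient.out_eq (Quotient.mk r x))
  choose g u hgu using hrep
  refine ⟨fun {N M} f e _ => ?_⟩
  have he : Function.Surjective e.hom := (Rep.epi_iff_surjective e).1 inferInstance
  choose n hn using fun x => he (f.hom (b x))
  let F : V →ₗ[k] N.V := b.constr k fun x => u x • N.ρ (g x) (n (rep x))
  have hF : ∀ x, F (b x) = u x • N.ρ (g x) (n (rep x)) := fun x => b.constr_basis k _ x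
  have hNs : ∀ (u : ℤˣ) γ v, N.ρ γ (u • v) = u • N.ρ γ v := fun u γ v => by
    simp [Units.smul_def]
  have hequiv : ∀ γ, F ∘ₗ ρ γ = N.ρ γ ∘ₗ F := by
    refine fun γ => b.ext fun x => ?_
    obtain ⟨y, v, hy⟩ := hperm γ x
    have hxy : rep y = rep x := congrArg Quotient.out (Quotient.sound (s := r) ⟨γ, v, hy⟩).symm
    have h1 : ρ (γ * g x) (b (rep x)) = (u x * v) • b y := by
      rw [map_mul, Module.End.mul_apply, hgu, hsmul, hy, smul_smul]
    have h2 := hgu y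
    rw [hxy] at h2
    -- Both elements carry the representative to `± b y`, so they differ by an element fixing it up
    -- to sign; freeness up to sign makes them equal.
    have h3 : g y = γ * g x := by
      have h4 : ρ ((γ * g x)⁻¹ * g y) (b (rep x)) = (u y * (u x * v)) • b (rep x) := by
        have h5 : ρ (γ * g x)⁻¹ (ρ (γ * g x) (b (rep x))) = b (rep x) := by
          rw [← Module.End.mul_apply, ← map_mul]; simp
        rw [h1, hsmul] at h5
        rw [map_mul, Module.End.mul_apply, h2, hsmul, mul_smul]
        congr 1
        conv_rhs => rw [← h5, huu]
      exact (inv_mul_eq_one.1 (hfree _ _ _ h4)).symm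
    -- Comparing coefficients of `b y` determines the sign, since `1 ≠ -1` in characteristic zero.
    have h6 : u y = u x * v := by
      rw [h3, h1] at h2
      have := congrArg (fun w => b.repr w y) h2
      simp only [Units.smul_def, map_zsmul, Finsupp.smul_apply, Module.Basis.repr_self,
        Finsupp.single_eq_same, zsmul_eq_mul, mul_one] at this
      exact Units.ext (Int.cast_injective this.symm)
    have hFs : F (v • b y) = v • F (b y) := by simp [Units.smul_def]
    simp only [LinearMap.comp_apply]
    rw [hy, hFs, hF, hF, hNs, hxy, h3, h6, map_mul, Module.End.mul_apply, smul_smul,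
      mul_comm (u x), ← mul_assoc, Int.units_mul_self, one_mul]
  refine ⟨Rep.ofHom ⟨F, hequiv⟩, ?_⟩
  ext x
  revert x
  suffices h : e.hom.toLinearMap ∘ₗ F = f.hom.toLinearMap from fun x => LinearMap.congr_fun h x
  refine b.ext fun x => ?_
  have hes : ∀ (u : ℤˣ) v, e.hom (u • v) = u • e.hom v := fun u v => by
    simp [Units.smul_def]
  have hfs : ∀ (u : ℤˣ) (v : V), f.hom (u • v) = u • f.hom v := fun u v => by
    simp [Units.smul_def]
  change e.hom (F (b x)) = f.hom (b x)
  rw [hF, hes, Rep.hom_comm_apply, hn, ← Rep.hom_comm_apply, ← hfs]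
  congr 1
  change u x • ρ (g x) (b (rep x)) = b x
  rw [hgu, huu]

/-- A complex of projective representations that is elementwise exact and augmented to `k` is a
projective resolution of `k`. -/
def resolutionOfExact {k Γ : Type} [CommRing k] [Group Γ] (C : ChainComplex (Rep.{0} k Γ) ℕ)
    (hproj : ∀ n, Projective (C.X n)) (ε : C.X 0 ⟶ Rep.trivial k Γ k) (hε : C.d 1 0 ≫ ε = 0)
    (hsurj : Function.Surjective ε.hom) (h0 : ∀ x, ε.hom x = 0 → ∃ y, (C.d 1 0).hom y = x)
    (hn : ∀ n x, (C.d (n + 1) n).hom x = 0 → ∃ y, (C.d (n + 2) (n + 1)).hom y = x) :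
    ProjectiveResolution (Rep.trivial k Γ k) where
  complex := C
  projective := hproj
  π := (C.toSingle₀Equiv _).symm ⟨ε, hε⟩
  quasiIso :=
    { quasiIsoAt := fun m => by
        cases m with
        | zero =>
          rw [ChainComplex.quasiIsoAt₀_iff, ShortComplex.quasiIso_iff_of_zeros' _
            (by simp; rfl) (by simp; rfl) (by simp; rfl)]
          constructor
          · apply (forget₂ _ (ModuleCat k)).reflects_exact_of_faithful
            rw [ShortComplex.moduleCat_exact_iff]
            intro x hx
            obtain ⟨y, hy⟩ := h0 x (by simpa [ChainComplex.toSingle₀Equiv] using! hx)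
            exact ⟨y, hy⟩
          · rw [Rep.epi_iff_surjective]
            intro x
            obtain ⟨y, hy⟩ := hsurj x
            exact ⟨y, by simpa [ChainComplex.toSingle₀Equiv] using! hy⟩
        | succ m =>
          rw [quasiIsoAt_iff_exactAt' (hL := ChainComplex.exactAt_succ_single_obj ..),
            HomologicalComplex.exactAt_iff' _ (m + 2) (m + 1) m (by simp) (by simp)]
          apply (forget₂ _ (ModuleCat k)).reflects_exact_of_faithful
          rw [ShortComplex.moduleCat_exact_iff]
          exact fun x hx => hn m x hx }

end ToroidalOrbifold

/-! ### Topological half: from singular cohomology to group cohomology. -/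

namespace ToroidalOrbifold

open Limits Simplicial AlgebraicTopology

theorem one_smul_of_module {R M : Type} [Ring R] [AddCommGroup M] (_ : Module R M) (x : M) :
    (1 : R) • x = x :=
  one_smul R x

theorem rep_hom_ext {k Γ : Type} [CommRing k] [Group Γ] {V W : Rep.{0} k Γ} {f g : V ⟶ W}
    (h : ∀ x, f.hom x = g.hom x) : f = g := by
  ext x
  exact h x

/-! ### Simplicial chains of a simplicial set with a group action -/

/-- The integral chain complex of a simplicial set. -/
abbrev chains (K : SSet.{0}) : ChainComplex (ModuleCat.{0} ℤ) ℕ :=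
  K.chainComplex (ModuleCat.of ℤ ℤ)

/-- The chain map induced by a map of simplicial sets. -/
abbrev chainsMap {K L : SSet.{0}} (f : K ⟶ L) : chains K ⟶ chains L :=
  SSet.chainComplexMap f (ModuleCat.of ℤ ℤ)

/-- The chain given by a single simplex. -/
def simplexChain {K : SSet.{0}} {n : ℕ} (x : K _⦋n⦌) : (chains K).X n :=
  (K.ιChainComplex (R := ModuleCat.of ℤ ℤ) x).hom (1 : ℤ)

theorem chains_hom_ext {K : SSet.{0}} {n : ℕ} {M : Type} [AddCommGroup M] [Module ℤ M]
    {f g : (chains K).X n →ₗ[ℤ] M} (h : ∀ x : K _⦋n⦌, f (simplexChain x) = g (simplexChain x)) :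
    f = g := by
  have : ModuleCat.ofHom f = ModuleCat.ofHom g := by
    refine SSet.chainComplex_hom_ext fun x => ?_
    ext
    exact h x
  exact congrArg ModuleCat.Hom.hom this

/-- The linear map on chains with prescribed values on simplices. -/
def chainsLift {K : SSet.{0}} {n : ℕ} {M : Type} [AddCommGroup M] [Module ℤ M]
    (f : K _⦋n⦌ → M) : (chains K).X n →ₗ[ℤ] M :=
  ((Cofan.IsColimit.desc (K.isColimitChainComplexXCofan (ModuleCat.of ℤ ℤ) n)
    (fun x => ModuleCat.ofHom (LinearMap.toSpanSingleton ℤ M (f x)))) :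
      (chains K).X n ⟶ ModuleCat.of ℤ M).hom

theorem chainsLift_simplexChain {K : SSet.{0}} {n : ℕ} {M : Type} [AddCommGroup M] [Module ℤ M]
    (f : K _⦋n⦌ → M) (x : K _⦋n⦌) : chainsLift f (simplexChain x) = f x := by
  have := Cofan.IsColimit.fac (K.isColimitChainComplexXCofan (ModuleCat.of ℤ ℤ) n)
    (fun x => ModuleCat.ofHom (LinearMap.toSpanSingleton ℤ M (f x))) x
  have h := LinearMap.congr_fun (congrArg ModuleCat.Hom.hom this) (1 : ℤ)
  exact h.trans (one_smul_of_module _ _)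

/-- The simplices form a basis of the chains. -/
def chainsBasis (K : SSet.{0}) (n : ℕ) : Module.Basis (K _⦋n⦌) ℤ ((chains K).X n) :=
  Module.Basis.ofRepr <| LinearEquiv.ofLinearMap
    (chainsLift fun x => Finsupp.single x (1 : ℤ))
    (Finsupp.linearCombination ℤ simplexChain)
    (by
      refine Finsupp.lhom_ext' fun x => LinearMap.ext_ring ?_
      simp [chainsLift_simplexChain, Finsupp.linearCombination_single])
    (by
      refine chains_hom_ext fun x => ?_
      simp only [LinearMap.comp_apply, chainsLift_simplexChain,
        Finsupp.linearCombination_single, LinearMap.id_apply]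
      exact one_smul_of_module _ _)

theorem chainsBasis_apply (K : SSet.{0}) (n : ℕ) (x : K _⦋n⦌) :
    chainsBasis K n x = simplexChain x := by
  rw [Module.Basis.apply_eq_iff]
  exact chainsLift_simplexChain _ x

theorem chainsMap_simplexChain {K L : SSet.{0}} (f : K ⟶ L) {n : ℕ} (x : K _⦋n⦌) :
    ((chainsMap f).f n).hom (simplexChain x) = simplexChain (f.app _ x) := by
  have := SSet.ι_chainComplexMap_f K L f (ModuleCat.of ℤ ℤ) x
  exact LinearMap.congr_fun (congrArg ModuleCat.Hom.hom this) (1 : ℤ)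

/-! ### Simplicial chains as representations, and cochains on a quotient -/

section GroupAction

variable {Γ : Type} [Group Γ] {K : SSet.{0}} (φ : Γ →* End K)

/-- The representation on chains induced by an action on a simplicial set. -/
def chainsRepresentation (n : ℕ) : Representation ℤ Γ ((chains K).X n) where
  toFun γ := ((chainsMap (φ γ)).f n).hom
  map_one' := chains_hom_ext fun x => by
    rw [chainsMap_simplexChain, map_one]
    simp [End.one_def]
  map_mul' γ γ' := chains_hom_ext fun x => by
    rw [Module.End.mul_apply, chainsMap_simplexChain, chainsMap_simplexChain,
      chainsMap_simplexChain, map_mul]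
    simp [End.mul_def]

theorem chainsRepresentation_simplexChain (γ : Γ) {n : ℕ} (x : K _⦋n⦌) :
    chainsRepresentation φ n γ (simplexChain x) = simplexChain ((φ γ).app _ x) :=
  chainsMap_simplexChain _ _

/-- The complex of chains, as a complex of representations. -/
def chainsRep : ChainComplex (Rep.{0} ℤ Γ) ℕ where
  X n := Rep.of (chainsRepresentation φ n)
  d i j := Rep.ofHom ⟨((chains K).d i j).hom, fun γ => by
    have := (chainsMap (φ γ)).comm i j
    exact (congrArg ModuleCat.Hom.hom this)⟩
  shape i j h := by
    have := (chains K).shape i j h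
    ext x
    exact LinearMap.congr_fun (congrArg ModuleCat.Hom.hom this) x
  d_comp_d' i j k _ _ := by
    have := (chains K).d_comp_d i j k
    ext x
    exact LinearMap.congr_fun (congrArg ModuleCat.Hom.hom this) x

theorem projective_chainsRep (hfree : ∀ γ (n : ℕ) (x : K _⦋n⦌), (φ γ).app _ x = x → γ = 1)
    (n : ℕ) : Projective ((chainsRep φ).X n) := by
  refine projective_of_signed_free_basis (chainsRepresentation φ n) (chainsBasis K n)
    (fun γ x => ⟨(φ γ).app _ x, 1, ?_⟩) (fun γ x u h => hfree γ n x ?_)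
  · rw [one_smul, chainsBasis_apply, chainsBasis_apply, chainsRepresentation_simplexChain]
  · rw [chainsBasis_apply, chainsRepresentation_simplexChain, ← chainsBasis_apply,
      ← chainsBasis_apply] at h
    by_contra hne
    have := congrArg (fun w => (chainsBasis K n).repr w x) h
    simp [Units.smul_def, Finsupp.single_eq_of_ne' hne] at this
    exact u.ne_zero this.symm

/-- The augmentation of the chain complex. -/
def chainsAug (K : SSet.{0}) : (chains K).X 0 →ₗ[ℤ] ℤ := chainsLift fun _ => 1

theorem chainsAug_simplexChain (x : K _⦋0⦌) : chainsAug K (simplexChain x) = 1 :=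
  chainsLift_simplexChain _ x

theorem d_simplexChain {n : ℕ} (x : K _⦋n + 1⦌) :
    ((chains K).d (n + 1) n).hom (simplexChain x) =
      ∑ i : Fin (n + 2), (-1 : ℤ) ^ i.val • simplexChain (K.δ i x) := by
  have := SSet.ιChainComplex_d K (ModuleCat.of ℤ ℤ) x
  have h := LinearMap.congr_fun (congrArg ModuleCat.Hom.hom this) (1 : ℤ)
  refine Eq.trans h ?_
  simp [ModuleCat.hom_sum, LinearMap.sum_apply, simplexChain]

theorem chainsAug_d (K : SSet.{0}) : chainsAug K ∘ₗ ((chains K).d 1 0).hom = 0 := by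
  refine chains_hom_ext fun x => ?_
  rw [LinearMap.comp_apply, d_simplexChain]
  simp [Fin.sum_univ_two, chainsAug_simplexChain]

/-- The chains of an acyclic simplicial set with a free action form a projective resolution. -/
def chainsResolution (hfree : ∀ γ (n : ℕ) (x : K _⦋n⦌), (φ γ).app _ x = x → γ = 1)
    (hne : Nonempty (K _⦋0⦌))
    (h0 : ∀ x, chainsAug K x = 0 → ∃ y, ((chains K).d 1 0).hom y = x)
    (hn : ∀ n x, ((chains K).d (n + 1) n).hom x = 0 →
      ∃ y, ((chains K).d (n + 2) (n + 1)).hom y = x) :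
    ProjectiveResolution (Rep.trivial ℤ Γ ℤ) :=
  resolutionOfExact (chainsRep φ) (projective_chainsRep φ hfree)
    (Rep.ofHom ⟨chainsAug K, fun γ => chains_hom_ext fun x => by
      change chainsAug K (chainsRepresentation φ 0 γ (simplexChain x)) =
        chainsAug K (simplexChain x)
      rw [chainsRepresentation_simplexChain, chainsAug_simplexChain, chainsAug_simplexChain]⟩)
    (rep_hom_ext fun x => LinearMap.congr_fun (chainsAug_d K) x)
    (fun m => ⟨(m : ℤ) • simplexChain hne.some, by
      change chainsAug K (m • simplexChain hne.some) = (m : ℤ)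
      rw [map_zsmul, chainsAug_simplexChain, zsmul_one, Int.cast_id]⟩)
    h0 hn

variable {L : SSet.{0}} (p : K ⟶ L) (hp : ∀ γ, φ γ ≫ p = p)
  (hsurj : ∀ n (y : L _⦋n⦌), ∃ x : K _⦋n⦌, p.app _ x = y)
  (horb : ∀ n (x x' : K _⦋n⦌), p.app _ x = p.app _ x' → ∃ γ, (φ γ).app _ x = x')
  (A : Type) [AddCommGroup A]

/-- Cochains on the quotient are invariant cochains. -/
def quotientCochainsEquiv (n : ℕ) :
    ((chains L).X n ⟶ ModuleCat.of ℤ A) ≃ₗ[ℤ] ((chainsRep φ).X n ⟶ Rep.trivial ℤ Γ A) :=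
  LinearEquiv.ofBijective
    { toFun := fun f => Rep.ofHom ⟨f.hom ∘ₗ ((chainsMap p).f n).hom, fun γ => by
        refine chains_hom_ext fun x => ?_
        change f.hom (((chainsMap p).f n).hom (chainsRepresentation φ n γ (simplexChain x))) =
          f.hom (((chainsMap p).f n).hom (simplexChain x))
        rw [chainsRepresentation_simplexChain, chainsMap_simplexChain, chainsMap_simplexChain]
        have := congrArg (fun q => q.app (Opposite.op ⦋n⦌) x) (hp γ)
        congr 2⟩
      map_add' := fun f g => by ext x; rfl
      map_smul' := fun m f => by ext x; rfl }
    (by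
      constructor
      · intro f g h
        ext1
        refine chains_hom_ext fun y => ?_
        obtain ⟨x, rfl⟩ := hsurj n y
        have h' : f.hom (((chainsMap p).f n).hom (simplexChain x)) =
          g.hom (((chainsMap p).f n).hom (simplexChain x)) :=
          congrArg (fun q => q.hom (simplexChain x)) h
        rwa [chainsMap_simplexChain] at h'
      · intro g
        -- The value at a simplex of the quotient is read off at any lift; lifts differ by the
        -- group, so invariance makes the choice harmless.
        refine ⟨ModuleCat.ofHom (chainsLift fun y => g.hom (simplexChain (hsurj n y).choose)), ?_⟩
        ext x
        revert x
        refine LinearMap.congr_fun (f := _ ∘ₗ ((chainsMap p).f n).hom) (g := g.hom.toLinearMap)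
          (chains_hom_ext fun x => ?_)
        rw [LinearMap.comp_apply, chainsMap_simplexChain]
        refine (chainsLift_simplexChain _ _).trans ?_
        obtain ⟨γ, hγ⟩ := horb n x _ (hsurj n (p.app _ x)).choose_spec.symm
        rw [← hγ, ← chainsRepresentation_simplexChain]
        exact Rep.hom_comm_apply g γ _)

/-- Cochains on the quotient are invariant cochains, as complexes. -/
def quotientCochainsIso :
    (chains L).linearYonedaObj ℤ (ModuleCat.of ℤ A) ≅
      (chainsRep φ).linearYonedaObj ℤ (Rep.trivial ℤ Γ A) :=
  HomologicalComplex.Hom.isoOfComponents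
    (fun n => (quotientCochainsEquiv φ p hp hsurj horb A n).toModuleIso) (fun i j _ => by
      ext f
      change (chainsRep φ).d j i ≫ quotientCochainsEquiv φ p hp hsurj horb A i f =
        quotientCochainsEquiv φ p hp hsurj horb A j ((chains L).d j i ≫ f)
      refine rep_hom_ext fun x => ?_
      have := LinearMap.congr_fun (congrArg ModuleCat.Hom.hom ((chainsMap p).comm j i)) x
      exact congrArg f.hom this.symm)

end GroupAction

/-! ### Singular chains -/

/-- The singular simplicial set of a space. -/
abbrev sing (X : Type) [TopologicalSpace X] : SSet.{0} := TopCat.toSSet.obj (TopCat.of X)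

/-- The map of singular simplicial sets induced by a continuous map. -/
abbrev singMap {X Y : Type} [TopologicalSpace X] [TopologicalSpace Y] (f : C(X, Y)) :
    sing X ⟶ sing Y := TopCat.toSSet.map (TopCat.ofHom f)

/-- A singular simplex is a continuous map. -/
abbrev simplexMap {X : Type} [TopologicalSpace X] {n : ℕ} :
    sing X _⦋n⦌ ≃ C(stdSimplex ℝ (Fin (n + 1)), X) :=
  TopCat.toSSetObjEquiv (TopCat.of X) (Opposite.op ⦋n⦌)

theorem simplexMap_singMap {X Y : Type} [TopologicalSpace X] [TopologicalSpace Y] (f : C(X, Y))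
    {n : ℕ} (x : sing X _⦋n⦌) :
    simplexMap ((singMap f).app _ x) = f.comp (simplexMap x) := rfl

/-- Small balls of a convex set are convex. This supplies the local hypothesis of the lifting
criterion for maps from simplices to a covering. -/
theorem locallyPathConnectedSpace_of_convex {E : Type*} [NormedAddCommGroup E] [NormedSpace ℝ E]
    {s : Set E} (hs : Convex ℝ s) : LocallyPathConnectedSpace s := by
  refine LocallyPathConnectedSpace.of_bases (p := fun _ r => 0 < r)
    (s := fun x r => Metric.ball x r) (fun x => Metric.nhds_basis_ball) fun x r hr => ?_
  have h : IsPathConnected (s ∩ Metric.ball (x : E) r) :=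
    (hs.inter (convex_ball _ _)).isPathConnected ⟨x, x.2, Metric.mem_ball_self hr⟩
  have h' := h.preimage_coe Set.inter_subset_left
  convert h' using 1
  ext y
  simp [Subtype.dist_eq]

instance (n : ℕ) : LocallyPathConnectedSpace (stdSimplex ℝ (Fin (n + 1))) :=
  locallyPathConnectedSpace_of_convex (convex_stdSimplex ℝ _)

instance (n : ℕ) : ContractibleSpace (stdSimplex ℝ (Fin (n + 1))) :=
  (convex_stdSimplex ℝ _).contractibleSpace ⟨_, single_mem_stdSimplex ℝ 0⟩

/-! ### Acyclicity of the singular chains of a contractible space -/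

section Contractible

variable (X : Type) [TopologicalSpace X] [ContractibleSpace X]

/-- The identity of the chain complex of a contractible space is homotopic to the map induced by
a constant map. -/
theorem exists_chainHomotopy : ∃ x₀ : X, Nonempty (Homotopy (𝟙 (chains (sing X)))
    (chainsMap (singMap (ContinuousMap.const X x₀)))) := by
  obtain ⟨x₀, ⟨H⟩⟩ := id_nullhomotopic X
  refine ⟨x₀, ⟨?_⟩⟩
  have H' : TopCat.Homotopy (𝟙 (TopCat.of X)) (TopCat.ofHom (ContinuousMap.const X x₀)) := H
  refine (Homotopy.ofEq ?_).trans (H'.singularChainComplexFunctorObjMap (ModuleCat.of ℤ ℤ))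
  exact (CategoryTheory.Functor.map_id _ _).symm

/-- The identity is chain homotopic to a map that factors through the chains of a point, which have
no homology in positive degree. -/
theorem chains_exact_succ (n : ℕ) (x : (chains (sing X)).X (n + 1))
    (hx : ((chains (sing X)).d (n + 1) n).hom x = 0) :
    ∃ y, ((chains (sing X)).d (n + 2) (n + 1)).hom y = x := by
  obtain ⟨x₀, ⟨H⟩⟩ := exists_chainHomotopy X
  have h0 : IsZero ((chains (sing PUnit)).homology (n + 1)) := by
    have := singularChainComplexFunctor_exactAt_of_totallyDisconnectedSpace (ModuleCat.{0} ℤ)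
      (n + 1) (ModuleCat.of ℤ ℤ) (TopCat.of PUnit) (by simp)
    exact this.isZero_homology
  have hfac : chainsMap (singMap (ContinuousMap.const X x₀)) =
      chainsMap (singMap (ContinuousMap.const X PUnit.unit)) ≫
        chainsMap (singMap (ContinuousMap.const PUnit x₀)) := by
    rw [← Functor.map_comp, ← Functor.map_comp]
    rfl
  have hid := H.homologyMap_eq (n + 1)
  rw [hfac, HomologicalComplex.homologyMap_comp, HomologicalComplex.homologyMap_id,
    h0.eq_of_tgt (HomologicalComplex.homologyMap _ _) 0, zero_comp] at hid
  have hz : (chains (sing X)).ExactAt (n + 1) := by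
    rw [HomologicalComplex.exactAt_iff_isZero_homology, IsZero.iff_id_eq_zero]
    exact hid
  rw [HomologicalComplex.exactAt_iff' _ (n + 2) (n + 1) n (by simp) (by simp),
    ShortComplex.moduleCat_exact_iff] at hz
  exact hz x hx

/-- In degree zero the homotopy reads `x = d (H x) + c x`, where `c` is induced by a constant map
and sends `x` to its augmentation times one point. -/
theorem chains_exact_zero (x : (chains (sing X)).X 0) (hx : chainsAug (sing X) x = 0) :
    ∃ y, ((chains (sing X)).d 1 0).hom y = x := by
  obtain ⟨x₀, ⟨H⟩⟩ := exists_chainHomotopy X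
  have hconst : ((chainsMap (singMap (ContinuousMap.const X x₀))).f 0).hom =
      (LinearMap.toSpanSingleton ℤ _ (simplexChain (simplexMap.symm (ContinuousMap.const _ x₀)))) ∘ₗ
        chainsAug (sing X) := by
    refine chains_hom_ext fun s => ?_
    rw [chainsMap_simplexChain, LinearMap.comp_apply, chainsAug_simplexChain,
      LinearMap.toSpanSingleton_apply]
    refine Eq.trans ?_ (one_smul_of_module _ _).symm
    congr 1
  have h := H.comm 0
  rw [Homotopy.dNext_zero_chainComplex, zero_add, Homotopy.prevD_chainComplex] at h
  have h' := LinearMap.congr_fun (congrArg ModuleCat.Hom.hom h) x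
  refine ⟨(H.hom 0 1).hom x, ?_⟩
  refine Eq.symm (h'.trans ?_)
  change ((chains (sing X)).d 1 0).hom ((H.hom 0 1).hom x) +
    ((chainsMap (singMap (ContinuousMap.const X x₀))).f 0).hom x = _
  rw [hconst, LinearMap.comp_apply, hx, map_zero, add_zero]

end Contractible

/-! ### Cohomology of the quotient by a covering action -/

section Covering

variable {Γ : Type} [Group Γ] {X Y : Type} [TopologicalSpace X] [TopologicalSpace Y]
  [MulAction Γ X]

/-- The action on singular simplices induced by a continuous action. -/
def singAction [ContinuousConstSMul Γ X] : Γ →* End (sing X) where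
  toFun γ := singMap ⟨fun x => γ • x, continuous_const_smul γ⟩
  map_one' := by
    rw [End.one_def, ← CategoryTheory.Functor.map_id]
    congr 1
    ext x
    exact one_smul Γ x
  map_mul' γ γ' := by
    rw [End.mul_def, ← Functor.map_comp]
    congr 1
    ext x
    exact mul_smul γ γ' x

theorem singAction_app [ContinuousConstSMul Γ X] (γ : Γ) {n : ℕ} (x : sing X _⦋n⦌) (t) :
    simplexMap ((singAction γ).app _ x) t = γ • simplexMap x t := rfl

/-- The singular cohomology of the quotient of a contractible space by a covering action is the
cohomology of the group. -/
theorem singularCohomology_equiv_groupCohomology [ContractibleSpace X] {p : X → Y}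
    (hp : IsQuotientCoveringMap p Γ) (A : Type) [AddCommGroup A] (n : ℕ) :
    Nonempty (singularCohomology Y A n ≃+ groupCohomology (Rep.trivial ℤ Γ A) n) := by
  have := hp.toContinuousConstSMul
  have := hp.isCancelSMul
  have hcov := hp.isCoveringMap
  let t₀ (n : ℕ) : stdSimplex ℝ (Fin (n + 1)) := ⟨_, single_mem_stdSimplex ℝ 0⟩
  have hfree : ∀ (γ : Γ) (n : ℕ) (x : sing X _⦋n⦌), (singAction γ).app _ x = x → γ = 1 := by
    intro γ n x h
    have h' := singAction_app γ x (t₀ n)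
    rw [h] at h'
    exact IsCancelSMul.right_cancel γ 1 (simplexMap x (t₀ n)) (by rw [one_smul]; exact h'.symm)
  let P : ProjectiveResolution (Rep.trivial ℤ Γ ℤ) :=
    chainsResolution (singAction (Γ := Γ) (X := X)) hfree
      ⟨simplexMap.symm (ContinuousMap.const _ (Classical.arbitrary X))⟩
      (chains_exact_zero X) (chains_exact_succ X)
  have hinv : ∀ γ : Γ, singAction γ ≫ singMap ⟨p, hcov.continuous⟩ =
      singMap ⟨p, hcov.continuous⟩ := by
    intro γ
    change singMap _ ≫ singMap _ = _
    rw [← Functor.map_comp]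
    congr 1
    ext x
    exact hp.map_smul γ
  have hsurj : ∀ n (y : sing Y _⦋n⦌), ∃ x : sing X _⦋n⦌,
      (singMap ⟨p, hcov.continuous⟩).app _ x = y := by
    intro n y
    obtain ⟨e₀, he₀⟩ := hp.surjective (simplexMap y (t₀ n))
    -- A simplex is contractible and locally path connected, so it lifts through the covering from
    -- any starting point over its first vertex.
    obtain ⟨F, ⟨-, hF⟩, -⟩ := hcov.existsUnique_continuousMap_lifts (simplexMap y) (t₀ n) e₀ he₀
    refine ⟨simplexMap.symm F, simplexMap.injective ?_⟩
    rw [simplexMap_singMap, Equiv.apply_symm_apply]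
    ext t
    exact congrFun hF t
  have horb : ∀ n (x x' : sing X _⦋n⦌), (singMap ⟨p, hcov.continuous⟩).app _ x =
      (singMap ⟨p, hcov.continuous⟩).app _ x' → ∃ γ : Γ, (singAction γ).app _ x = x' := by
    intro n x x' h
    have h' := congrArg simplexMap h
    rw [simplexMap_singMap, simplexMap_singMap] at h'
    have h₀ := ContinuousMap.congr_fun h' (t₀ n)
    -- Match the two lifts at one vertex by a group element; uniqueness of lifts then matches them
    -- on the whole simplex.
    obtain ⟨γ, hγ⟩ := hp.apply_eq_iff_mem_orbit.1 h₀.symm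
    refine ⟨γ, simplexMap.injective ?_⟩
    refine ContinuousMap.ext fun t => congrFun (hcov.eq_of_comp_eq (ContinuousMap.continuous _)
      (ContinuousMap.continuous _) (funext fun s => ?_) (t₀ n) hγ) t
    refine Eq.trans ?_ (ContinuousMap.congr_fun h' s)
    exact hp.map_smul γ
  exact ⟨((HomologicalComplex.homologyMapIso
    (quotientCochainsIso singAction (singMap ⟨p, hcov.continuous⟩) hinv hsurj horb A) n ≪≫
      (groupCohomologyIso (Rep.trivial ℤ Γ A) n P).symm).toLinearEquiv).toAddEquiv⟩

end Covering

end ToroidalOrbifold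

namespace ToroidalOrbifold

/-! ### The Borel construction of the torus as the quotient of a contractible space by `ℤ⁶ ⋊ ℤ/4` -/

/-- In the sup norm every real and imaginary part is an integer of absolute value below one. This is
the discreteness behind proper discontinuity of translations. -/
theorem eq_zero_of_mem_lattice {l : Fin 3 → ℂ} (hl : l ∈ lattice) (h : ‖l‖ < 1) : l = 0 := by
  funext j
  obtain ⟨a, b, hab⟩ := hl j
  have h1 : ‖l j‖ < 1 := (norm_le_pi_norm l j).trans_lt h
  have ha := (Complex.abs_re_le_norm (l j)).trans_lt h1
  have hb := (Complex.abs_im_le_norm (l j)).trans_lt h1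
  rw [hab] at ha hb ⊢
  simp only [Complex.add_re, Complex.intCast_re, Complex.mul_re, Complex.I_re, mul_zero,
    Complex.intCast_im, Complex.I_im, mul_one, sub_self, add_zero, Complex.add_im, Complex.mul_im,
    zero_add] at ha hb
  have ha' : |a| < 1 := by exact_mod_cast ha
  have hb' : |b| < 1 := by exact_mod_cast hb
  rw [Int.abs_lt_one_iff] at ha' hb'
  simp [ha', hb']

theorem continuous_rotFun (g : C4) : Continuous (rotFun g) := by
  unfold rotFun
  fun_prop

/-- The Hausdorff property separates `e` from each `g • e`; finiteness of `G` allows intersecting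
the neighbourhoods. -/
theorem exists_nhds_disjoint_of_free {G E : Type} [Group G] [Finite G] [TopologicalSpace E]
    [T2Space E] [MulAction G E] (hc : ∀ g : G, Continuous fun e : E => g • e)
    (hfree : ∀ (g : G) (e : E), g • e = e → g = 1) (e : E) :
    ∃ U ∈ nhds e, ∀ g : G, ∀ x ∈ U, g • x ∈ U → g = 1 := by
  have key : ∀ g : G, ∃ U ∈ nhds e, g ≠ 1 → ∀ x ∈ U, g • x ∉ U := by
    intro g
    by_cases hg : g = 1
    · exact ⟨Set.univ, Filter.univ_mem, fun h => absurd hg h⟩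
    have hne : g • e ≠ e := fun h => hg (hfree g e h)
    obtain ⟨W, U, hW, hU, hWe, hUe, hWU⟩ := t2_separation hne
    refine ⟨U ∩ (fun x => g • x) ⁻¹' W, Filter.inter_mem (hU.mem_nhds hUe)
      ((hW.preimage (hc g)).mem_nhds hWe), fun _ x hx hx' => ?_⟩
    exact Set.disjoint_left.1 hWU hx.2 hx'.1
  choose U hU hU' using key
  refine ⟨⋂ g, U g, Filter.iInter_mem.2 hU, fun g x hx hgx => ?_⟩
  by_contra hg
  exact hU' g hg x (Set.mem_iInter.1 hx g) (Set.mem_iInter.1 hgx g)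

section

variable (E : Type) [MulAction C4 E]

/-- The action of `ℤ⁶ ⋊ ℤ/4` on `E × ℂ³`. -/
@[reducible] def coverAction : MulAction Gamma (E × (Fin 3 → ℂ)) where
  smul γ x := (γ.right • x.1, rotFun γ.right x.2 + (Multiplicative.toAdd γ.left : lattice).1)
  one_smul x := by
    refine Prod.ext (one_smul C4 x.1) ?_
    change rotFun 1 x.2 + 0 = x.2
    rw [rotFun_one, add_zero]
  mul_smul γ γ' x := by
    refine Prod.ext (mul_smul γ.right γ'.right x.1) ?_
    change rotFun (γ.right * γ'.right) x.2 + (γ.left.toAdd.1 + rotFun γ.right γ'.left.toAdd.1) =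
      rotFun γ.right (rotFun γ'.right x.2 + γ'.left.toAdd.1) + γ.left.toAdd.1
    rw [rotFun_mul, rotFun_add]
    abel

variable [TopologicalSpace E]

/-- The projection from `E × ℂ³` to the Borel construction. -/
def coverProj (x : E × (Fin 3 → ℂ)) : Borel C4 E Torus :=
  Quotient.mk _ (x.1, QuotientAddGroup.mk x.2)

theorem isQuotientCoveringMap_coverProj (hE : IsUniversalSpace C4 E) :
    let := coverAction E
    IsQuotientCoveringMap (coverProj E) Gamma := by
  let := coverAction E
  have hsmul : ∀ (γ : Gamma) (x : E × (Fin 3 → ℂ)), γ • x =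
    (γ.right • x.1, rotFun γ.right x.2 + (Multiplicative.toAdd γ.left : lattice).1) :=
    fun _ _ => rfl
  -- The projection to the torus is open, so its product with the identity of `E` is still a
  -- quotient map.
  have hq : Topology.IsQuotientMap (coverProj E) := by
    have h1 : IsOpenQuotientMap (QuotientAddGroup.mk : (Fin 3 → ℂ) → Torus) :=
      QuotientAddGroup.isOpenQuotientMap_mk
    exact isQuotientMap_quotient_mk'.comp
      ((IsOpenQuotientMap.id (X := E)).prodMap h1).isQuotientMap
  refine { hq with continuous_const_smul := ?_, apply_eq_iff_mem_orbit := ?_, disjoint := ?_ }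
  · intro γ
    exact ((hE.continuous_smul γ.right).comp continuous_fst).prodMk
      (((continuous_rotFun _).comp continuous_snd).add continuous_const)
  · rintro ⟨e₁, v₁⟩ ⟨e₂, v₂⟩
    unfold coverProj
    rw [Quotient.eq]
    constructor
    · rintro ⟨g, hg⟩
      have hg1 : g • e₂ = e₁ := congrArg Prod.fst hg
      have hg2 : (QuotientAddGroup.mk (rotFun g v₂) : Torus) = QuotientAddGroup.mk v₁ :=
        congrArg Prod.snd hg
      rw [QuotientAddGroup.eq] at hg2
      -- The translation part is forced: it is `v₁ - κ^g v₂`, a lattice vector by `hg2`.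
      refine ⟨⟨Multiplicative.ofAdd ⟨_, hg2⟩, g⟩, ?_⟩
      refine Prod.ext hg1 ?_
      change rotFun g v₂ + (-rotFun g v₂ + v₁) = v₁
      abel
    · rintro ⟨γ, hγ⟩
      have hg1 : γ.right • e₂ = e₁ := congrArg Prod.fst hγ
      have hg2 : rotFun γ.right v₂ + (Multiplicative.toAdd γ.left : lattice).1 = v₁ :=
        congrArg Prod.snd hγ
      refine ⟨γ.right, Prod.ext hg1 ?_⟩
      change (QuotientAddGroup.mk (rotFun γ.right v₂) : Torus) = QuotientAddGroup.mk v₁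
      rw [QuotientAddGroup.eq, ← hg2, neg_add_cancel_left]
      exact (Multiplicative.toAdd γ.left).2
  · rintro ⟨e, v⟩
    have := hE.hausdorff
    have : Finite C4 := inferInstanceAs (Finite (ZMod 4))
    obtain ⟨U, hU, hU'⟩ := exists_nhds_disjoint_of_free hE.continuous_smul hE.free e
    -- Two points of a ball of radius `1/2` differ by less than one, so no nonzero lattice vector
    -- relates them; `U` excludes nontrivial rotations.
    refine ⟨U ×ˢ Metric.ball v (1 / 2), prod_mem_nhds hU (Metric.ball_mem_nhds v (by norm_num)), ?_⟩
    rintro γ ⟨_, ⟨⟨x, w⟩, hxw, rfl⟩, hx'⟩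
    dsimp only at hx'
    rw [hsmul] at hx'
    have h1 : γ.right = 1 := hU' _ x hxw.1 hx'.1
    have h2 : (Multiplicative.toAdd γ.left : lattice).1 = 0 := by
      refine eq_zero_of_mem_lattice (Multiplicative.toAdd γ.left).2 ?_
      have h3 := hx'.2
      have h4 := hxw.2
      simp only [Metric.mem_ball, h1, rotFun_one] at h3 h4
      rw [dist_eq_norm] at h3 h4
      have h5 : (Multiplicative.toAdd γ.left : lattice).1 =
        (w + (Multiplicative.toAdd γ.left : lattice).1 - v) - (w - v) := by abel
      rw [h5]
      refine (norm_sub_le _ _).trans_lt ?_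
      linarith
    refine SemidirectProduct.ext ?_ h1
    exact congrArg Multiplicative.ofAdd (Subtype.ext h2 : Multiplicative.toAdd γ.left = 0)

/-- The cohomology of the Borel construction is the cohomology of `ℤ⁶ ⋊ ℤ/4`. -/
theorem singularCohomology_borel_equiv (hE : IsUniversalSpace C4 E) (A : Type) [AddCommGroup A]
    (n : ℕ) : Nonempty (singularCohomology (Borel C4 E Torus) A n ≃+
      groupCohomology (Rep.trivial ℤ Gamma A) n) := by
  let := coverAction E
  have := hE.contractible
  exact singularCohomology_equiv_groupCohomology (isQuotientCoveringMap_coverProj E hE) A n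

end

end ToroidalOrbifold

/-! ### Algebraic half: an explicit resolution and the resulting cohomology. -/

namespace ToroidalOrbifold

open scoped TensorProduct

/-! ### Contracted complexes of free abelian groups and their tensor products -/

/-- Chains on a set of cells. -/
abbrev Ch (X : Type) : Type := X →₀ ℤ

/-- A linear endomorphism of the chains on a set of cells. -/
abbrev ChEnd (X : Type) : Type := Module.End ℤ (Ch X)

/-- The tensor product of chains on `X` and chains on `Y` are the chains on `X × Y`. -/
def chTensor (X Y : Type) : Ch X ⊗[ℤ] Ch Y ≃ₗ[ℤ] Ch (X × Y) := finsuppTensorFinsupp' ℤ X Y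

/-- The tensor product of two endomorphisms. -/
def endTensor {X Y : Type} (f : ChEnd X) (g : ChEnd Y) : ChEnd (X × Y) :=
  (chTensor X Y).toLinearMap ∘ₗ TensorProduct.map f g ∘ₗ (chTensor X Y).symm.toLinearMap

section endTensor

variable {X Y : Type}

theorem endTensor_apply (f : ChEnd X) (g : ChEnd Y) (w : Ch (X × Y)) :
    endTensor f g w = chTensor X Y (TensorProduct.map f g ((chTensor X Y).symm w)) := rfl

theorem endTensor_chTensor (f : ChEnd X) (g : ChEnd Y) (u : Ch X) (v : Ch Y) :
    endTensor f g (chTensor X Y (u ⊗ₜ v)) = chTensor X Y (f u ⊗ₜ g v) := by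
  rw [endTensor_apply, LinearEquiv.symm_apply_apply, TensorProduct.map_tmul]

theorem chTensor_single (x : X) (y : Y) (a b : ℤ) :
    chTensor X Y (Finsupp.single x a ⊗ₜ Finsupp.single y b) = Finsupp.single (x, y) (a * b) :=
  finsuppTensorFinsupp'_single_tmul_single ..

theorem endTensor_single (f : ChEnd X) (g : ChEnd Y) (x : X) (y : Y) :
    endTensor f g (Finsupp.single (x, y) 1) =
      chTensor X Y (f (Finsupp.single x 1) ⊗ₜ g (Finsupp.single y 1)) := by
  rw [← endTensor_chTensor, chTensor_single, one_mul]

theorem endTensor_mul (f f' : ChEnd X) (g g' : ChEnd Y) :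
    endTensor f g * endTensor f' g' = endTensor (f * f') (g * g') := by
  refine Finsupp.lhom_ext' fun ⟨x, y⟩ => LinearMap.ext_ring ?_
  simp only [LinearMap.comp_apply, Finsupp.lsingle_apply, Module.End.mul_apply, endTensor_single,
    endTensor_chTensor]

theorem endTensor_one : endTensor (1 : ChEnd X) (1 : ChEnd Y) = 1 := by
  refine LinearMap.ext fun x => ?_
  simp [endTensor_apply, Module.End.one_eq_id]

theorem endTensor_add_left (f f' : ChEnd X) (g : ChEnd Y) :
    endTensor (f + f') g = endTensor f g + endTensor f' g := by
  refine LinearMap.ext fun x => ?_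
  simp [endTensor_apply, TensorProduct.map_add_left]

theorem endTensor_add_right (f : ChEnd X) (g g' : ChEnd Y) :
    endTensor f (g + g') = endTensor f g + endTensor f g' := by
  refine LinearMap.ext fun x => ?_
  simp [endTensor_apply, TensorProduct.map_add_right]

theorem endTensor_zero_left (g : ChEnd Y) : endTensor (0 : ChEnd X) g = 0 := by
  have := endTensor_add_left (0 : ChEnd X) 0 g
  simpa using this

theorem endTensor_zero_right (f : ChEnd X) : endTensor f (0 : ChEnd Y) = 0 := by
  have := endTensor_add_right f (0 : ChEnd Y) 0
  simpa using this

theorem endTensor_neg_left (f : ChEnd X) (g : ChEnd Y) : endTensor (-f) g = -endTensor f g := by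
  rw [eq_neg_iff_add_eq_zero, ← endTensor_add_left, neg_add_cancel, endTensor_zero_left]

theorem endTensor_neg_right (f : ChEnd X) (g : ChEnd Y) : endTensor f (-g) = -endTensor f g := by
  rw [eq_neg_iff_add_eq_zero, ← endTensor_add_right, neg_add_cancel, endTensor_zero_right]

theorem chTensor_mem_supported {u : Ch X} {v : Ch Y} {S : Set X} {T : Set Y} {R : Set (X × Y)}
    (hu : u ∈ Finsupp.supported ℤ ℤ S) (hv : v ∈ Finsupp.supported ℤ ℤ T)
    (h : ∀ x ∈ S, ∀ y ∈ T, (x, y) ∈ R) :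
    chTensor X Y (u ⊗ₜ v) ∈ Finsupp.supported ℤ ℤ R := by
  rw [Finsupp.mem_supported'] at hu hv ⊢
  rintro ⟨x, y⟩ hxy
  have : chTensor X Y (u ⊗ₜ v) (x, y) = u x * v y := finsuppTensorFinsupp'_apply_apply ..
  rw [this]
  by_cases hx : x ∈ S
  · rw [hv y fun hy => hxy (h x hx y hy), mul_zero]
  · rw [hu x hx, zero_mul]

end endTensor

/-- A complex of free abelian groups with graded basis, augmented to `ℤ`, with a contracting
homotopy. -/
structure ContractedComplex (X : Type) where
  /-- The degree of a basis element. -/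
  deg : X → ℕ
  /-- A basis element of degree zero. -/
  base : X
  /-- The differential. -/
  d : ChEnd X
  /-- The contracting homotopy. -/
  s : ChEnd X
  /-- The augmentation, followed by the inclusion of the base cell. -/
  π : ChEnd X
  deg_base : deg base = 0
  π_single : ∀ x, π (Finsupp.single x 1) = if deg x = 0 then Finsupp.single base 1 else 0
  d_mem : ∀ x, d (Finsupp.single x 1) ∈ Finsupp.supported ℤ ℤ {y | deg y + 1 = deg x}
  s_mem : ∀ x, s (Finsupp.single x 1) ∈ Finsupp.supported ℤ ℤ {y | deg y = deg x + 1}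
  d_mul_d : d * d = 0
  π_mul_d : π * d = 0
  homotopy : d * s + s * d = 1 - π

/-- The augmentation of a graded basis, followed by the inclusion of the base cell. -/
def augProj {X : Type} (deg : X → ℕ) (base : X) : ChEnd X :=
  Finsupp.linearCombination ℤ fun x => if deg x = 0 then Finsupp.single base (1 : ℤ) else 0

theorem augProj_single {X : Type} (deg : X → ℕ) (base : X) (x : X) :
    augProj deg base (Finsupp.single x 1) = if deg x = 0 then Finsupp.single base 1 else 0 := by
  simp [augProj, Finsupp.linearCombination_single]

namespace ContractedComplex

variable {X Y : Type} (C : ContractedComplex X) (D : ContractedComplex Y)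

/-- The grading sign. -/
def τ : ChEnd X :=
  Finsupp.linearCombination ℤ fun x => Finsupp.single x ((-1 : ℤ) ^ C.deg x)

theorem τ_single (x : X) :
    C.τ (Finsupp.single x 1) = (-1 : ℤ) ^ C.deg x • Finsupp.single x 1 := by
  simp [τ, Finsupp.linearCombination_single]

theorem τ_of_mem {n : ℕ} {u : Ch X} (hu : u ∈ Finsupp.supported ℤ ℤ {y | C.deg y = n}) :
    C.τ u = (-1 : ℤ) ^ n • u := by
  rw [τ, Finsupp.linearCombination_apply, Finsupp.sum]
  conv_rhs => rw [← Finsupp.sum_single u, Finsupp.sum, Finset.smul_sum]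
  refine Finset.sum_congr rfl fun x hx => ?_
  have : C.deg x = n := hu hx
  rw [this, Finsupp.smul_single, Finsupp.smul_single, smul_eq_mul, smul_eq_mul, mul_comm]

theorem ext_single {M : Type*} [AddCommGroup M] [Module ℤ M] {f g : Ch X →ₗ[ℤ] M}
    (h : ∀ x, f (Finsupp.single x 1) = g (Finsupp.single x 1)) : f = g :=
  Finsupp.lhom_ext' fun x => LinearMap.ext_ring (h x)

/-- The differential changes degree by one, hence parity. With the same fact for `s`, this cancels
the cross terms in the tensor product. -/
theorem τ_mul_d : C.τ * C.d = -(C.d * C.τ) := by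
  refine ext_single fun x => ?_
  rw [LinearMap.neg_apply, Module.End.mul_apply, Module.End.mul_apply, τ_single, map_zsmul]
  rcases hx : C.deg x with _ | n
  · have h : C.d (Finsupp.single x 1) = 0 := by
      have := C.d_mem x
      simp only [hx, Nat.add_one_ne_zero, Set.ofPred_false, Finsupp.supported_empty,
        Submodule.mem_bot] at this
      exact this
    simp [h]
  · rw [C.τ_of_mem (n := n) (by simpa [hx] using C.d_mem x), pow_succ]
    simp

theorem τ_mul_s : C.τ * C.s = -(C.s * C.τ) := by
  refine ext_single fun x => ?_
  rw [LinearMap.neg_apply, Module.End.mul_apply, Module.End.mul_apply, τ_single, map_zsmul,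
    C.τ_of_mem (C.s_mem x), pow_succ]
  simp

theorem τ_mul_π : C.τ * C.π = C.π := by
  refine ext_single fun x => ?_
  rw [Module.End.mul_apply, π_single]
  split_ifs
  · rw [τ_single, deg_base, pow_zero, one_smul]
  · rw [map_zero]

theorem π_mul_τ : C.π * C.τ = C.π := by
  refine ext_single fun x => ?_
  rw [Module.End.mul_apply, τ_single, map_zsmul, π_single]
  split_ifs with h
  · rw [h, pow_zero, one_smul]
  · rw [smul_zero]

theorem d_single_of_deg_eq_zero {x : X} (hx : C.deg x = 0) :
    C.d (Finsupp.single x 1) = 0 := by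
  have := C.d_mem x
  simp only [hx, Nat.add_one_ne_zero, Set.ofPred_false, Finsupp.supported_empty,
    Submodule.mem_bot] at this
  exact this

theorem d_mul_π : C.d * C.π = 0 := by
  refine ext_single fun x => ?_
  rw [Module.End.mul_apply, π_single]
  split_ifs
  · rw [d_single_of_deg_eq_zero C C.deg_base, LinearMap.zero_apply]
  · rw [map_zero, LinearMap.zero_apply]

theorem single_mem (x : X) :
    Finsupp.single x 1 ∈ Finsupp.supported ℤ ℤ {y | C.deg y = C.deg x} :=
  Finsupp.single_mem_supported ℤ _ rfl

theorem τ_mem (x : X) :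
    C.τ (Finsupp.single x 1) ∈ Finsupp.supported ℤ ℤ {y | C.deg y = C.deg x} := by
  rw [τ_single]
  exact Submodule.smul_mem _ _ (C.single_mem x)

/-- The tensor product of two contracted complexes. -/
def tensor : ContractedComplex (X × Y) where
  deg x := C.deg x.1 + D.deg x.2
  base := (C.base, D.base)
  d := endTensor C.d 1 + endTensor C.τ D.d
  -- Contract the first factor, then the second over the base cell of the first. The cross terms
  -- `(τs + sτ) ⊗ d` cancel, leaving `(1 - π) ⊗ 1 + π ⊗ (1 - π) = 1 - π ⊗ π`.
  s := endTensor C.s 1 + endTensor C.π D.s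
  π := endTensor C.π D.π
  deg_base := by simp [deg_base]
  π_single := by
    rintro ⟨x, y⟩
    rw [endTensor_single, π_single, π_single]
    by_cases hx : C.deg x = 0 <;> by_cases hy : D.deg y = 0 <;>
      simp [hx, hy, chTensor_single]
  d_mem := by
    rintro ⟨x, y⟩
    rw [LinearMap.add_apply, endTensor_single, endTensor_single]
    refine Submodule.add_mem _ ?_ ?_
    · refine chTensor_mem_supported (C.d_mem x) (D.single_mem y) ?_
      simp only [Set.mem_ofPred_eq]
      intro a ha b hb
      lia
    · refine chTensor_mem_supported (C.τ_mem x) (D.d_mem y) ?_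
      simp only [Set.mem_ofPred_eq]
      intro a ha b hb
      lia
  s_mem := by
    rintro ⟨x, y⟩
    rw [LinearMap.add_apply, endTensor_single, endTensor_single]
    refine Submodule.add_mem _ ?_ ?_
    · refine chTensor_mem_supported (C.s_mem x) (D.single_mem y) ?_
      simp only [Set.mem_ofPred_eq]
      intro a ha b hb
      lia
    · rw [π_single]
      split_ifs with hx
      · refine chTensor_mem_supported (C.single_mem _) (D.s_mem y) ?_
        simp only [Set.mem_ofPred_eq, deg_base]
        intro a ha b hb
        lia
      · simp
  d_mul_d := by
    simp only [mul_add, add_mul, endTensor_mul, d_mul_d, one_mul, mul_one, endTensor_zero_left,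
      endTensor_zero_right, τ_mul_d, endTensor_neg_left]
    abel
  π_mul_d := by
    simp only [mul_add, endTensor_mul, π_mul_d, mul_one, endTensor_zero_left,
      endTensor_zero_right, add_zero]
  homotopy := by
    have h1 : C.s * C.d = 1 - C.π - C.d * C.s := by rw [← C.homotopy]; abel
    have h2 : D.s * D.d = 1 - D.π - D.d * D.s := by rw [← D.homotopy]; abel
    simp only [mul_add, add_mul, endTensor_mul, one_mul, mul_one, d_mul_π, π_mul_d, τ_mul_s,
      τ_mul_π, π_mul_τ, endTensor_zero_left, h1, h2, sub_eq_add_neg, endTensor_add_left,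
      endTensor_add_right, endTensor_neg_left, endTensor_neg_right, endTensor_one]
    abel

theorem tensor_d_single (x : X) (y : Y) :
    (C.tensor D).d (Finsupp.single (x, y) 1) =
      chTensor _ _ (C.d (Finsupp.single x 1) ⊗ₜ Finsupp.single y 1) +
        (-1 : ℤ) ^ C.deg x •
          chTensor _ _ (Finsupp.single x 1 ⊗ₜ D.d (Finsupp.single y 1)) := by
  change (endTensor C.d 1 + endTensor C.τ D.d : ChEnd (X × Y)) _ = _
  rw [LinearMap.add_apply, endTensor_single, endTensor_single, τ_single]
  rw [Module.End.one_apply, ← TensorProduct.smul_tmul', map_zsmul]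

end ContractedComplex

/-- An action of a group on a contracted complex by degree-preserving chain maps that are
compatible with the augmentation. -/
structure ComplexAction (Γ : Type) [Group Γ] {X : Type} (C : ContractedComplex X) where
  /-- The representation on chains. -/
  ρ : Representation ℤ Γ (Ch X)
  ρ_mem : ∀ γ x, ρ γ (Finsupp.single x 1) ∈ Finsupp.supported ℤ ℤ {y | C.deg y = C.deg x}
  ρ_mul_d : ∀ γ, ρ γ * C.d = C.d * ρ γ
  π_mul_ρ : ∀ γ, C.π * ρ γ = C.π

namespace ComplexAction

variable {Γ : Type} [Group Γ] {X Y : Type} {C : ContractedComplex X} {D : ContractedComplex Y} (a : ComplexAction Γ C)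
  (b : ComplexAction Γ D)

theorem τ_mul_ρ (γ : Γ) : C.τ * a.ρ γ = a.ρ γ * C.τ := by
  refine ContractedComplex.ext_single fun x => ?_
  rw [Module.End.mul_apply, Module.End.mul_apply, C.τ_of_mem (a.ρ_mem γ x), C.τ_single, map_zsmul]

/-- The diagonal action on a tensor product. -/
def tensor : ComplexAction Γ (C.tensor D) where
  ρ :=
    { toFun := fun γ => endTensor (a.ρ γ) (b.ρ γ)
      map_one' := by rw [map_one, map_one, endTensor_one]
      map_mul' := fun γ γ' => by rw [map_mul, map_mul, ← endTensor_mul] }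
  ρ_mem := by
    rintro γ ⟨x, y⟩
    change endTensor (a.ρ γ) (b.ρ γ) _ ∈ _
    rw [endTensor_single]
    refine chTensor_mem_supported (a.ρ_mem γ x) (b.ρ_mem γ y) ?_
    simp only [Set.mem_ofPred_eq]
    intro p hp q hq
    change C.deg p + D.deg q = C.deg x + D.deg y
    lia
  ρ_mul_d γ := by
    change endTensor (a.ρ γ) (b.ρ γ) * (endTensor C.d 1 + endTensor C.τ D.d) =
      (endTensor C.d 1 + endTensor C.τ D.d) * endTensor (a.ρ γ) (b.ρ γ)
    simp only [mul_add, add_mul, endTensor_mul, ρ_mul_d, τ_mul_ρ, one_mul, mul_one]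
  π_mul_ρ γ := by
    change endTensor C.π D.π * endTensor (a.ρ γ) (b.ρ γ) = endTensor C.π D.π
    rw [endTensor_mul, π_mul_ρ, π_mul_ρ]

theorem tensor_ρ_single (γ : Γ) (x : X) (y : Y) :
    (a.tensor b).ρ γ (Finsupp.single (x, y) 1) =
      chTensor _ _ (a.ρ γ (Finsupp.single x 1) ⊗ₜ b.ρ γ (Finsupp.single y 1)) :=
  endTensor_single _ _ _ _

/-- The chains of degree `n`. -/
abbrev graded (C : ContractedComplex X) (n : ℕ) : Submodule ℤ (Ch X) :=
  Finsupp.supported ℤ ℤ {x | C.deg x = n}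

theorem map_graded_le {C : ContractedComplex X} {f : ChEnd X} {n m : ℕ}
    (h : ∀ x, C.deg x = n → f (Finsupp.single x 1) ∈ graded C m) :
    ∀ u ∈ graded C n, f u ∈ graded C m := by
  intro u hu
  rw [← Finsupp.sum_single u, Finsupp.sum, map_sum]
  refine Submodule.sum_mem _ fun x hx => ?_
  have : Finsupp.single x (u x) = u x • Finsupp.single x (1 : ℤ) := by simp
  rw [this, map_zsmul]
  exact Submodule.smul_mem _ _ (h x (hu hx))

theorem d_mem_graded (C : ContractedComplex X) (n : ℕ) :
    ∀ u ∈ graded C (n + 1), C.d u ∈ graded C n :=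
  map_graded_le fun x hx => by simpa [hx] using C.d_mem x

theorem s_mem_graded (C : ContractedComplex X) (n : ℕ) :
    ∀ u ∈ graded C n, C.s u ∈ graded C (n + 1) :=
  map_graded_le fun x hx => by simpa [hx] using C.s_mem x

theorem ρ_mem_graded (γ : Γ) (n : ℕ) : ∀ u ∈ graded C n, a.ρ γ u ∈ graded C n :=
  map_graded_le fun x hx => by simpa [hx] using a.ρ_mem γ x

theorem π_eq_zero (C : ContractedComplex X) (n : ℕ) : ∀ u ∈ graded C (n + 1), C.π u = 0 := by
  intro u hu
  rw [← Finsupp.sum_single u, Finsupp.sum, map_sum]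
  refine Finset.sum_eq_zero fun x hx => ?_
  have h1 : Finsupp.single x (u x) = u x • Finsupp.single x (1 : ℤ) := by simp
  have h2 : C.deg x = n + 1 := hu hx
  rw [h1, map_zsmul, C.π_single, if_neg (by lia), smul_zero]

theorem d_eq_zero (C : ContractedComplex X) : ∀ u ∈ graded C 0, C.d u = 0 := by
  intro u hu
  rw [← Finsupp.sum_single u, Finsupp.sum, map_sum]
  refine Finset.sum_eq_zero fun x hx => ?_
  have h1 : Finsupp.single x (u x) = u x • Finsupp.single x (1 : ℤ) := by simp
  rw [h1, map_zsmul, C.d_single_of_deg_eq_zero (hu hx), smul_zero]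

/-- The representation on the chains of degree `n`. -/
def gradedRep (n : ℕ) : Representation ℤ Γ (graded C n) where
  toFun γ := (a.ρ γ).restrict (a.ρ_mem_graded γ n)
  map_one' := by ext u : 2; simp
  map_mul' γ γ' := by
    ext u : 2
    simp [LinearMap.restrict_apply]

/-- The complex of representations attached to an action on a contracted complex. -/
def complex : ChainComplex (Rep.{0} ℤ Γ) ℕ :=
  ChainComplex.of (fun n => Rep.of (a.gradedRep n))
    (fun n => Rep.ofHom ⟨C.d.restrict (d_mem_graded C n), fun γ => by
      ext u : 2
      exact (LinearMap.congr_fun (a.ρ_mul_d γ) u.1).symm⟩)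
    (fun n => by
      refine rep_hom_ext fun u => Subtype.ext ?_
      exact LinearMap.congr_fun C.d_mul_d u.1)

theorem complex_d_apply (n : ℕ) (u : graded C (n + 1)) :
    (((a.complex).d (n + 1) n).hom u : graded C n).1 = C.d u.1 := by
  exact congrArg (fun f : Rep.of (a.gradedRep (n + 1)) ⟶ Rep.of (a.gradedRep n) => (f.hom u).1)
    (ChainComplex.of_d (fun n => Rep.of (a.gradedRep n)) _ n)

/-- The augmentation. -/
def aug (C : ContractedComplex X) : Ch X →ₗ[ℤ] ℤ := Finsupp.lapply C.base ∘ₗ C.π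

theorem π_eq_aug (C : ContractedComplex X) (u : Ch X) :
    C.π u = aug C u • Finsupp.single C.base 1 := by
  revert u
  refine LinearMap.congr_fun (g := (LinearMap.toSpanSingleton ℤ _ _) ∘ₗ aug C)
    (ContractedComplex.ext_single fun x => ?_)
  by_cases h : C.deg x = 0 <;> simp [aug, C.π_single, h]

/-- The projective resolution attached to a free signed action on a contracted complex. -/
def resolution (hproj : ∀ n, Projective (Rep.of (a.gradedRep n))) :
    ProjectiveResolution (Rep.trivial ℤ Γ ℤ) :=
  resolutionOfExact a.complex hproj
    (Rep.ofHom ⟨aug C ∘ₗ (graded C 0).subtype, fun γ => by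
      ext u
      exact congrArg (fun v => v C.base) (LinearMap.congr_fun (a.π_mul_ρ γ) u.1)⟩)
    (rep_hom_ext fun u => by
      refine (congrArg (aug C) (complex_d_apply a 0 u)).trans ?_
      exact congrArg (fun v => v C.base) (LinearMap.congr_fun C.π_mul_d u.1))
    (fun m => by
      refine ⟨⟨Finsupp.single C.base m, Finsupp.single_mem_supported ℤ _ C.deg_base⟩, ?_⟩
      change aug C (Finsupp.single C.base (m : ℤ)) = (m : ℤ)
      have h1 : Finsupp.single C.base (m : ℤ) = (m : ℤ) • Finsupp.single C.base (1 : ℤ) := by simp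
      rw [h1, map_zsmul]
      simp [aug, C.π_single, C.deg_base])
    (fun u hu => by
      -- On a cycle killed by `π` the identity `d s + s d = 1 - π` reduces to `d (s u) = u`.
      refine ⟨⟨C.s u.1, s_mem_graded C 0 u.1 u.2⟩, Subtype.ext ?_⟩
      refine (complex_d_apply a 0 _).trans ?_
      have h := LinearMap.congr_fun C.homotopy u.1
      have h1 : aug C u.1 = 0 := hu
      simp only [LinearMap.add_apply, Module.End.mul_apply, LinearMap.sub_apply,
        Module.End.one_apply, d_eq_zero C u.1 u.2, map_zero, add_zero, π_eq_aug, h1, zero_smul,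
        sub_zero] at h
      exact h)
    (fun n u hu => by
      refine ⟨⟨C.s u.1, s_mem_graded C (n + 1) u.1 u.2⟩, Subtype.ext ?_⟩
      refine (complex_d_apply a (n + 1) _).trans ?_
      have h := LinearMap.congr_fun C.homotopy u.1
      have h1 : C.d u.1 = 0 := (complex_d_apply a n u).symm.trans (congrArg Subtype.val hu)
      simp only [LinearMap.add_apply, Module.End.mul_apply, LinearMap.sub_apply,
        Module.End.one_apply, h1, map_zero, add_zero, π_eq_zero C n u.1 u.2, sub_zero] at h
      exact h)

end ComplexAction

/-! ### The cellular complex of the line -/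

/-- Half-integer points are numbered by integers; the odd ones are midpoints of edges. -/
def lineDeg (c : ℤ) : ℕ := if Even c then 0 else 1

/-- The endomorphism of chains with given values on basis elements. -/
def chLift {X : Type} (f : X → Ch X) : ChEnd X := Finsupp.linearCombination ℤ f

theorem chLift_single {X : Type} (f : X → Ch X) (x : X) :
    chLift f (Finsupp.single x 1) = f x := by
  simp [chLift, Finsupp.linearCombination_single]

/-- The chain of edges from `0` to the vertex `2 * m`. -/
def linePath : ℤ → Ch ℤ
  | Int.ofNat m => ∑ k ∈ Finset.range m, Finsupp.single (2 * (k : ℤ) + 1) 1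
  | Int.negSucc m => -∑ k ∈ Finset.range (m + 1), Finsupp.single (-(2 * (k : ℤ) + 1)) 1

theorem linePath_add_one (m : ℤ) :
    linePath (m + 1) = linePath m + Finsupp.single (2 * m + 1) 1 := by
  rcases m with m | m
  · change linePath (Int.ofNat (m + 1)) = _
    simp only [linePath, Finset.sum_range_succ]
    rfl
  · rcases m with _ | m
    · change linePath (Int.ofNat 0) = _
      simp [linePath]
    · have h : Int.negSucc (m + 1) + 1 = Int.negSucc m := by lia
      have h' : 2 * Int.negSucc (m + 1) + 1 = -(2 * ((m + 1 : ℕ) : ℤ) + 1) := by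
        rw [Int.negSucc_eq]; push_cast; ring
      rw [h, h']
      simp only [linePath]
      rw [Finset.sum_range_succ (fun k : ℕ => Finsupp.single (-(2 * (k : ℤ) + 1)) (1 : ℤ)) (m + 1)]
      abel

theorem linePath_mem (m : ℤ) : linePath m ∈ Finsupp.supported ℤ ℤ {y | lineDeg y = 1} := by
  have h : ∀ k : ℤ, lineDeg (2 * k + 1) = 1 := fun k => by
    rw [lineDeg, if_neg (by simp)]
  rcases m with m | m
  · exact Submodule.sum_mem _ fun k _ => Finsupp.single_mem_supported ℤ _ (h k)
  · refine Submodule.neg_mem _ (Submodule.sum_mem _ fun k _ => Finsupp.single_mem_supported ℤ _ ?_)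
    have : -(2 * (k : ℤ) + 1) = 2 * (-k - 1) + 1 := by ring
    rw [this]
    exact h _

/-- The boundary of a cell of the line. -/
def lineBoundary (c : ℤ) : Ch ℤ :=
  if Even c then 0 else Finsupp.single (c + 1) 1 - Finsupp.single (c - 1) 1

/-- The cellular chain complex of the line. -/
def lineComplex : ContractedComplex ℤ where
  deg := lineDeg
  base := 0
  d := chLift lineBoundary
  s := chLift fun c => if Even c then linePath (c / 2) else 0
  π := augProj lineDeg 0
  deg_base := by simp [lineDeg]
  π_single := augProj_single _ _
  d_mem c := by
    rw [chLift_single, lineBoundary]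
    split_ifs with h
    · exact Submodule.zero_mem _
    · have h1 : Even (c + 1) := (Int.not_even_iff_odd.1 h).add_one
      have h2 : Even (c - 1) := (Int.not_even_iff_odd.1 h).sub_odd odd_one
      exact Submodule.sub_mem _ (Finsupp.single_mem_supported ℤ _ (by simp [lineDeg, h, h1]))
        (Finsupp.single_mem_supported ℤ _ (by simp [lineDeg, h, h2]))
  s_mem c := by
    rw [chLift_single]
    split_ifs with h
    · simpa [lineDeg, h] using linePath_mem (c / 2)
    · exact Submodule.zero_mem _
  d_mul_d := by
    refine ContractedComplex.ext_single fun c => ?_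
    rw [Module.End.mul_apply, chLift_single, lineBoundary]
    split_ifs with h
    · simp
    · have h1 : Even (c + 1) := (Int.not_even_iff_odd.1 h).add_one
      have h2 : Even (c - 1) := (Int.not_even_iff_odd.1 h).sub_odd odd_one
      rw [map_sub, chLift_single, chLift_single, lineBoundary, lineBoundary, if_pos h1, if_pos h2]
      simp
  π_mul_d := by
    refine ContractedComplex.ext_single fun c => ?_
    rw [Module.End.mul_apply, chLift_single, lineBoundary]
    split_ifs with h
    · simp
    · have h1 : Even (c + 1) := (Int.not_even_iff_odd.1 h).add_one
      have h2 : Even (c - 1) := (Int.not_even_iff_odd.1 h).sub_odd odd_one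
      rw [map_sub, augProj_single, augProj_single, lineDeg, lineDeg, if_pos h1, if_pos h2]
      simp
  homotopy := by
    have hpath : ∀ m : ℤ, chLift lineBoundary (linePath m) =
        Finsupp.single (2 * m) 1 - Finsupp.single 0 1 := by
      have hstep : ∀ m : ℤ, chLift lineBoundary (Finsupp.single (2 * m + 1) 1) =
          Finsupp.single (2 * (m + 1)) 1 - Finsupp.single (2 * m) 1 := fun m => by
        rw [chLift_single, lineBoundary, if_neg (by simp)]
        congr 2 <;> ring
      intro m
      induction m using Int.induction_on with
      | zero =>
        change chLift lineBoundary (∑ k ∈ Finset.range 0, _) = _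
        simp
      | succ m ih =>
        rw [linePath_add_one, map_add, ih, hstep]
        abel
      | pred m ih =>
        have h := linePath_add_one (-(m : ℤ) - 1)
        have h' := hstep (-(m : ℤ) - 1)
        rw [sub_add_cancel] at h h'
        rw [h, map_add, h'] at ih
        rw [← sub_eq_zero] at ih ⊢
        rw [← ih]
        abel
    refine ContractedComplex.ext_single fun c => ?_
    simp only [LinearMap.add_apply, Module.End.mul_apply, LinearMap.sub_apply,
      Module.End.one_apply, chLift_single, augProj_single]
    by_cases h : Even c
    · obtain ⟨m, rfl⟩ := h
      have h2 : Even (m + m) := ⟨m, rfl⟩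
      have h3 : (m + m) / 2 = m := by lia
      have hd : lineDeg (m + m) = 0 := if_pos h2
      rw [lineBoundary, if_pos h2, if_pos h2, if_pos hd, map_zero, add_zero, h3, hpath,
        two_mul]
    · obtain ⟨m, rfl⟩ := Int.not_even_iff_odd.1 h
      have h1 : Even (2 * m + 1 + 1) := ⟨m + 1, by ring⟩
      have h2 : Even (2 * m + 1 - 1) := ⟨m, by ring⟩
      have h3 : (2 * m + 1 + 1) / 2 = m + 1 := by lia
      have h4 : (2 * m + 1 - 1) / 2 = m := by lia
      have hd : lineDeg (2 * m + 1) ≠ 0 := by rw [lineDeg, if_neg h]; exact one_ne_zero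
      rw [lineBoundary, if_neg h, if_neg h, if_neg hd, map_zero, zero_add,
        map_sub, chLift_single, chLift_single, if_pos h1, if_pos h2, h3, h4, linePath_add_one]
      abel

/-! ### The periodic complex of the cyclic group of order four -/

/-- The boundary in the periodic complex. -/
def cyclicBoundary : ℕ × ZMod 4 → Ch (ℕ × ZMod 4)
  | (0, _) => 0
  | (i + 1, g) => if Even i then Finsupp.single (i, g + 1) 1 - Finsupp.single (i, g) 1
      else ∑ h : ZMod 4, Finsupp.single (i, h) 1

/-- The contraction of the periodic complex. -/
def cyclicContraction (x : ℕ × ZMod 4) : Ch (ℕ × ZMod 4) :=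
  -- In even degree this is the path `0, 1, …, g - 1`, whose boundary telescopes to `g - 0`. In odd
  -- degree only `g = 3`, the edge closing the circle, is not already recovered by `s d`; the norm
  -- supplies it.
  if Even x.1 then ∑ k ∈ Finset.range x.2.val, Finsupp.single (x.1 + 1, (k : ZMod 4)) 1
  else if x.2 = 3 then Finsupp.single (x.1 + 1, 0) 1 else 0

theorem sum_zmod_four {M : Type*} [AddCommMonoid M] (f : ZMod 4 → M) :
    ∑ h, f h = f 0 + f 1 + f 2 + f 3 :=
  Fin.sum_univ_four f

/-- The periodic complex of the cyclic group of order four. -/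
def cyclicComplex : ContractedComplex (ℕ × ZMod 4) where
  deg x := x.1
  base := (0, 0)
  d := chLift cyclicBoundary
  s := chLift cyclicContraction
  π := augProj _ _
  deg_base := rfl
  π_single := augProj_single _ _
  d_mem := by
    rintro ⟨i, g⟩
    rw [chLift_single]
    rcases i with _ | i
    · exact Submodule.zero_mem _
    · rw [cyclicBoundary]
      split_ifs
      · exact Submodule.sub_mem _ (Finsupp.single_mem_supported ℤ _ rfl)
          (Finsupp.single_mem_supported ℤ _ rfl)
      · exact Submodule.sum_mem _ fun _ _ => Finsupp.single_mem_supported ℤ _ rfl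
  s_mem := by
    rintro ⟨i, g⟩
    rw [chLift_single, cyclicContraction]
    split_ifs
    · exact Submodule.sum_mem _ fun _ _ => Finsupp.single_mem_supported ℤ _ rfl
    · exact Finsupp.single_mem_supported ℤ _ rfl
    · exact Submodule.zero_mem _
  d_mul_d := by
    refine ContractedComplex.ext_single ?_
    rintro ⟨i, g⟩
    rw [Module.End.mul_apply, chLift_single]
    rcases i with _ | _ | i
    · simp [cyclicBoundary]
    · simp [cyclicBoundary, chLift_single]
    · by_cases h : Even i
      · have h' : ¬ Even (i + 1) := by simpa [Nat.even_add_one] using h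
        simp only [cyclicBoundary, h, h', if_true, if_false, map_sum, chLift_single,
          Finset.sum_sub_distrib, LinearMap.zero_apply]
        rw [sub_eq_zero]
        exact Equiv.sum_comp (Equiv.addRight (1 : ZMod 4))
          fun x => (Finsupp.single (i, x) (1 : ℤ) : Ch (ℕ × ZMod 4))
      · have h' : Even (i + 1) := by simpa [Nat.even_add_one] using h
        simp [cyclicBoundary, h, h', chLift_single]
  π_mul_d := by
    refine ContractedComplex.ext_single ?_
    rintro ⟨i, g⟩
    rw [Module.End.mul_apply, chLift_single]
    rcases i with _ | _ | i
    · simp [cyclicBoundary]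
    · simp [cyclicBoundary, augProj_single]
    · by_cases h : Even (i + 1) <;> simp [cyclicBoundary, augProj_single, h]
  homotopy := by
    refine ContractedComplex.ext_single ?_
    rintro ⟨i, g⟩
    have h0 : (0 : ZMod 4).val = 0 := rfl
    have h1 : (1 : ZMod 4).val = 1 := rfl
    have h2 : (2 : ZMod 4).val = 2 := rfl
    have h3 : (3 : ZMod 4).val = 3 := rfl
    have e1 : (1 : ZMod 4) + 1 = 2 := rfl
    have e2 : (2 : ZMod 4) + 1 = 3 := rfl
    have e3 : (3 : ZMod 4) + 1 = 0 := rfl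
    have hg : g = 0 ∨ g = 1 ∨ g = 2 ∨ g = 3 := by revert g; decide
    simp only [LinearMap.add_apply, Module.End.mul_apply, LinearMap.sub_apply,
      Module.End.one_apply, chLift_single, augProj_single]
    rcases i with _ | i
    · rcases hg with rfl | rfl | rfl | rfl <;>
        simp [cyclicBoundary, cyclicContraction, chLift_single, h0, h1, h2, h3,
          Finset.sum_range_succ, e1, e2]
    · by_cases h : Even i
      · have h' : ¬ Even (i + 1) := by simpa [Nat.even_add_one] using h
        rcases hg with rfl | rfl | rfl | rfl <;>
        simp [cyclicBoundary, cyclicContraction, chLift_single, h0, h1, h2, h3, h, h',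
          Finset.sum_range_succ, e1, e2, e3, sum_zmod_four] <;> abel
      · have h' : Even (i + 1) := by simpa [Nat.even_add_one] using h
        rcases hg with rfl | rfl | rfl | rfl <;>
        simp [cyclicBoundary, cyclicContraction, chLift_single, h0, h1, h2, h3, h, h',
          Finset.sum_range_succ, e1, e2]

/-! ### Rotations of periodic complexes -/

/-- The endomorphism sending each cell to a cell, with a sign. -/
def signedMap {X : Type} (f : X → X) (u : X → ℤˣ) : ChEnd X :=
  chLift fun x => Finsupp.single (f x) (u x : ℤ)

section signedMap

variable {X Y : Type}

theorem signedMap_single (f : X → X) (u : X → ℤˣ) (x : X) :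
    signedMap f u (Finsupp.single x 1) = Finsupp.single (f x) (u x : ℤ) :=
  chLift_single _ _

theorem signedMap_single' (f : X → X) (u : X → ℤˣ) (x : X) (m : ℤ) :
    signedMap f u (Finsupp.single x m) = Finsupp.single (f x) (m * (u x : ℤ)) := by
  have h : Finsupp.single x m = m • Finsupp.single x (1 : ℤ) := by simp
  rw [h, map_zsmul, signedMap_single, Finsupp.smul_single, smul_eq_mul]

theorem signedMap_mul (f g : X → X) (u v : X → ℤˣ) :
    signedMap f u * signedMap g v = signedMap (f ∘ g) fun x => v x * u (g x) := by
  refine ContractedComplex.ext_single fun x => ?_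
  rw [Module.End.mul_apply, signedMap_single, signedMap_single', signedMap_single, Units.val_mul]
  rfl

theorem signedMap_id : signedMap (id : X → X) 1 = 1 := by
  refine ContractedComplex.ext_single fun x => ?_
  rw [signedMap_single]
  rfl

theorem endTensor_signedMap (f : X → X) (u : X → ℤˣ) (g : Y → Y) (v : Y → ℤˣ) :
    endTensor (signedMap f u) (signedMap g v) =
      signedMap (Prod.map f g) fun x => u x.1 * v x.2 := by
  refine ContractedComplex.ext_single fun ⟨x, y⟩ => ?_
  rw [endTensor_single, signedMap_single, signedMap_single, signedMap_single, chTensor_single,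
    Units.val_mul]
  rfl

theorem signedMap_mem {C : ContractedComplex X} {f : X → X} (u : X → ℤˣ)
    (h : ∀ x, C.deg (f x) = C.deg x) (x : X) :
    signedMap f u (Finsupp.single x 1) ∈ Finsupp.supported ℤ ℤ {y | C.deg y = C.deg x} := by
  rw [signedMap_single]
  exact Finsupp.single_mem_supported ℤ _ (h x)

theorem τ_mul_signedMap {C : ContractedComplex X} {f : X → X} (u : X → ℤˣ)
    (h : ∀ x, C.deg (f x) = C.deg x) : C.τ * signedMap f u = signedMap f u * C.τ := by
  refine ContractedComplex.ext_single fun x => ?_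
  rw [Module.End.mul_apply, Module.End.mul_apply, C.τ_of_mem (signedMap_mem u h x), C.τ_single,
    map_zsmul]

theorem tensor_d_comm {C : ContractedComplex X} {D : ContractedComplex Y} {F : ChEnd X}
    {G : ChEnd Y} (hF : C.d * F = F * C.d) (hG : D.d * G = G * D.d) (hτ : C.τ * F = F * C.τ) :
    (C.tensor D).d * endTensor F G = endTensor F G * (C.tensor D).d := by
  change (endTensor C.d 1 + endTensor C.τ D.d) * _ = _ * (endTensor C.d 1 + endTensor C.τ D.d)
  simp only [add_mul, mul_add, endTensor_mul, hF, hG, hτ, one_mul, mul_one]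

end signedMap

/-- Translation of cells by twice a vector. -/
def translate {X : Type} [AddCommGroup X] (z : X) : ChEnd X := signedMap (fun x => x + (z + z)) 1

theorem translate_single {X : Type} [AddCommGroup X] (z x : X) :
    translate z (Finsupp.single x 1) = Finsupp.single (x + (z + z)) 1 :=
  signedMap_single _ _ _

theorem translate_prod {X Y : Type} [AddCommGroup X] [AddCommGroup Y] (z : X) (w : Y) :
    translate (z, w) = endTensor (translate z) (translate w) := by
  rw [translate, translate, translate, endTensor_signedMap]
  congr 1

/-- Freezing a cell in one factor turns an invariant functional on the product into an invariant
functional on the other factor, so both terms of the differential vanish separately. -/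
theorem tensor_coinv_d {X Y : Type} [AddCommGroup X] [AddCommGroup Y] {C : ContractedComplex X}
    {D : ContractedComplex Y}
    (hC : ∀ (A : Type) [AddCommGroup A] (h : Ch X →+ A),
      (∀ z u, h (translate z u) = h u) → ∀ u, h (C.d u) = 0)
    (hD : ∀ (A : Type) [AddCommGroup A] (h : Ch Y →+ A),
      (∀ z u, h (translate z u) = h u) → ∀ u, h (D.d u) = 0)
    (A : Type) [AddCommGroup A] (h : Ch (X × Y) →+ A) (hh : ∀ z u, h (translate z u) = h u)
    (u : Ch (X × Y)) : h ((C.tensor D).d u) = 0 := by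
  have hR : ∀ (u : Ch X) (y : Y), h (chTensor X Y (C.d u ⊗ₜ Finsupp.single y 1)) = 0 := by
    intro u y
    refine hC A (h.comp ((chTensor X Y).toLinearMap ∘ₗ
      (TensorProduct.mk ℤ _ _).flip (Finsupp.single y 1)).toAddMonoidHom) (fun z u => ?_) u
    have h1 := hh (z, 0) (chTensor X Y (u ⊗ₜ Finsupp.single y 1))
    rw [translate_prod, endTensor_chTensor, translate_single, add_zero, add_zero] at h1
    exact h1
  have hS : ∀ (x : X) (u : Ch Y), h (chTensor X Y (Finsupp.single x 1 ⊗ₜ D.d u)) = 0 := by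
    intro x u
    refine hD A (h.comp ((chTensor X Y).toLinearMap ∘ₗ
      (TensorProduct.mk ℤ _ _) (Finsupp.single x 1)).toAddMonoidHom) (fun z u => ?_) u
    have h1 := hh (0, z) (chTensor X Y (Finsupp.single x 1 ⊗ₜ u))
    rw [translate_prod, endTensor_chTensor, translate_single, add_zero, add_zero] at h1
    exact h1
  have h0 : (h.comp (C.tensor D).d.toAddMonoidHom).toIntLinearMap = 0 := by
    refine ContractedComplex.ext_single fun ⟨x, y⟩ => ?_
    change h ((C.tensor D).d (Finsupp.single (x, y) 1)) = 0
    rw [ContractedComplex.tensor_d_single, map_add, map_zsmul, hR, hS, smul_zero, add_zero]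
  exact LinearMap.congr_fun h0 u

/-- A contracted complex whose cells form an abelian group `X`, that is invariant under translation
by `2 * X` and under a signed rotation of order four. The cells modulo `2 * X` are given by `V`. -/
structure Rotation {X : Type} [AddCommGroup X] (C : ContractedComplex X) (V : Type) where
  /-- Reduction of a cell. -/
  q : X → V
  /-- Representatives of reduced cells. -/
  σ : V → X
  q_σ : ∀ v, q (σ v) = v
  exists_of_q_eq : ∀ x y, q x = q y → ∃ z, x = y + (z + z)
  q_add : ∀ x z, q (x + (z + z)) = q x
  /-- The rotation of cells. -/
  r : X →+ X
  /-- The rotation of reduced cells. -/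
  rV : V → V
  q_r : ∀ x, q (r x) = rV (q x)
  -- On reduced cells the rotation has order at most two, although `r` has order four on cells: the
  -- half turn only changes signs there. This bounds orbits by two elements.
  rV_rV : ∀ v, rV (rV v) = v
  r_four : ∀ x, r (r (r (r x))) = x
  /-- The sign of the rotation. -/
  ε : V → ℤˣ
  /-- The degree of a reduced cell. -/
  degV : V → ℕ
  deg_eq : ∀ x, C.deg x = degV (q x)
  degV_rV : ∀ v, degV (rV v) = degV v
  -- Vertices carry no orientation; this makes the rotation compatible with the augmentation.
  ε_of_degV : ∀ v, degV v = 0 → ε v = 1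
  d_translate : ∀ z, C.d * translate z = translate z * C.d
  d_rot : C.d * signedMap r (fun x => ε (q x)) = signedMap r (fun x => ε (q x)) * C.d
  -- Minimality of the cell structure: the differential induced on the quotient by translations is
  -- zero.
  coinv_d : ∀ (A : Type) [AddCommGroup A] (h : Ch X →+ A),
    (∀ z u, h (translate z u) = h u) → ∀ u, h (C.d u) = 0

namespace Rotation

variable {X Y V W : Type} [AddCommGroup X] [AddCommGroup Y] {C : ContractedComplex X}
  {D : ContractedComplex Y} (R : Rotation C V) (S : Rotation D W)

/-- The signed rotation of chains. -/
def rot : ChEnd X := signedMap R.r fun x => R.ε (R.q x)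

theorem deg_r (x : X) : C.deg (R.r x) = C.deg x := by
  rw [R.deg_eq, R.deg_eq, R.q_r, R.degV_rV]

theorem deg_add (R : Rotation C V) (x z : X) : C.deg (x + (z + z)) = C.deg x := by
  rw [R.deg_eq, R.deg_eq, R.q_add]

/-- The product of two rotations. -/
def prod : Rotation (C.tensor D) (V × W) where
  q x := (R.q x.1, S.q x.2)
  σ v := (R.σ v.1, S.σ v.2)
  q_σ v := by rw [R.q_σ, S.q_σ]
  exists_of_q_eq x y h := by
    obtain ⟨z, hz⟩ := R.exists_of_q_eq _ _ (congrArg Prod.fst h)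
    obtain ⟨w, hw⟩ := S.exists_of_q_eq _ _ (congrArg Prod.snd h)
    exact ⟨(z, w), Prod.ext hz hw⟩
  q_add x z := Prod.ext (R.q_add _ _) (S.q_add _ _)
  r := R.r.prodMap S.r
  rV v := (R.rV v.1, S.rV v.2)
  q_r x := Prod.ext (R.q_r _) (S.q_r _)
  rV_rV v := Prod.ext (R.rV_rV _) (S.rV_rV _)
  r_four x := Prod.ext (R.r_four _) (S.r_four _)
  ε v := R.ε v.1 * S.ε v.2
  degV v := R.degV v.1 + S.degV v.2
  deg_eq x := congrArg₂ (· + ·) (R.deg_eq _) (S.deg_eq _)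
  degV_rV v := congrArg₂ (· + ·) (R.degV_rV _) (S.degV_rV _)
  ε_of_degV v h := by
    rw [R.ε_of_degV _ (by lia), S.ε_of_degV _ (by lia), one_mul]
  d_translate z := by
    rw [← Prod.mk.eta (p := z), translate_prod]
    exact tensor_d_comm (R.d_translate _) (S.d_translate _) (τ_mul_signedMap _ fun x => R.deg_add x _)
  d_rot := by
    have h : endTensor R.rot S.rot = signedMap (R.r.prodMap S.r)
        fun x : X × Y => R.ε (R.q x.1) * S.ε (S.q x.2) := endTensor_signedMap _ _ _ _
    rw [← h]
    exact tensor_d_comm R.d_rot S.d_rot (τ_mul_signedMap _ R.deg_r)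
  coinv_d := tensor_coinv_d R.coinv_d S.coinv_d

end Rotation

/-! ### The rotations of the plane -/

/-- The cellular chain complex of the plane. -/
abbrev planeComplex : ContractedComplex (ℤ × ℤ) := lineComplex.tensor lineComplex

theorem lineComplex_d_even {c : ℤ} (h : Even c) : lineComplex.d (Finsupp.single c 1) = 0 := by
  change chLift lineBoundary _ = _
  rw [chLift_single, lineBoundary, if_pos h]

theorem lineComplex_d_odd {c : ℤ} (h : ¬ Even c) :
    lineComplex.d (Finsupp.single c 1) = Finsupp.single (c + 1) 1 - Finsupp.single (c - 1) 1 := by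
  change chLift lineBoundary _ = _
  rw [chLift_single, lineBoundary, if_neg h]

theorem lineComplex_d_translate (z : ℤ) :
    lineComplex.d * translate z = translate z * lineComplex.d := by
  refine ContractedComplex.ext_single fun c => ?_
  rw [Module.End.mul_apply, Module.End.mul_apply, translate_single]
  have hz : Even (z + z) := ⟨z, rfl⟩
  by_cases h : Even c
  · rw [lineComplex_d_even h, lineComplex_d_even (h.add hz), map_zero]
  · have h' : ¬ Even (c + (z + z)) := fun h' => h (by simpa using h'.sub hz)
    rw [lineComplex_d_odd h, lineComplex_d_odd h', map_sub, translate_single, translate_single]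
    congr 2 <;> ring

/-- The two ends of an edge are translates of each other, so the boundary of an edge dies in the
circle. -/
theorem lineComplex_coinv_d (A : Type) [AddCommGroup A] (h : Ch ℤ →+ A)
    (hh : ∀ z u, h (translate z u) = h u) (u : Ch ℤ) : h (lineComplex.d u) = 0 := by
  have h0 : (h.comp lineComplex.d.toAddMonoidHom).toIntLinearMap = 0 := by
    refine ContractedComplex.ext_single fun c => ?_
    change h (lineComplex.d (Finsupp.single c 1)) = 0
    by_cases hc : Even c
    · rw [lineComplex_d_even hc, map_zero]
    · have h1 := hh 1 (Finsupp.single (c - 1) 1)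
      rw [translate_single, sub_add_add_cancel] at h1
      rw [lineComplex_d_odd hc, map_sub, h1, sub_self]
  exact LinearMap.congr_fun h0 u

theorem intCast_zmod_two_of_even {c : ℤ} (h : Even c) : (c : ZMod 2) = 0 :=
  (ZMod.intCast_zmod_eq_zero_iff_dvd c 2).2 h.two_dvd

theorem intCast_zmod_two_of_not_even {c : ℤ} (h : ¬ Even c) : (c : ZMod 2) = 1 := by
  obtain ⟨m, rfl⟩ := Int.not_even_iff_odd.1 h
  have : ((2 : ℤ) : ZMod 2) = 0 := rfl
  push_cast at this ⊢
  rw [this, zero_mul, zero_add]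

theorem lineDeg_eq (c : ℤ) : lineDeg c = (c : ZMod 2).val := by
  by_cases h : Even c
  · rw [lineDeg, if_pos h, intCast_zmod_two_of_even h, ZMod.val_zero]
  · rw [lineDeg, if_neg h, intCast_zmod_two_of_not_even h]
    rfl

theorem exists_add_double {a b : ℤ} (h : (a : ZMod 2) = b) : ∃ z, a = b + (z + z) := by
  obtain ⟨z, hz⟩ := (ZMod.intCast_eq_intCast_iff_dvd_sub b a 2).1 h.symm
  exact ⟨z, by push_cast at hz; lia⟩

theorem intCast_add_double (a z : ℤ) : ((a + (z + z) : ℤ) : ZMod 2) = a := by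
  have h : Even (z + z) := ⟨z, rfl⟩
  rw [Int.cast_add, intCast_zmod_two_of_even h, add_zero]

/-- The cells of a square with opposite sides identified. -/
abbrev Square : Type := ZMod 2 × ZMod 2

/-- A rotation of the plane that permutes the standard cells. -/
def planeRotation (r : ℤ × ℤ →+ ℤ × ℤ) (rV : Square → Square) (ε : Square → ℤˣ)
    (q_r : ∀ x, (((r x).1 : ZMod 2), ((r x).2 : ZMod 2)) = rV ((x.1 : ZMod 2), (x.2 : ZMod 2)))
    (rV_rV : ∀ v, rV (rV v) = v) (r_four : ∀ x, r (r (r (r x))) = x)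
    (degV_rV : ∀ v, (rV v).1.val + (rV v).2.val = v.1.val + v.2.val)
    (ε_of_degV : ∀ v : Square, v.1.val + v.2.val = 0 → ε v = 1)
    (d_rot : ∀ x, planeComplex.d (Finsupp.single (r x) 1) = (ε ((x.1 : ZMod 2), (x.2 : ZMod 2)) : ℤ) •
      signedMap r (fun x => ε ((x.1 : ZMod 2), (x.2 : ZMod 2)))
        (planeComplex.d (Finsupp.single x 1))) : Rotation planeComplex Square where
  q x := (x.1, x.2)
  σ v := (v.1.val, v.2.val)
  q_σ v := by simp
  exists_of_q_eq x y h := by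
    obtain ⟨z, hz⟩ := exists_add_double (congrArg Prod.fst h)
    obtain ⟨w, hw⟩ := exists_add_double (congrArg Prod.snd h)
    exact ⟨(z, w), Prod.ext hz hw⟩
  q_add x z := Prod.ext (intCast_add_double _ _) (intCast_add_double _ _)
  r := r
  rV := rV
  q_r := q_r
  rV_rV := rV_rV
  r_four := r_four
  ε := ε
  degV v := v.1.val + v.2.val
  deg_eq x := congrArg₂ (· + ·) (lineDeg_eq _) (lineDeg_eq _)
  degV_rV := degV_rV
  ε_of_degV := ε_of_degV
  d_translate z := by
    rw [← Prod.mk.eta (p := z), translate_prod]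
    refine tensor_d_comm (lineComplex_d_translate _) (lineComplex_d_translate _)
      (τ_mul_signedMap _ fun x => ?_)
    change lineDeg _ = lineDeg _
    rw [lineDeg_eq, lineDeg_eq, intCast_add_double]
  d_rot := by
    refine ContractedComplex.ext_single fun x => ?_
    rw [Module.End.mul_apply, Module.End.mul_apply, signedMap_single,
      ← mul_one (Units.val _), ← smul_eq_mul, ← Finsupp.smul_single, map_zsmul, d_rot, smul_smul,
      ← Units.val_mul, Int.units_mul_self, Units.val_one, one_smul]
  coinv_d := tensor_coinv_d lineComplex_coinv_d lineComplex_coinv_d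

theorem planeComplex_d_single (a b : ℤ) : planeComplex.d (Finsupp.single (a, b) 1) =
    (if Even a then 0 else Finsupp.single (a + 1, b) 1 - Finsupp.single (a - 1, b) 1) +
      (if Even a then 1 else (-1 : ℤ)) •
        (if Even b then 0 else Finsupp.single (a, b + 1) 1 - Finsupp.single (a, b - 1) 1) := by
  rw [ContractedComplex.tensor_d_single]
  have h : (-1 : ℤ) ^ lineComplex.deg a = if Even a then 1 else (-1 : ℤ) := by
    change (-1 : ℤ) ^ lineDeg a = _
    rw [lineDeg]
    split_ifs <;> simp
  rw [h]
  by_cases ha : Even a <;> by_cases hb : Even b <;>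
    simp only [ha, hb, lineComplex_d_even, lineComplex_d_odd, not_false_eq_true, if_true, if_false,
      TensorProduct.zero_tmul, TensorProduct.tmul_zero, TensorProduct.sub_tmul,
      TensorProduct.tmul_sub, map_sub, map_zero, chTensor_single, mul_one]

/-- The rotation by a half turn. -/
def halfTurn : Rotation planeComplex Square :=
  -- A half turn reverses edges of either direction and preserves the orientation of squares.
  planeRotation (-AddMonoidHom.id _) id (fun v => if v.1 = v.2 then 1 else -1)
    (fun x => by
      have h : ∀ a : ZMod 2, -a = a := by decide
      simp [h])
    (fun _ => rfl) (fun x => by simp) (fun _ => rfl) (by decide)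
    (by
      rintro ⟨a, b⟩
      change planeComplex.d (Finsupp.single (-a, -b) 1) = _
      rw [planeComplex_d_single, planeComplex_d_single]
      have h01 : (0 : ZMod 2) ≠ 1 := by decide
      have e1 : -a + 1 = -(a - 1) := by ring
      have e2 : -a - 1 = -(a + 1) := by ring
      have e3 : -b + 1 = -(b - 1) := by ring
      have e4 : -b - 1 = -(b + 1) := by ring
      by_cases ha : Even a <;> by_cases hb : Even b <;>
        simp [ha, hb, signedMap_single, intCast_zmod_two_of_even, intCast_zmod_two_of_not_even,
          h01, h01.symm, e1, e2, e3, e4] <;> abel)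

/-- The rotation by a quarter turn. -/
def quarterTurn : Rotation planeComplex Square :=
  planeRotation
    { toFun := fun x => (-x.2, x.1)
      map_zero' := by simp
      map_add' := fun x y => by ext <;> simp [add_comm] }
    -- A quarter turn sends horizontal edges to upward vertical ones and vertical edges to reversed
    -- horizontal ones; squares keep their orientation.
    (fun v => (v.2, v.1)) (fun v => if v = (0, 1) then -1 else 1)
    (fun x => by
      have h : ∀ a : ZMod 2, -a = a := by decide
      simp [h])
    (fun _ => rfl) (fun x => by simp) (fun _ => add_comm _ _) (by decide)
    (by
      rintro ⟨a, b⟩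
      change planeComplex.d (Finsupp.single (-b, a) 1) = _
      rw [planeComplex_d_single, planeComplex_d_single]
      have h01 : (0 : ZMod 2) ≠ 1 := by decide
      have h11 : (1 : ZMod 2) + 1 = 0 := rfl
      have e3 : -b + 1 = -(b - 1) := by ring
      have e4 : -b - 1 = -(b + 1) := by ring
      by_cases ha : Even a <;> by_cases hb : Even b <;>
        simp [ha, hb, signedMap_single, intCast_zmod_two_of_even, intCast_zmod_two_of_not_even,
          h01, h01.symm, h11, e3, e4]
      all_goals abel)

/-! ### The action of the group on a periodic complex with a rotation -/

theorem translate_zero {X : Type} [AddCommGroup X] : translate (0 : X) = 1 := by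
  refine ContractedComplex.ext_single fun x => ?_
  rw [translate_single, add_zero, add_zero, Module.End.one_apply]

theorem translate_add {X : Type} [AddCommGroup X] (z w : X) :
    translate (z + w) = translate z * translate w := by
  refine ContractedComplex.ext_single fun x => ?_
  rw [Module.End.mul_apply, translate_single, translate_single, translate_single]
  congr 1
  abel

namespace Rotation

variable {X V : Type} [AddCommGroup X] {C : ContractedComplex X} (R : Rotation C V)

theorem rot_single (x : X) :
    R.rot (Finsupp.single x 1) = Finsupp.single (R.r x) (R.ε (R.q x) : ℤ) :=
  signedMap_single _ _ _

theorem rot_mul_translate (z : X) : R.rot * translate z = translate (R.r z) * R.rot := by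
  refine ContractedComplex.ext_single fun x => ?_
  rw [Module.End.mul_apply, Module.End.mul_apply, translate_single, rot_single, rot_single,
    translate, signedMap_single', R.q_add, map_add, map_add]
  simp

theorem rot_pow_mul_translate (n : ℕ) (z : X) :
    R.rot ^ n * translate z = translate (R.r^[n] z) * R.rot ^ n := by
  induction n generalizing z with
  | zero => simp
  | succ n ih => rw [pow_succ, mul_assoc, rot_mul_translate, ← mul_assoc, ih, mul_assoc]; rfl

/-- The sign of an iterated rotation. -/
def εPow : ℕ → V → ℤˣ
  | 0, _ => 1
  | n + 1, v => R.ε v * εPow n (R.rV v)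

theorem rot_pow_single (n : ℕ) (x : X) :
    (R.rot ^ n) (Finsupp.single x 1) = Finsupp.single (R.r^[n] x) (R.εPow n (R.q x) : ℤ) := by
  induction n generalizing x with
  | zero => simp [εPow]
  | succ n ih =>
    rw [pow_succ, Module.End.mul_apply, rot_single, ← mul_one (Units.val _), ← smul_eq_mul,
      ← Finsupp.smul_single, map_zsmul, ih, Finsupp.smul_single, smul_eq_mul, R.q_r,
      ← Units.val_mul]
    rfl

/-- Along four steps each of the two signs on an orbit of reduced cells is met twice. -/
theorem rot_pow_four : R.rot ^ 4 = 1 := by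
  refine ContractedComplex.ext_single fun x => ?_
  rw [rot_pow_single, Module.End.one_apply]
  have h : ∀ u v : ℤˣ, u * (v * (u * (v * 1))) = 1 := by decide
  simp only [εPow, Function.iterate_succ_apply, Function.iterate_zero_apply, R.r_four, R.rV_rV, h,
    Units.val_one]

theorem rot_pow_add (a b : ZMod 4) : R.rot ^ (a + b).val = R.rot ^ a.val * R.rot ^ b.val := by
  rw [ZMod.val_add, ← pow_add, ← pow_eq_pow_mod _ R.rot_pow_four]

theorem deg_iterate (n : ℕ) (x : X) : C.deg (R.r^[n] x) = C.deg x := by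
  induction n generalizing x with
  | zero => rfl
  | succ n ih => rw [Function.iterate_succ_apply, ih, R.deg_r]

theorem rV_iterate_deg (n : ℕ) (v : V) : R.degV (R.rV^[n] v) = R.degV v := by
  induction n generalizing v with
  | zero => rfl
  | succ n ih => rw [Function.iterate_succ_apply, ih, R.degV_rV]

theorem q_iterate (n : ℕ) (x : X) : R.q (R.r^[n] x) = R.rV^[n] (R.q x) := by
  induction n generalizing x with
  | zero => rfl
  | succ n ih => rw [Function.iterate_succ_apply, ih, R.q_r, Function.iterate_succ_apply]

theorem εPow_of_degV (n : ℕ) (v : V) (h : R.degV v = 0) : R.εPow n v = 1 := by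
  induction n generalizing v with
  | zero => rfl
  | succ n ih =>
    rw [εPow, R.ε_of_degV v h, ih _ (by rw [R.degV_rV, h]), one_mul]

theorem latticeAut_eq_iterate (φ : lattice ≃+ X)
    (hφ : ∀ l, φ (latticeAut (Multiplicative.ofAdd 1) l) = R.r (φ l)) (g : C4) (l : lattice) :
    φ (latticeAut g l) = R.r^[g.toAdd.val] (φ l) := by
  have h : ∀ n : ℕ, ∀ l, φ (latticeAut (Multiplicative.ofAdd (n : ZMod 4)) l) = R.r^[n] (φ l) := by
    intro n
    induction n with
    | zero =>
      intro l
      rw [Nat.cast_zero, Function.iterate_zero_apply]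
      exact congrArg φ (Subtype.ext (rotFun_one l.1))
    | succ n ih =>
      intro l
      rw [Function.iterate_succ_apply, ← hφ, ← ih, Nat.cast_add, ofAdd_add]
      exact congrArg φ (Subtype.ext (rotFun_mul _ _ l.1))
  have := h g.toAdd.val l
  rwa [ZMod.natCast_zmod_val] at this

/-- The action of `ℤ⁶ ⋊ ℤ/4` on the complex by translations and rotations. -/
def action (φ : lattice ≃+ X)
    (hφ : ∀ l, φ (latticeAut (Multiplicative.ofAdd 1) l) = R.r (φ l)) : ComplexAction Gamma C where
  ρ :=
    { toFun := fun γ => translate (φ γ.left.toAdd) * R.rot ^ γ.right.toAdd.val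
      map_one' := by simp [translate_zero]
      map_mul' := fun γ γ' => by
        have h1 : φ (γ * γ').left.toAdd =
            φ γ.left.toAdd + R.r^[γ.right.toAdd.val] (φ γ'.left.toAdd) := by
          rw [← latticeAut_eq_iterate R φ hφ, ← map_add]
          rfl
        rw [h1, SemidirectProduct.mul_right, toAdd_mul, rot_pow_add, translate_add]
        simp only [mul_assoc]
        -- The semidirect product relation: a rotation passes a translation by rotating its vector.
        rw [← mul_assoc (translate (R.r^[_] _)), ← rot_pow_mul_translate, mul_assoc] }
  ρ_mem γ x := by
    change (translate (φ γ.left.toAdd) * R.rot ^ γ.right.toAdd.val) _ ∈ _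
    rw [Module.End.mul_apply, rot_pow_single, translate, signedMap_single']
    refine Finsupp.single_mem_supported ℤ _ ?_
    change C.deg _ = C.deg _
    rw [R.deg_add, R.deg_iterate]
  ρ_mul_d γ := by
    change translate (φ γ.left.toAdd) * R.rot ^ γ.right.toAdd.val * C.d =
      C.d * (translate (φ γ.left.toAdd) * R.rot ^ γ.right.toAdd.val)
    have h : Commute (R.rot ^ γ.right.toAdd.val) C.d := Commute.pow_left R.d_rot.symm _
    rw [mul_assoc, h.eq, ← mul_assoc, ← R.d_translate, mul_assoc]
  π_mul_ρ γ := by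
    refine ContractedComplex.ext_single fun x => ?_
    change C.π ((translate (φ γ.left.toAdd) * R.rot ^ γ.right.toAdd.val) _) = _
    rw [Module.End.mul_apply, rot_pow_single, translate, signedMap_single',
      ← mul_one (_ * _), ← smul_eq_mul, ← Finsupp.smul_single, map_zsmul, C.π_single, C.π_single,
      R.deg_add, R.deg_iterate]
    by_cases h : C.deg x = 0
    · rw [εPow_of_degV _ _ _ (by rw [← R.deg_eq, h])]
      simp
    · simp [h]

theorem action_single (φ : lattice ≃+ X)
    (hφ : ∀ l, φ (latticeAut (Multiplicative.ofAdd 1) l) = R.r (φ l)) (γ : Gamma) (x : X) :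
    (R.action φ hφ).ρ γ (Finsupp.single x 1) =
      Finsupp.single (R.r^[γ.right.toAdd.val] x + (φ γ.left.toAdd + φ γ.left.toAdd))
        (R.εPow γ.right.toAdd.val (R.q x) : ℤ) := by
  change (translate (φ γ.left.toAdd) * R.rot ^ γ.right.toAdd.val) _ = _
  rw [Module.End.mul_apply, rot_pow_single, translate, signedMap_single']
  simp

end Rotation

/-- The action of `ℤ⁶ ⋊ ℤ/4` on the periodic complex of `ℤ/4`. -/
def cyclicAction : ComplexAction Gamma cyclicComplex where
  ρ :=
    -- With subtraction, an element with rotation part `g` carries `(i, g)` to `(i, 0)`, so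
    -- invariant cochains are determined at `(i, 0)`.
    { toFun := fun γ => signedMap (fun x => (x.1, x.2 - γ.right.toAdd)) 1
      map_one' := by
        rw [← signedMap_id]
        simp only [SemidirectProduct.one_right, toAdd_one, sub_zero]
        rfl
      map_mul' := fun γ γ' => by
        rw [signedMap_mul]
        congr 1
        funext x
        simp [sub_sub, add_comm] }
  ρ_mem γ x := by
    change signedMap (fun x => (x.1, x.2 - γ.right.toAdd)) 1 _ ∈ _
    exact signedMap_mem (C := cyclicComplex) (f := fun x => (x.1, x.2 - γ.right.toAdd)) 1
      (fun _ => rfl) x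
  ρ_mul_d γ := by
    refine ContractedComplex.ext_single ?_
    rintro ⟨i, g⟩
    change signedMap (fun x => (x.1, x.2 - γ.right.toAdd)) 1 (chLift cyclicBoundary _) =
      chLift cyclicBoundary (signedMap (fun x => (x.1, x.2 - γ.right.toAdd)) 1 _)
    rw [signedMap_single, chLift_single]
    simp only [Pi.one_apply, Units.val_one, chLift_single]
    rcases i with _ | i
    · simp [cyclicBoundary]
    · by_cases h : Even i
      · simp only [cyclicBoundary, h, if_true, map_sub, signedMap_single, Pi.one_apply,
          Units.val_one]
        rw [add_sub_right_comm]
      · simp only [cyclicBoundary, h, if_false, map_sum, signedMap_single, Pi.one_apply,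
          Units.val_one]
        exact Equiv.sum_comp (Equiv.subRight γ.right.toAdd)
          fun x => (Finsupp.single (i, x) (1 : ℤ) : Ch (ℕ × ZMod 4))
  π_mul_ρ γ := by
    refine ContractedComplex.ext_single fun x => ?_
    change cyclicComplex.π (signedMap (fun x => (x.1, x.2 - γ.right.toAdd)) 1 _) = _
    rw [signedMap_single, Pi.one_apply, Units.val_one, cyclicComplex.π_single,
      cyclicComplex.π_single]
    rfl

theorem cyclicAction_single (γ : Gamma) (x : ℕ × ZMod 4) :
    cyclicAction.ρ γ (Finsupp.single x 1) = Finsupp.single (x.1, x.2 - γ.right.toAdd) 1 := by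
  change signedMap (fun x => (x.1, x.2 - γ.right.toAdd)) 1 _ = _
  rw [signedMap_single, Pi.one_apply, Units.val_one]

namespace Rotation

variable {X V : Type} [AddCommGroup X] {C : ContractedComplex X} (R : Rotation C V)
  (φ : lattice ≃+ X) (hφ : ∀ l, φ (latticeAut (Multiplicative.ofAdd 1) l) = R.r (φ l))

/-- The action on the total complex. -/
def totalAction : ComplexAction Gamma (cyclicComplex.tensor C) := cyclicAction.tensor (R.action φ hφ)

theorem totalAction_single (γ : Gamma) (i : ℕ × ZMod 4) (x : X) :
    (R.totalAction φ hφ).ρ γ (Finsupp.single (i, x) 1) =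
      Finsupp.single ((i.1, i.2 - γ.right.toAdd),
        R.r^[γ.right.toAdd.val] x + (φ γ.left.toAdd + φ γ.left.toAdd))
        (R.εPow γ.right.toAdd.val (R.q x) : ℤ) := by
  refine (ComplexAction.tensor_ρ_single _ _ _ _ _).trans ?_
  rw [cyclicAction_single, action_single, chTensor_single, one_mul]

/-- The cells of degree `n` form a basis of the chains of degree `n`. -/
def gradedBasis {Y : Type} (D : ContractedComplex Y) (n : ℕ) :
    Module.Basis {y // D.deg y = n} ℤ (ComplexAction.graded D n) :=
  Module.Basis.ofRepr (Finsupp.supportedEquivFinsupp {y | D.deg y = n})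

theorem gradedBasis_apply {Y : Type} (D : ContractedComplex Y) (n : ℕ) (y : {y // D.deg y = n}) :
    (gradedBasis D n y : Ch Y) = Finsupp.single y.1 1 := by
  exact Finsupp.supportedEquivFinsupp_symm_single {y | D.deg y = n} y (1 : ℤ)

/-- The periodic coordinate is fixed only by pure translations, and a nonzero vector `z` moves a
cell by `z + z ≠ 0`. Neither factor alone would do: rotations fix the origin of `ℝ⁶`. -/
theorem projective_totalAction (hX : ∀ z : X, z + z = 0 → z = 0) (n : ℕ) :
    Projective (Rep.of ((R.totalAction φ hφ).gradedRep n)) := by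
  have key : ∀ γ (y : {y // (cyclicComplex.tensor C).deg y = n}),
      (((R.totalAction φ hφ).gradedRep n γ (gradedBasis _ n y) :
        ComplexAction.graded _ n) : Ch _) = (R.totalAction φ hφ).ρ γ (Finsupp.single y.1 1) := by
    intro γ y
    rw [← gradedBasis_apply]
    rfl
  refine projective_of_signed_free_basis _ (gradedBasis _ n) ?_ ?_
  · rintro γ ⟨⟨i, x⟩, hx⟩
    have hd : (cyclicComplex.tensor C).deg ((i.1, i.2 - γ.right.toAdd),
        R.r^[γ.right.toAdd.val] x + (φ γ.left.toAdd + φ γ.left.toAdd)) = n := by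
      rw [← hx]
      change i.1 + C.deg _ = i.1 + C.deg _
      rw [R.deg_add, R.deg_iterate]
    refine ⟨⟨_, hd⟩, R.εPow γ.right.toAdd.val (R.q x), Subtype.ext ?_⟩
    rw [key, totalAction_single, Units.smul_def, Submodule.coe_smul, gradedBasis_apply,
      Finsupp.smul_single, smul_eq_mul, mul_one]
  · rintro γ ⟨⟨⟨i, h⟩, x⟩, hx⟩ u hu
    have hu' := congrArg Subtype.val hu
    rw [key, totalAction_single, Units.smul_def, Submodule.coe_smul, gradedBasis_apply,
      Finsupp.smul_single, smul_eq_mul, mul_one] at hu'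
    obtain ⟨h1, -⟩ | ⟨-, h1⟩ := (Finsupp.single_eq_single_iff _ _ _ _).1 hu'
    · have h2 : γ.right.toAdd = 0 := by
        have := congrArg (fun y => y.1.2) h1
        simpa using this
      have h3 := congrArg Prod.snd h1
      simp only [h2, ZMod.val_zero, Function.iterate_zero_apply, add_eq_left] at h3
      have h4 : γ.left.toAdd = 0 := φ.map_eq_zero_iff.1 (hX _ h3)
      exact SemidirectProduct.ext h4 h2
    · exact absurd h1 u.ne_zero

end Rotation

/-! ### Coordinates of the lattice and the total rotation -/

/-- The integral coordinates of the lattice. -/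
abbrev Cells : Type := (ℤ × ℤ) × ((ℤ × ℤ) × (ℤ × ℤ))

/-- The Gaussian integer with given coordinates, as a complex number. -/
def gaussian : ℤ × ℤ →+ ℂ where
  toFun x := x.1 + x.2 * Complex.I
  map_zero' := by simp
  map_add' x y := by simp; ring

theorem gaussian_injective : Function.Injective gaussian := by
  intro x y h
  have h' : (x.1 + x.2 * Complex.I : ℂ) = y.1 + y.2 * Complex.I := h
  have h1 := congrArg Complex.re h'
  have h2 := congrArg Complex.im h'
  simp at h1 h2
  exact Prod.ext h1 h2

/-- The lattice vector with given coordinates. -/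
def latticeVector : Cells →+ lattice where
  toFun x := ⟨![gaussian x.1, gaussian x.2.1, gaussian x.2.2], fun j => by
    fin_cases j
    exacts [⟨_, _, rfl⟩, ⟨_, _, rfl⟩, ⟨_, _, rfl⟩]⟩
  map_zero' := Subtype.ext (by funext j; fin_cases j <;> simp)
  map_add' x y := Subtype.ext (by funext j; fin_cases j <;> simp)

theorem latticeVector_bijective : Function.Bijective latticeVector := by
  constructor
  · intro x y h
    have h' := congrArg Subtype.val h
    exact Prod.ext (gaussian_injective (congrFun h' 0)) (Prod.ext
      (gaussian_injective (congrFun h' 1)) (gaussian_injective (congrFun h' 2)))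
  · rintro ⟨z, hz⟩
    choose a b h using (show ∀ j, ∃ a b : ℤ, z j = a + b * Complex.I from hz)
    refine ⟨((a 0, b 0), ((a 1, b 1), (a 2, b 2))), Subtype.ext ?_⟩
    funext j
    fin_cases j
    exacts [(h 0).symm, (h 1).symm, (h 2).symm]

/-- The coordinates of a lattice vector. -/
def latticeCoords : lattice ≃+ Cells :=
  (AddEquiv.ofBijective latticeVector latticeVector_bijective).symm

/-- Reduced cells, the cells of the torus. -/
abbrev TorusCells : Type := Square × (Square × Square)

/-- The rotation of the six-dimensional complex. -/
def torusRotation : Rotation (planeComplex.tensor (planeComplex.tensor planeComplex)) TorusCells :=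
  halfTurn.prod (quarterTurn.prod quarterTurn)

theorem latticeVector_rotation (x : Cells) :
    latticeVector (torusRotation.r x) =
      latticeAut (Multiplicative.ofAdd 1) (latticeVector x) := by
  refine Subtype.ext ?_
  change _ = rotFun _ _
  rw [rotFun_generator]
  have hI : Complex.I * Complex.I = -1 := Complex.I_mul_I
  have h2 : ∀ y : ℤ × ℤ, gaussian (-y.2, y.1) = Complex.I * gaussian y := fun y => by
    simp only [gaussian, AddMonoidHom.coe_mk, ZeroHom.coe_mk]
    push_cast
    linear_combination -(y.2 : ℂ) * hI
  have h1 : ∀ y : ℤ × ℤ, gaussian (-y) = -gaussian y := map_neg _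
  funext j
  fin_cases j
  exacts [h1 _, h2 _, h2 _]

theorem latticeCoords_latticeAut (l : lattice) :
    latticeCoords (latticeAut (Multiplicative.ofAdd 1) l) = torusRotation.r (latticeCoords l) := by
  obtain ⟨x, rfl⟩ := latticeVector_bijective.2 l
  rw [← latticeVector_rotation]
  have h : ∀ y, latticeCoords (latticeVector y) = y := fun y =>
    (AddEquiv.ofBijective latticeVector latticeVector_bijective).symm_apply_apply y
  rw [h, h]

/-- The projective resolution of the integers over `ℤ⁶ ⋊ ℤ/4`. -/
def gammaResolution : ProjectiveResolution (Rep.trivial ℤ Gamma ℤ) :=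
  (torusRotation.totalAction latticeCoords latticeCoords_latticeAut).resolution
    (torusRotation.projective_totalAction latticeCoords latticeCoords_latticeAut
      fun z hz => by
        simp only [Prod.ext_iff, Prod.fst_add, Prod.snd_add, Prod.fst_zero, Prod.snd_zero] at hz
        ext <;> simp <;> lia)

/-! ### Collapse of the invariant cochain complex onto the 64 torus cells -/

/-! ### Cochains on the quotient -/

namespace Rotation

variable {X V : Type} [AddCommGroup X] {C : ContractedComplex X} (R : Rotation C V)

section Cochains

variable (A : Type) [AddCommGroup A]

/-- The rotation of cochains on reduced cells. -/
def coRot : AddMonoid.End (V → A) where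
  toFun f v := R.ε v • f (R.rV v)
  map_zero' := by funext v; simp
  map_add' f g := by funext v; simp

theorem coRot_apply (f : V → A) (v : V) : R.coRot A f v = R.ε v • f (R.rV v) := rfl

theorem coRot_pow_apply (n : ℕ) (f : V → A) (v : V) :
    (R.coRot A ^ n) f v = R.εPow n v • f (R.rV^[n] v) := by
  induction n generalizing v with
  | zero => simp [εPow]
  | succ n ih =>
    rw [pow_succ', AddMonoid.End.coe_mul, Function.comp_apply, coRot_apply, ih, smul_smul]
    rfl

theorem coRot_pow_four : R.coRot A ^ 4 = 1 := by
  ext f v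
  rw [coRot_pow_apply, AddMonoid.End.coe_one, id]
  have h : ∀ u v : ℤˣ, u * (v * (u * (v * 1))) = 1 := by decide
  simp only [εPow, Function.iterate_succ_apply, Function.iterate_zero_apply, R.rV_rV, h, one_smul]

theorem coRot_pow_add (a b : ZMod 4) :
    R.coRot A ^ (a + b).val = R.coRot A ^ a.val * R.coRot A ^ b.val := by
  rw [ZMod.val_add, ← pow_add, ← pow_eq_pow_mod _ (R.coRot_pow_four A)]

/-- The coboundary in the direction of the cyclic group. -/
def op : ℕ → AddMonoid.End (V → A)
  -- The index is the target degree: nothing maps into degree zero. This value is also what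
  -- truncated subtraction reaches on cells of too large dimension.
  | 0 => 0
  | i + 1 => if Even i then R.coRot A - 1
      else 1 + R.coRot A + R.coRot A ^ 2 + R.coRot A ^ 3

end Cochains

end Rotation

/-! ### Invariant cochains -/

namespace ComplexAction

variable {Γ : Type} [Group Γ] {Y : Type} {D : ContractedComplex Y} (a : ComplexAction Γ D)
  {A : Type} [AddCommGroup A]

open scoped Classical in
/-- The extension by zero of a cochain of degree `n`. -/
def extend {n : ℕ} (f : a.complex.X n ⟶ Rep.trivial ℤ Γ A) : Ch Y →ₗ[ℤ] A :=
  (show graded D n →ₗ[ℤ] A from f.hom.toLinearMap) ∘ₗ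
    Finsupp.restrictDom ℤ ℤ {y | D.deg y = n}

theorem extend_of_mem {n : ℕ} (f : a.complex.X n ⟶ Rep.trivial ℤ Γ A) {u : Ch Y}
    (hu : u ∈ graded D n) : a.extend f u = f.hom (⟨u, hu⟩ : graded D n) := by
  classical
  refine congrArg (fun v : graded D n => f.hom v) (Subtype.ext ?_)
  rw [Finsupp.restrictDom_apply]
  exact Finsupp.filter_eq_self_iff _ _ |>.2 fun y hy => hu (Finsupp.mem_support_iff.2 hy)

theorem extend_of_mem_of_ne {n m : ℕ} (f : a.complex.X n ⟶ Rep.trivial ℤ Γ A) {u : Ch Y}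
    (hu : u ∈ graded D m) (h : m ≠ n) : a.extend f u = 0 := by
  classical
  have h0 : Finsupp.restrictDom ℤ ℤ {y | D.deg y = n} u = 0 := ?_
  · exact (congrArg (fun v : graded D n => f.hom v) h0).trans (map_zero f.hom.toLinearMap)
  refine Subtype.ext ?_
  rw [Finsupp.restrictDom_apply]
  refine Finsupp.filter_eq_zero_iff _ _ |>.2 fun y hy => ?_
  by_contra hy'
  exact h ((hu (Finsupp.mem_support_iff.2 hy')).symm.trans hy)

theorem single_mem_graded (y : Y) : Finsupp.single y 1 ∈ graded D (D.deg y) :=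
  Finsupp.single_mem_supported ℤ _ rfl

theorem extend_ρ {n : ℕ} (f : a.complex.X n ⟶ Rep.trivial ℤ Γ A) (γ : Γ) (u : Ch Y) :
    a.extend f (a.ρ γ u) = a.extend f u := by
  revert u
  refine LinearMap.congr_fun (f := a.extend f ∘ₗ a.ρ γ) (ContractedComplex.ext_single fun y => ?_)
  have h := a.ρ_mem_graded γ _ _ (single_mem_graded (D := D) y)
  rw [LinearMap.comp_apply]
  by_cases hy : D.deg y = n
  · subst hy
    rw [extend_of_mem a f h, extend_of_mem a f (single_mem_graded y)]
    exact Rep.hom_comm_apply f γ (⟨_, single_mem_graded y⟩ : graded D (D.deg y))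
  · rw [extend_of_mem_of_ne a f h hy, extend_of_mem_of_ne a f (single_mem_graded y) hy]

theorem extend_d {n : ℕ} (f : a.complex.X n ⟶ Rep.trivial ℤ Γ A) (u : Ch Y) :
    a.extend (a.complex.d (n + 1) n ≫ f) u = a.extend f (D.d u) := by
  revert u
  refine LinearMap.congr_fun (g := a.extend f ∘ₗ D.d) (ContractedComplex.ext_single fun y => ?_)
  have h0 := single_mem_graded (D := D) y
  rw [LinearMap.comp_apply]
  rcases hm : D.deg y with _ | m
  · rw [hm] at h0
    rw [extend_of_mem_of_ne _ _ h0 (by simp), d_eq_zero _ _ h0, map_zero]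
  · rw [hm] at h0
    have h1 := d_mem_graded D m _ h0
    by_cases h : m = n
    · subst h
      rw [extend_of_mem _ _ h0, extend_of_mem _ _ h1]
      exact congrArg (fun v : graded D m => f.hom v) (Subtype.ext (a.complex_d_apply m ⟨_, h0⟩))
    · rw [extend_of_mem_of_ne _ _ h0 (by simpa using h), extend_of_mem_of_ne _ _ h1 h]

theorem extend_injective {n : ℕ} {f g : a.complex.X n ⟶ Rep.trivial ℤ Γ A}
    (h : a.extend f = a.extend g) : f = g := by
  refine rep_hom_ext fun u => ?_
  have := LinearMap.congr_fun h (show graded D n from u).1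
  rwa [extend_of_mem a f (show graded D n from u).2, extend_of_mem a g (show graded D n from u).2]
    at this

theorem extend_add {n : ℕ} (f g : a.complex.X n ⟶ Rep.trivial ℤ Γ A) :
    a.extend (f + g) = a.extend f + a.extend g := rfl

/-- The cochain of degree `n` that is the restriction of an invariant functional. -/
def ofExtend (n : ℕ) (h : Ch Y →ₗ[ℤ] A) (hh : ∀ γ u, h (a.ρ γ u) = h u) :
    a.complex.X n ⟶ Rep.trivial ℤ Γ A :=
  show Rep.of (a.gradedRep n) ⟶ _ from
    Rep.ofHom ⟨h ∘ₗ (graded D n).subtype, fun γ => by ext u; exact hh γ u.1⟩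

theorem extend_ofExtend {n : ℕ} (h : Ch Y →ₗ[ℤ] A) (hh : ∀ γ u, h (a.ρ γ u) = h u) {u : Ch Y}
    (hu : u ∈ graded D n) : a.extend (a.ofExtend n h hh) u = h u :=
  extend_of_mem a _ hu

end ComplexAction

/-! ### Homology of complexes of modules -/

theorem shortComplex_homology_equiv {k : Type} [Ring k] (S : ShortComplex (ModuleCat.{0} k))
    {H : Type} [AddCommGroup H]
    (φ : LinearMap.ker S.g.hom →+ H) (hφ : Function.Surjective φ)
    (hker : ∀ x, φ x = 0 ↔ ∃ y, S.f.hom y = x.1) : Nonempty (S.homology ≃+ H) := by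
  have e1 : S.homology ≃+ (LinearMap.ker S.g.hom ⧸ LinearMap.range S.moduleCatToCycles) :=
    S.moduleCatHomologyIso.toLinearEquiv.toAddEquiv
  have hk : (LinearMap.range S.moduleCatToCycles).toAddSubgroup = φ.ker := by
    ext x
    rw [AddMonoidHom.mem_ker, hker]
    constructor
    · rintro ⟨y, rfl⟩
      exact ⟨y, rfl⟩
    · rintro ⟨y, hy⟩
      exact ⟨y, Subtype.ext hy⟩
  have e2 : (LinearMap.ker S.g.hom ⧸ LinearMap.range S.moduleCatToCycles) ≃+
      (LinearMap.ker S.g.hom ⧸ φ.ker) :=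
    (Submodule.quotEquivOfEq _ _ rfl).toAddEquiv.trans (QuotientAddGroup.quotientAddEquivOfEq hk)
  exact ⟨e1.trans (e2.trans (QuotientAddGroup.quotientKerEquivOfSurjective φ hφ))⟩

/-! ### Cohomology in terms of reduced cells -/

namespace Rotation

variable {X V : Type} [AddCommGroup X] {C : ContractedComplex X} (R : Rotation C V)

section op

variable (A : Type) [AddCommGroup A]

theorem op_succ_of_even {i : ℕ} (h : Even i) : R.op A (i + 1) = R.coRot A - 1 := if_pos h

theorem op_succ_of_not_even {i : ℕ} (h : ¬ Even i) :
    R.op A (i + 1) = 1 + R.coRot A + R.coRot A ^ 2 + R.coRot A ^ 3 := if_neg h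

/-- The cyclic coboundary is built from powers of the rotation, so it sees only one orbit; gluing
over orbits rests on this. -/
theorem op_congr (i : ℕ) {f g : V → A} {v : V} (h : ∀ n, f (R.rV^[n] v) = g (R.rV^[n] v)) :
    R.op A i f v = R.op A i g v := by
  have h' : ∀ n, (R.coRot A ^ n) f v = (R.coRot A ^ n) g v := fun n => by
    rw [coRot_pow_apply, coRot_pow_apply, h]
  have h0 : f v = g v := h 0
  have h1 := h' 1
  rw [pow_one] at h1
  rcases i with _ | i
  · rfl
  · by_cases hi : Even i
    · rw [op_succ_of_even R A hi]
      change R.coRot A f v - f v = R.coRot A g v - g v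
      rw [h0, h1]
    · rw [op_succ_of_not_even R A hi]
      change f v + R.coRot A f v + (R.coRot A ^ 2) f v + (R.coRot A ^ 3) f v =
        g v + R.coRot A g v + (R.coRot A ^ 2) g v + (R.coRot A ^ 3) g v
      rw [h0, h1, h', h']

/-- The coboundary on functions on reduced cells, with values in degree `n`. -/
def coboundary (n : ℕ) : (V → A) →+ (V → A) where
  -- On a cell of dimension at least `n` the subtraction gives `0` and the coboundary vanishes, as
  -- no cochain of degree `n - 1` has a cyclic part mapping there.
  toFun f v := R.op A (n - R.degV v) f v
  map_zero' := by funext v; simp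
  map_add' f g := by funext v; simp

theorem coboundary_apply (n : ℕ) (f : V → A) (v : V) :
    R.coboundary A n f v = R.op A (n - R.degV v) f v := rfl

/-- The cocycles of degree `n` among the functions on reduced cells. -/
def cocycles (n : ℕ) : AddSubgroup (V → A) where
  -- Entries at cells of dimension above `n` do not belong to any cochain of degree `n`, so they are
  -- required to be zero.
  carrier := {f | (∀ v, n < R.degV v → f v = 0) ∧ R.coboundary A (n + 1) f = 0}
  zero_mem' := ⟨fun _ _ => rfl, map_zero _⟩
  add_mem' := by
    intro f g hf hg
    refine ⟨fun v hv => ?_, by rw [map_add, hf.2, hg.2, add_zero]⟩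
    rw [Pi.add_apply, hf.1 v hv, hg.1 v hv, add_zero]
  neg_mem' := by
    intro f hf
    exact ⟨fun v hv => by rw [Pi.neg_apply, hf.1 v hv, neg_zero], by rw [map_neg, hf.2, neg_zero]⟩

end op

variable (φ : lattice ≃+ X) (hφ : ∀ l, φ (latticeAut (Multiplicative.ofAdd 1) l) = R.r (φ l))

/-! ### Invariant functionals on the total complex -/

section invariant

variable {A : Type} [AddCommGroup A] (h : Ch ((ℕ × ZMod 4) × X) →ₗ[ℤ] A)
  (hh : ∀ γ u, h ((R.totalAction φ hφ).ρ γ u) = h u)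

include hh in
theorem invariant_translate (i : ℕ × ZMod 4) (x z : X) :
    h (Finsupp.single (i, x + (z + z)) 1) = h (Finsupp.single (i, x) 1) := by
  rw [← hh ⟨Multiplicative.ofAdd (φ.symm z), 1⟩ (Finsupp.single (i, x) 1), totalAction_single]
  simp [εPow]

include hh in
theorem invariant_of_q_eq (i : ℕ × ZMod 4) {x y : X} (hxy : R.q x = R.q y) :
    h (Finsupp.single (i, x) 1) = h (Finsupp.single (i, y) 1) := by
  obtain ⟨z, rfl⟩ := R.exists_of_q_eq x y hxy
  exact invariant_translate R φ hφ h hh i y z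

/-- The values of a functional at representatives of the reduced cells. -/
def reduce (i : ℕ) (v : V) : A := h (Finsupp.single ((i, 0), R.σ v) 1)

include hh in
theorem invariant_single (i : ℕ) (g : ZMod 4) (x : X) :
    h (Finsupp.single ((i, g), x) 1) = (R.coRot A ^ g.val) (R.reduce h i) (R.q x) := by
  rw [← hh ⟨1, Multiplicative.ofAdd g⟩ (Finsupp.single ((i, g), x) 1), totalAction_single,
    coRot_pow_apply]
  simp only [toAdd_one, map_zero, add_zero, toAdd_ofAdd, sub_self]
  rw [← mul_one (Units.val _), ← smul_eq_mul, ← Finsupp.smul_single, map_zsmul, reduce,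
    invariant_of_q_eq R φ hφ h hh (i, 0) (y := R.σ (R.rV^[g.val] (R.q x)))
      (by rw [R.q_σ, q_iterate])]
  rfl

-- The cellular half of the differential becomes zero on an invariant functional by `coinv_d`; only
-- the periodic half remains. This is where the double complex collapses.
include hh in
theorem invariant_d (i : ℕ) (x : X) :
    h ((cyclicComplex.tensor C).d (Finsupp.single ((i, 0), x) 1)) =
      R.op A i (R.reduce h (i - 1)) (R.q x) := by
  have h2 : h (chTensor _ _ (Finsupp.single (i, 0) 1 ⊗ₜ C.d (Finsupp.single x 1))) = 0 := by
    let Q : Ch X →ₗ[ℤ] A := h ∘ₗ ((chTensor _ _).toLinearMap ∘ₗ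
      (TensorProduct.mk ℤ _ _) (Finsupp.single (i, 0) 1))
    refine R.coinv_d A Q.toAddMonoidHom (fun z => ?_) _
    refine LinearMap.congr_fun (f := Q ∘ₗ translate z) (g := Q)
      (ContractedComplex.ext_single fun y => ?_)
    change h (chTensor _ _ (Finsupp.single (i, 0) 1 ⊗ₜ translate z (Finsupp.single y 1))) =
      h (chTensor _ _ (Finsupp.single (i, 0) 1 ⊗ₜ Finsupp.single y 1))
    rw [translate_single, chTensor_single, chTensor_single, mul_one]
    exact invariant_translate R φ hφ h hh (i, 0) y z
  rw [ContractedComplex.tensor_d_single, map_add, map_zsmul, h2, smul_zero, add_zero]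
  change h (chTensor _ _ (chLift cyclicBoundary (Finsupp.single (i, 0) 1) ⊗ₜ
    Finsupp.single x 1)) = _
  rw [chLift_single]
  have e1 : (1 : ZMod 4).val = 1 := rfl
  have e2 : (2 : ZMod 4).val = 2 := rfl
  have e3 : (3 : ZMod 4).val = 3 := rfl
  rcases i with _ | i
  · simp [cyclicBoundary, op]
  · by_cases hi : Even i
    · rw [cyclicBoundary, if_pos hi, op_succ_of_even R A hi, TensorProduct.sub_tmul, map_sub,
        map_sub, chTensor_single, chTensor_single, mul_one, zero_add,
        invariant_single R φ hφ h hh, invariant_single R φ hφ h hh, e1, pow_one, ZMod.val_zero,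
        pow_zero]
      rfl
    · rw [cyclicBoundary, if_neg hi, op_succ_of_not_even R A hi, sum_zmod_four]
      simp only [TensorProduct.add_tmul, map_add, chTensor_single, mul_one,
        invariant_single R φ hφ h hh, e1, e2, e3, ZMod.val_zero, pow_zero, pow_one]
      rfl

end invariant

/-! ### Invariant cochains as functions on reduced cells -/

section cochains

variable {A : Type} [AddCommGroup A]

/-- The values of an invariant cochain at representatives of cells. -/
def values (n : ℕ) :
    ((R.totalAction φ hφ).complex.X n ⟶ Rep.trivial ℤ Gamma A) →+ (V → A) :=
  AddMonoidHom.mk'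
    (fun f v => (R.totalAction φ hφ).extend f (Finsupp.single ((n - R.degV v, 0), R.σ v) 1))
    (fun f g => by
      funext v
      rw [ComplexAction.extend_add]
      rfl)

theorem values_apply (n : ℕ) (f : (R.totalAction φ hφ).complex.X n ⟶ Rep.trivial ℤ Gamma A)
    (v : V) : R.values φ hφ n f v =
      R.reduce ((R.totalAction φ hφ).extend f) (n - R.degV v) v := rfl

theorem extend_eq_zero {n : ℕ} (f : (R.totalAction φ hφ).complex.X n ⟶ Rep.trivial ℤ Gamma A)
    (i : ℕ × ZMod 4) (x : X) (h : i.1 + C.deg x ≠ n) :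
    (R.totalAction φ hφ).extend f (Finsupp.single (i, x) 1) = 0 :=
  ComplexAction.extend_of_mem_of_ne _ f (ComplexAction.single_mem_graded (i, x)) h

theorem values_of_lt {n : ℕ} (f : (R.totalAction φ hφ).complex.X n ⟶ Rep.trivial ℤ Gamma A)
    {v : V} (h : n < R.degV v) : R.values φ hφ n f v = 0 := by
  refine extend_eq_zero R φ hφ f _ _ ?_
  rw [R.deg_eq, R.q_σ]
  dsimp only
  lia

theorem values_d (n : ℕ) (f : (R.totalAction φ hφ).complex.X n ⟶ Rep.trivial ℤ Gamma A) :
    R.values φ hφ (n + 1) ((R.totalAction φ hφ).complex.d (n + 1) n ≫ f) =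
      R.coboundary A (n + 1) (R.values φ hφ n f) := by
  funext v
  rw [values_apply, reduce, ComplexAction.extend_d,
    invariant_d R φ hφ _ (ComplexAction.extend_ρ _ f), R.q_σ, coboundary_apply]
  refine R.op_congr A _ fun k => ?_
  rw [values_apply, rV_iterate_deg]
  congr 1
  lia

theorem values_injective (n : ℕ) : Function.Injective (R.values φ hφ (A := A) n) := by
  intro f g hfg
  refine ComplexAction.extend_injective _ (ContractedComplex.ext_single ?_)
  rintro ⟨⟨i, k⟩, x⟩
  by_cases h : i + C.deg x = n
  · rw [invariant_single R φ hφ _ (ComplexAction.extend_ρ _ f),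
      invariant_single R φ hφ _ (ComplexAction.extend_ρ _ g), coRot_pow_apply, coRot_pow_apply]
    have h1 := congrFun hfg (R.rV^[k.val] (R.q x))
    rw [values_apply, values_apply, rV_iterate_deg] at h1
    have h2 : n - R.degV (R.q x) = i := by
      rw [R.deg_eq] at h
      lia
    rw [h2] at h1
    rw [h1]
  · rw [extend_eq_zero _ _ _ _ _ _ h, extend_eq_zero _ _ _ _ _ _ h]

theorem exists_values_eq (n : ℕ) (F : V → A) (hF : ∀ v, n < R.degV v → F v = 0) :
    ∃ f, R.values φ hφ n f = F := by
  -- The formula of `invariant_single` taken as a definition, the same for every periodic degree;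
  -- restricting to total degree `n` selects the relevant part.
  let h : Ch ((ℕ × ZMod 4) × X) →ₗ[ℤ] A :=
    Finsupp.linearCombination ℤ fun y => (R.coRot A ^ y.1.2.val) F (R.q y.2)
  have hs : ∀ i k x m, h (Finsupp.single ((i, k), x) m) = m • (R.coRot A ^ k.val) F (R.q x) :=
    fun i k x m => Finsupp.linearCombination_single _ _ _
  refine ⟨(R.totalAction φ hφ).ofExtend n h fun γ u => ?_, ?_⟩
  · revert u
    refine LinearMap.congr_fun (f := h ∘ₗ (R.totalAction φ hφ).ρ γ)
      (ContractedComplex.ext_single ?_)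
    rintro ⟨⟨i, k⟩, x⟩
    rw [LinearMap.comp_apply, totalAction_single, hs, hs, R.q_add, q_iterate, one_smul]
    refine (coRot_pow_apply R A _ ((R.coRot A ^ (k - γ.right.toAdd).val) F) _).symm.trans ?_
    change (R.coRot A ^ γ.right.toAdd.val * R.coRot A ^ (k - γ.right.toAdd).val) F (R.q x) = _
    rw [← coRot_pow_add, add_sub_cancel]
  · funext v
    by_cases hv : n < R.degV v
    · rw [hF v hv, values_of_lt _ _ _ _ hv]
    · rw [values_apply, reduce, ComplexAction.extend_ofExtend _ _ _
        (Finsupp.single_mem_supported ℤ _ ?_), hs, ZMod.val_zero, pow_zero, one_smul, R.q_σ]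
      · rfl
      · change n - R.degV v + C.deg (R.σ v) = n
        rw [R.deg_eq, R.q_σ]
        lia

/-- It suffices to exhibit a surjection from the cocycles on reduced cells whose kernel is the
coboundaries; this form suits the orbit decomposition. -/
theorem homology_equiv (n : ℕ) {H : Type} [AddCommGroup H] (Θ : R.cocycles A n →+ H)
    (hΘ : Function.Surjective Θ) (hker : ∀ f, Θ f = 0 ↔ ∃ g, R.coboundary A n g = f) :
    Nonempty (((R.totalAction φ hφ).complex.linearYonedaObj ℤ
      (Rep.trivial ℤ Gamma A)).homology n ≃+ H) := by
  let K := (R.totalAction φ hφ).complex.linearYonedaObj ℤ (Rep.trivial ℤ Gamma A)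
  have hnext : (ComplexShape.up ℕ).next n = n + 1 := by simp
  have hd : ∀ x : K.X n, K.d n ((ComplexShape.up ℕ).next n) x = 0 ↔
      R.coboundary A (n + 1) (R.values φ hφ n x) = 0 := by
    rw [hnext]
    have h : ∀ f : (R.totalAction φ hφ).complex.X n ⟶ Rep.trivial ℤ Gamma A,
        (R.totalAction φ hφ).complex.d (n + 1) n ≫ f = 0 ↔
          R.coboundary A (n + 1) (R.values φ hφ n f) = 0 := fun f => by
      rw [← values_d, ← map_zero (R.values φ hφ (n + 1)), (values_injective R φ hφ _).eq_iff]
    exact h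
  let ψ : LinearMap.ker (K.sc n).g.hom →+ R.cocycles A n :=
    { toFun := fun x => ⟨R.values φ hφ n x.1, fun v hv => values_of_lt R φ hφ _ hv, (hd x.1).1 x.2⟩
      map_zero' := Subtype.ext (map_zero (R.values φ hφ n))
      map_add' := fun x y => Subtype.ext (map_add (R.values φ hφ n) x.1 y.1) }
  have hψ : Function.Surjective ψ := by
    rintro ⟨F, hF⟩
    obtain ⟨f, rfl⟩ := exists_values_eq R φ hφ n F hF.1
    exact ⟨⟨f, (hd f).2 hF.2⟩, rfl⟩
  refine shortComplex_homology_equiv (K.sc n) (Θ.comp ψ) (hΘ.comp hψ) fun x => ?_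
  rw [AddMonoidHom.comp_apply, hker]
  change _ ↔ ∃ y : K.X _, K.d ((ComplexShape.up ℕ).prev n) n y = x.1
  rcases n with _ | n
  · have h0 : K.d ((ComplexShape.up ℕ).prev 0) 0 = 0 := K.shape _ _ (by simp)
    have h1 : ∀ g, R.coboundary A 0 g = 0 := fun g => by
      funext v
      rw [coboundary_apply, Nat.zero_sub]
      rfl
    rw [h0]
    constructor
    · rintro ⟨g, hg⟩
      rw [h1] at hg
      exact ⟨0, values_injective R φ hφ 0 ((map_zero _).trans hg)⟩
    · rintro ⟨y, hy⟩
      refine ⟨0, (h1 0).trans ?_⟩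
      exact (map_zero (R.values φ hφ 0)).symm.trans (congrArg (R.values φ hφ 0) hy)
  · have hprev : (ComplexShape.up ℕ).prev (n + 1) = n := by simp
    rw [hprev]
    constructor
    · rintro ⟨g, hg⟩
      -- An arbitrary `g` may be nonzero on cells of dimension above `n`. Discarding those entries
      -- gives an actual cochain with the same coboundary.
      obtain ⟨f, hf⟩ := exists_values_eq R φ hφ n (fun v => if n < R.degV v then 0 else g v)
        fun v hv => if_pos hv
      refine ⟨f, values_injective R φ hφ (n + 1) ?_⟩
      refine (values_d R φ hφ n f).trans (Eq.trans ?_ hg)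
      rw [hf]
      funext v
      rw [coboundary_apply, coboundary_apply]
      rcases Nat.lt_or_ge n (R.degV v) with hv | hv
      · rw [Nat.sub_eq_zero_of_le hv]
        rfl
      · refine R.op_congr A _ fun k => ?_
        rw [rV_iterate_deg, if_neg (by lia)]
    · rintro ⟨y, hy⟩
      exact ⟨R.values φ hφ n y,
        (values_d R φ hφ n y).symm.trans (congrArg (R.values φ hφ (n + 1)) hy)⟩

end cochains

end Rotation

/-! ### Decomposition into orbits of reduced cells -/

namespace Rotation

variable {X V : Type} [AddCommGroup X] {C : ContractedComplex X} (R : Rotation C V)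
  (A : Type) [AddCommGroup A]

variable {A} in
/-- The value of `R.op A i f` at `v`, in terms of the values of `f` at `v` and its rotation. -/
def pairOp (v : V) : ℕ → A → A → A
  | 0, _, _ => 0
  | i + 1, x, y => if Even i then R.ε v • y - x
      -- The norm is `(1 + T)` followed by `(1 + T²)`, and `T²` acts on the orbit by the product of
      -- its two signs.
      else x + R.ε v • y + (R.ε v * R.ε (R.rV v)) • (x + R.ε v • y)

theorem op_apply (i : ℕ) (f : V → A) (v : V) :
    R.op A i f v = R.pairOp v i (f v) (f (R.rV v)) := by
  rcases i with _ | i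
  · rfl
  · by_cases hi : Even i
    · rw [op_succ_of_even R A hi, pairOp, if_pos hi]
      rfl
    · rw [op_succ_of_not_even R A hi, pairOp, if_neg hi]
      change f v + R.coRot A f v + (R.coRot A ^ 2) f v + (R.coRot A ^ 3) f v = _
      simp only [coRot_apply, coRot_pow_apply, εPow, Function.iterate_succ_apply,
        Function.iterate_zero_apply, R.rV_rV, mul_one, smul_add, smul_smul, mul_assoc]
      abel

/-- The pairs of values of cocycles on the orbit of a reduced cell. -/
def pairs (v : V) (i : ℕ) : AddSubgroup (A × A) where
  carrier := {p | (R.rV v = v → p.1 = p.2) ∧ R.pairOp v (i + 1) p.1 p.2 = 0 ∧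
    R.pairOp (R.rV v) (i + 1) p.2 p.1 = 0}
  zero_mem' := by simp [pairOp]
  add_mem' := by
    have h : ∀ w x y x' y', R.pairOp w (i + 1) (x + x') (y + y') =
        R.pairOp w (i + 1) x y + R.pairOp w (i + 1) (x' : A) y' := by
      intro w x y x' y'
      simp only [pairOp]
      split_ifs
      · rw [smul_add]
        abel
      · simp only [smul_add]
        abel
    intro p p' hp hp'
    refine ⟨fun hv => congrArg₂ (· + ·) (hp.1 hv) (hp'.1 hv), ?_, ?_⟩
    · exact (h _ _ _ _ _).trans (by rw [hp.2.1, hp'.2.1, add_zero])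
    · exact (h _ _ _ _ _).trans (by rw [hp.2.2, hp'.2.2, add_zero])
  neg_mem' := by
    have h : ∀ w x y, R.pairOp w (i + 1) (-x) (-y) = -R.pairOp w (i + 1) (x : A) y := by
      intro w x y
      simp only [pairOp]
      split_ifs
      · rw [smul_neg]
        abel
      · simp only [smul_neg, smul_add]
        abel
    intro p hp
    refine ⟨fun hv => congrArg Neg.neg (hp.1 hv), ?_, ?_⟩
    · exact (h _ _ _).trans (by rw [hp.2.1, neg_zero])
    · exact (h _ _ _).trans (by rw [hp.2.2, neg_zero])

variable {A} in
/-- Two values on the orbit of a reduced cell that come from a coboundary. -/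
def IsPairBoundary (v : V) (i : ℕ) (p : A × A) : Prop :=
  ∃ x y : A, (R.rV v = v → x = y) ∧ R.pairOp v i x y = p.1 ∧ R.pairOp (R.rV v) i y x = p.2

/-- The contribution of the orbit of `v` to the cohomology in degree `n` is `G`. -/
def LocalCohomology (n : ℕ) (v : V) (G : Type) [AddCommGroup G] : Prop :=
  n < R.degV v ∧ Subsingleton G ∨
    R.degV v ≤ n ∧ ∃ t : R.pairs A v (n - R.degV v) →+ G, Function.Surjective t ∧
      ∀ p, t p = 0 ↔ R.IsPairBoundary v (n - R.degV v) p.1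

variable {A} in
open scoped Classical in
/-- The function on reduced cells with given values at `v` and its rotation. -/
def pairFun (v : V) (x y : A) (w : V) : A := if w = v then x else if w = R.rV v then y else 0

theorem pairFun_self (v : V) (x y : A) : R.pairFun v x y v = x := if_pos rfl

theorem pairFun_rV (v : V) {x y : A} (h : R.rV v = v → x = y) :
    R.pairFun v x y (R.rV v) = y := by
  rw [pairFun]
  by_cases hv : R.rV v = v
  · rw [if_pos hv, h hv]
  · rw [if_neg hv, if_pos rfl]

theorem pairFun_of_ne {v w : V} (x y : A) (h : w ≠ v) (h' : w ≠ R.rV v) :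
    R.pairFun v x y w = 0 := by
  rw [pairFun, if_neg h, if_neg h']

variable {A} in
theorem coboundary_eq_iff_pair {n : ℕ} {v : V} {f : V → A} :
    (∃ g, R.coboundary A n g v = f v ∧ R.coboundary A n g (R.rV v) = f (R.rV v)) ↔
      R.IsPairBoundary v (n - R.degV v) (f v, f (R.rV v)) := by
  constructor
  · rintro ⟨g, h1, h2⟩
    rw [coboundary_apply, op_apply] at h1 h2
    rw [R.rV_rV, R.degV_rV] at h2
    exact ⟨g v, g (R.rV v), fun h => by rw [h], h1, h2⟩
  · rintro ⟨x, y, h, h1, h2⟩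
    refine ⟨R.pairFun v x y, ?_, ?_⟩
    · rw [coboundary_apply, op_apply, pairFun_self, pairFun_rV R A v h]
      exact h1
    · rw [coboundary_apply, op_apply, R.rV_rV, R.degV_rV, pairFun_self, pairFun_rV R A v h]
      exact h2

theorem pair_mem_pairs {n : ℕ} {v : V} (hv : R.degV v ≤ n) (f : R.cocycles A n) :
    (f.1 v, f.1 (R.rV v)) ∈ R.pairs A v (n - R.degV v) := by
  have h1 := congrFun f.2.2 v
  have h2 := congrFun f.2.2 (R.rV v)
  rw [coboundary_apply, op_apply] at h1 h2
  rw [R.rV_rV, R.degV_rV] at h2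
  rw [Nat.sub_add_comm hv] at h1 h2
  exact ⟨fun h => by rw [h], h1, h2⟩

/-- Extension by zero outside the orbit preserves the cocycle condition, since the coboundary does
not mix orbits. -/
theorem exists_cocycle {n : ℕ} {v : V} (hv : R.degV v ≤ n)
    (p : R.pairs A v (n - R.degV v)) :
    ∃ f : R.cocycles A n, f.1 v = p.1.1 ∧ f.1 (R.rV v) = p.1.2 := by
  obtain ⟨⟨x, y⟩, h, h1, h2⟩ := p
  refine ⟨⟨R.pairFun v x y, fun w hw => ?_, ?_⟩, pairFun_self R A v x y, pairFun_rV R A v h⟩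
  · refine pairFun_of_ne R A x y ?_ ?_
    · rintro rfl
      lia
    · rintro rfl
      rw [R.degV_rV] at hw
      lia
  · funext w
    rw [coboundary_apply, op_apply]
    by_cases hw : w = v
    · subst hw
      rw [pairFun_self, pairFun_rV R A w h, Nat.sub_add_comm hv]
      exact h1
    · by_cases hw' : w = R.rV v
      · subst hw'
        rw [R.rV_rV, pairFun_self, pairFun_rV R A v h, R.degV_rV, Nat.sub_add_comm hv]
        exact h2
      · rw [pairFun_of_ne R A x y hw hw', pairFun_of_ne R A x y
          (fun h => hw' (by rw [← h, R.rV_rV])) (fun h => hw (by rw [← R.rV_rV w, h, R.rV_rV]))]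
        have h0 := congrFun (map_zero (R.op A (n + 1 - R.degV w))) w
        rw [op_apply] at h0
        exact h0

/-- A homomorphism on cocycles realizing the contribution of an orbit. -/
theorem exists_localHom {n : ℕ} {v : V} {G : Type} [AddCommGroup G]
    (h : R.LocalCohomology A n v G) : ∃ t : R.cocycles A n →+ G, Function.Surjective t ∧
      (∀ f f', f.1 v = f'.1 v → f.1 (R.rV v) = f'.1 (R.rV v) → t f = t f') ∧
      ∀ f, t f = 0 ↔
        ∃ g, R.coboundary A n g v = f.1 v ∧ R.coboundary A n g (R.rV v) = f.1 (R.rV v) := by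
  obtain ⟨hv, hG⟩ | ⟨hv, t, ht, hker⟩ := h
  · refine ⟨0, fun y => ⟨0, Subsingleton.elim _ _⟩, fun _ _ _ _ => rfl, fun f => ?_⟩
    refine iff_of_true rfl ⟨0, ?_, ?_⟩
    · rw [map_zero, f.2.1 v hv, Pi.zero_apply]
    · rw [map_zero, f.2.1 _ (by rwa [R.degV_rV]), Pi.zero_apply]
  · let s : R.cocycles A n →+ R.pairs A v (n - R.degV v) :=
      { toFun := fun f => ⟨(f.1 v, f.1 (R.rV v)), pair_mem_pairs R A hv f⟩
        map_zero' := rfl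
        map_add' := fun _ _ => rfl }
    refine ⟨t.comp s, ht.comp fun p => ?_, fun f f' h h' => ?_, fun f => ?_⟩
    · obtain ⟨f, hf, hf'⟩ := exists_cocycle R A hv p
      exact ⟨f, Subtype.ext (Prod.ext hf hf')⟩
    · exact congrArg t (Subtype.ext (Prod.ext h h'))
    · rw [coboundary_eq_iff_pair, AddMonoidHom.comp_apply, hker]
      exact Iff.rfl

/-- Cocycles and coboundaries are both glued orbit by orbit: evaluate at `w` the local solution
attached to the representative of `w`. -/
theorem exists_globalHom {n : ℕ} (rep : V → V) (hrep : ∀ v, rep (R.rV v) = rep v)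
    (hrep' : ∀ v, rep v = v ∨ rep v = R.rV v) (G : {v // rep v = v} → Type)
    [∀ v, AddCommGroup (G v)] (h : ∀ v, R.LocalCohomology A n v.1 (G v)) :
    ∃ Θ : R.cocycles A n →+ (∀ v, G v), Function.Surjective Θ ∧
      ∀ f, Θ f = 0 ↔ ∃ g, R.coboundary A n g = f.1 := by
  choose t ht hloc hker using fun v => exists_localHom R A (h v)
  have hidem : ∀ v, rep (rep v) = rep v := fun v => by
    obtain h | h := hrep' v
    · rw [h, h]
    · rw [h, hrep, h]
  let ι : V → {v // rep v = v} := fun v => ⟨rep v, hidem v⟩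
  have hι : ∀ v k, ι (R.rV^[k] v) = ι v := by
    intro v k
    induction k generalizing v with
    | zero => rfl
    | succ k ih => rw [Function.iterate_succ_apply, ih]; exact Subtype.ext (hrep v)
  have hglue : ∀ (F : {v // rep v = v} → V → A) (m : ℕ) (v : V),
      R.coboundary A m (fun w => F (ι w) w) v = R.coboundary A m (F (ι v)) v := by
    intro F m v
    rw [coboundary_apply, coboundary_apply]
    exact R.op_congr A _ fun k => by rw [hι]
  refine ⟨AddMonoidHom.mk' (fun f v => t v f) fun f g => ?_, fun y => ?_, fun f => ?_⟩
  · funext v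
    exact map_add _ _ _
  · choose F hF using fun v => ht v (y v)
    refine ⟨⟨fun w => (F (ι w)).1 w, fun v hv => (F (ι v)).2.1 v hv, ?_⟩, ?_⟩
    · funext v
      rw [hglue fun v => (F v).1, (F (ι v)).2.2]
    · funext v
      rw [← hF v]
      have h0 : ι v.1 = v := Subtype.ext v.2
      refine hloc v _ _ ?_ ?_
      · change (F (ι v.1)).1 v.1 = _
        rw [h0]
      · change (F (ι (R.rV v.1))).1 (R.rV v.1) = _
        rw [show ι (R.rV v.1) = v from (hι v.1 1).trans h0]
  · constructor
    · intro hf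
      choose g hg hg' using fun v => (hker v f).1 (congrFun hf v)
      refine ⟨fun w => g (ι w) w, ?_⟩
      funext v
      rw [hglue]
      obtain h | h := hrep' v
      · have := hg (ι v)
        rwa [show (ι v).1 = v from h] at this
      · have := hg' (ι v)
        rwa [show (ι v).1 = R.rV v from h, R.rV_rV] at this
    · rintro ⟨g, hg⟩
      funext v
      exact (hker v f).2 ⟨g, by rw [hg], by rw [hg]⟩

end Rotation

/-! ### Contributions of the orbits -/

namespace Rotation

variable {X V : Type} [AddCommGroup X] {C : ContractedComplex X} (R : Rotation C V)

section general

variable {A : Type} [AddCommGroup A] {n : ℕ} {v : V}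

theorem localCohomology_of_lt {G : Type} [AddCommGroup G] [Subsingleton G] (h : n < R.degV v) :
    R.LocalCohomology A n v G := Or.inl ⟨h, inferInstance⟩

theorem localCohomology_of_exact {G : Type} [AddCommGroup G] [Subsingleton G] (h : R.degV v ≤ n)
    (hb : ∀ p ∈ R.pairs A v (n - R.degV v), R.IsPairBoundary v (n - R.degV v) p) :
    R.LocalCohomology A n v G :=
  Or.inr ⟨h, 0, fun _ => ⟨0, Subsingleton.elim _ _⟩, fun p => iff_of_true rfl (hb p.1 p.2)⟩

/-- The contribution of an orbit, computed by a homomorphism defined on all pairs of values. -/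
theorem localCohomology_of_hom {G : Type} [AddCommGroup G] (h : R.degV v ≤ n) (t : A × A →+ G)
    (hsurj : ∀ y, ∃ p ∈ R.pairs A v (n - R.degV v), t p = y)
    (hker : ∀ p ∈ R.pairs A v (n - R.degV v), t p = 0 ↔ R.IsPairBoundary v (n - R.degV v) p) :
    R.LocalCohomology A n v G :=
  Or.inr ⟨h, t.comp (R.pairs A v (n - R.degV v)).subtype, fun y => by
    obtain ⟨p, hp, hy⟩ := hsurj y
    exact ⟨⟨p, hp⟩, hy⟩, fun p => hker p.1 p.2⟩

variable (A) in
/-- In its own degree, an orbit on which the rotation acts without sign contributes the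
coefficients. -/
theorem localCohomology_free (hn : n = R.degV v) (hε : R.ε v = R.ε (R.rV v))
    (hfix : R.rV v = v → R.ε v = 1) : R.LocalCohomology A n v A := by
  have huu : ∀ (u : ℤˣ) (x : A), u • u • x = x := fun u x => by
    rw [smul_smul, Int.units_mul_self, one_smul]
  refine R.localCohomology_of_hom hn.ge (AddMonoidHom.fst A A) (fun x => ⟨(x, R.ε v • x), ?_, rfl⟩)
    fun p hp => ?_
  · refine ⟨fun h => by simp [hfix h], ?_, ?_⟩
    · simp [pairOp, hn, huu]
    · simp [pairOp, hn, hε]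
  -- In cyclic degree zero the only boundary is zero, and the cocycle condition makes the second
  -- value `ε v` times the first.
  · rw [hn, Nat.sub_self] at hp ⊢
    obtain ⟨-, h1, h2⟩ := hp
    simp only [pairOp, Even.zero, if_true, R.rV_rV, sub_eq_zero] at h1 h2
    constructor
    · intro h
      refine ⟨0, 0, fun _ => rfl, h.symm, ?_⟩
      rw [← h2, show p.1 = 0 from h, smul_zero]
      rfl
    · rintro ⟨x, y, -, h, -⟩
      exact h.symm

end general

end Rotation

/-! ### Integral coefficients -/

/-- The possible contributions of an orbit. -/
inductive Factor
  | zero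
  | free
  | four
  | two
  deriving DecidableEq

/-- The group contributed by an orbit. -/
def Factor.Group (A : Type) : Factor → Type
  | zero => PUnit
  | free => A
  | four => ZMod 4
  | two => ZMod 2

instance Factor.addCommGroup (A : Type) [AddCommGroup A] : ∀ F : Factor, AddCommGroup (F.Group A)
  | zero => inferInstanceAs (AddCommGroup PUnit)
  | free => inferInstanceAs (AddCommGroup A)
  | four => inferInstanceAs (AddCommGroup (ZMod 4))
  | two => inferInstanceAs (AddCommGroup (ZMod 2))

instance Factor.subsingleton (A : Type) : Subsingleton (Factor.zero.Group A) :=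
  inferInstanceAs (Subsingleton PUnit)

namespace Rotation

variable {X V : Type} [AddCommGroup X] {C : ContractedComplex X} (R : Rotation C V)

/-- The contribution of an orbit to integral cohomology. -/
def integralFactor [DecidableEq V] (n : ℕ) (v : V) : Factor :=
  if n < R.degV v then .zero
  else if R.rV v = v then
    if R.ε v = 1 then
      if n = R.degV v then .free else if Even (n - R.degV v) then .four else .zero
    else if Even (n - R.degV v) then .zero else .two
  else if R.ε v = R.ε (R.rV v) then
    if n = R.degV v then .free else if Even (n - R.degV v) then .two else .zero
  else if Even (n - R.degV v) then .zero else .two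

/-! ### Integral cohomology of `ℤ/4` with coefficients in each type of orbit -/

section integral

variable {n : ℕ} {v : V}

/-- With trivial action every value is a cocycle in even degree, and the norm is multiplication by
four. -/
theorem local_fixed_even (hv : R.rV v = v) (hε : R.ε v = 1) {i : ℕ} (hn : n = R.degV v + (i + 1))
    (hi : ¬ Even i) : R.LocalCohomology ℤ n v (ZMod 4) := by
  have hi' : Even (i + 1) := by simpa [Nat.even_add_one] using hi
  have h0 : n - R.degV v = i + 1 := by lia
  refine R.localCohomology_of_hom (by lia) ((Int.castAddHom (ZMod 4)).comp (AddMonoidHom.fst ℤ ℤ))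
    (fun y => ⟨((y.val : ℤ), (y.val : ℤ)), ?_, by simp⟩) fun p hp => ?_
  · rw [h0]
    simp [pairs, pairOp, hi', hv, hε]
  · rw [h0] at hp ⊢
    obtain ⟨h1, -, -⟩ := hp
    obtain ⟨x, y⟩ := p
    obtain rfl : x = y := h1 hv
    change (x : ZMod 4) = 0 ↔ _
    rw [ZMod.intCast_zmod_eq_zero_iff_dvd]
    simp only [IsPairBoundary, pairOp, hi, if_false, hv, hε, one_smul, mul_one]
    constructor
    · rintro ⟨m, rfl⟩
      exact ⟨m, m, fun _ => rfl, by push_cast; ring, by push_cast; ring⟩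
    · rintro ⟨a, b, h, h2, -⟩
      obtain rfl := h trivial
      exact ⟨a, by push_cast; linarith⟩

/-- Multiplication by four is injective on `ℤ`. -/
theorem local_fixed_odd (hv : R.rV v = v) (hε : R.ε v = 1) {i : ℕ} (hn : n = R.degV v + i)
    (hi : ¬ Even i) : R.LocalCohomology ℤ n v (Factor.zero.Group ℤ) := by
  have h0 : n - R.degV v = i := by lia
  refine R.localCohomology_of_exact (by lia) fun p hp => ?_
  rw [h0] at hp ⊢
  obtain ⟨h1, h2, -⟩ := hp
  obtain ⟨x, y⟩ := p
  obtain rfl : x = y := h1 hv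
  simp only [pairOp, hi, if_false, hv, hε, one_smul, mul_one] at h2
  obtain rfl : x = 0 := by lia
  exact ⟨0, 0, fun _ => rfl, by cases i <;> simp [pairOp], by cases i <;> simp [pairOp]⟩

/-- The generator acts by `-1`, so `T - 1 = -2` is injective; this includes cyclic degree zero. -/
theorem local_sign_even (hv : R.rV v = v) (hε : R.ε v = -1) {i : ℕ} (hn : n = R.degV v + i)
    (hi : Even i) : R.LocalCohomology ℤ n v (Factor.zero.Group ℤ) := by
  have h0 : n - R.degV v = i := by lia
  refine R.localCohomology_of_exact (by lia) fun p hp => ?_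
  rw [h0] at hp ⊢
  obtain ⟨h1, h2, -⟩ := hp
  obtain ⟨x, y⟩ := p
  obtain rfl : x = y := h1 hv
  simp only [pairOp, hi, if_true, hε, Units.neg_smul, one_smul] at h2
  obtain rfl : x = 0 := by lia
  exact ⟨0, 0, fun _ => rfl, by cases i <;> simp [pairOp], by cases i <;> simp [pairOp]⟩

/-- The norm `1 - 1 + 1 - 1` is zero, while the image of `T - 1` is `2ℤ`. -/
theorem local_sign_odd (hv : R.rV v = v) (hε : R.ε v = -1) {i : ℕ} (hn : n = R.degV v + (i + 1))
    (hi : Even i) : R.LocalCohomology ℤ n v (ZMod 2) := by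
  have hi' : ¬ Even (i + 1) := by simpa [Nat.even_add_one] using hi
  have h0 : n - R.degV v = i + 1 := by lia
  refine R.localCohomology_of_hom (by lia) ((Int.castAddHom (ZMod 2)).comp (AddMonoidHom.fst ℤ ℤ))
    (fun y => ⟨((y.val : ℤ), (y.val : ℤ)), ?_, by simp⟩) fun p hp => ?_
  · rw [h0]
    simp [pairs, pairOp, hi', hv, hε]
  · rw [h0] at hp ⊢
    obtain ⟨h1, -, -⟩ := hp
    obtain ⟨x, y⟩ := p
    obtain rfl : x = y := h1 hv
    change (x : ZMod 2) = 0 ↔ _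
    rw [ZMod.intCast_zmod_eq_zero_iff_dvd]
    simp only [IsPairBoundary, pairOp, hi, if_true, hv, hε, one_smul, Units.neg_smul]
    constructor
    · rintro ⟨m, rfl⟩
      exact ⟨-m, -m, fun _ => rfl, by push_cast; ring, by push_cast; ring⟩
    · rintro ⟨a, b, h, h2, -⟩
      obtain rfl := h trivial
      exact ⟨-a, by push_cast; linarith⟩

/-- The module is induced from `ℤ/2` acting trivially. Cocycles are the pairs `(x, εx)`, and the
norm has first component `2(a + εb)`. -/
theorem local_swap_even (hv : R.rV v ≠ v) (hε : R.ε v = R.ε (R.rV v)) {i : ℕ}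
    (hn : n = R.degV v + (i + 1)) (hi : ¬ Even i) : R.LocalCohomology ℤ n v (ZMod 2) := by
  have hi' : Even (i + 1) := by simpa [Nat.even_add_one] using hi
  have h0 : n - R.degV v = i + 1 := by lia
  refine R.localCohomology_of_hom (by lia) ((Int.castAddHom (ZMod 2)).comp (AddMonoidHom.fst ℤ ℤ))
    (fun y => ⟨((y.val : ℤ), R.ε v • (y.val : ℤ)), ?_, by simp⟩) fun p hp => ?_
  · rw [h0]
    simp [pairs, pairOp, hi', hv, ← hε, smul_smul, Int.units_mul_self]
  · rw [h0] at hp ⊢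
    obtain ⟨-, h1, h2⟩ := hp
    obtain ⟨x, y⟩ := p
    change (x : ZMod 2) = 0 ↔ _
    rw [ZMod.intCast_zmod_eq_zero_iff_dvd]
    simp only [pairOp, hi', if_true, ← hε] at h1 h2
    simp only [IsPairBoundary, pairOp, hi, if_false, hv, ← hε, R.rV_rV]
    obtain hu | hu := Int.units_eq_one_or (R.ε v) <;>
      simp only [hu, one_smul, Units.neg_smul, mul_one, neg_mul_neg] at h1 h2 ⊢
    · constructor
      · rintro ⟨m, rfl⟩
        exact ⟨m, 0, fun h => h.elim, by push_cast; ring, by push_cast at *; linarith⟩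
      · rintro ⟨a, b, h, h2, -⟩
        exact ⟨a + b, by push_cast; linarith⟩
    · constructor
      · rintro ⟨m, rfl⟩
        exact ⟨m, 0, fun h => h.elim, by push_cast; ring, by push_cast at *; linarith⟩
      · rintro ⟨a, b, h, h2, -⟩
        exact ⟨a - b, by push_cast; linarith⟩

/-- A cocycle satisfies `2(x + εy) = 0`, so `y = -εx`, and this is the boundary of `(0, εx)`. -/
theorem local_swap_odd (hv : R.rV v ≠ v) (hε : R.ε v = R.ε (R.rV v)) {i : ℕ}
    (hn : n = R.degV v + (i + 1)) (hi : Even i) :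
    R.LocalCohomology ℤ n v (Factor.zero.Group ℤ) := by
  have hi' : ¬ Even (i + 1) := by simpa [Nat.even_add_one] using hi
  have h0 : n - R.degV v = i + 1 := by lia
  refine R.localCohomology_of_exact (by lia) fun p hp => ?_
  rw [h0] at hp ⊢
  obtain ⟨-, h1, -⟩ := hp
  obtain ⟨x, y⟩ := p
  simp only [pairOp, hi', if_false, ← hε, Int.units_mul_self, one_smul] at h1
  simp only [IsPairBoundary, pairOp, hi, if_true, hv, ← hε, R.rV_rV]
  obtain hu | hu := Int.units_eq_one_or (R.ε v) <;>
    simp only [hu, one_smul, Units.neg_smul] at h1 ⊢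
  · exact ⟨0, x, fun h => h.elim, by ring, by linarith⟩
  · exact ⟨0, -x, fun h => h.elim, by ring, by linarith⟩

/-- The square of the rotation acts by `-1`, so an invariant pair equals its own negative. -/
theorem local_quarter_even (hε : R.ε v ≠ R.ε (R.rV v)) {i : ℕ}
    (hn : n = R.degV v + i) (hi : Even i) :
    R.LocalCohomology ℤ n v (Factor.zero.Group ℤ) := by
  have h0 : n - R.degV v = i := by lia
  refine R.localCohomology_of_exact (by lia) fun p hp => ?_
  rw [h0] at hp ⊢
  obtain ⟨-, h1, h2⟩ := hp
  obtain ⟨x, y⟩ := p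
  simp only [pairOp, hi, if_true] at h1 h2
  have hxy : x = 0 ∧ y = 0 := by
    obtain hu | hu := Int.units_eq_one_or (R.ε v) <;>
      obtain hw | hw := Int.units_eq_one_or (R.ε (R.rV v)) <;>
      simp only [hu, hw, one_smul, Units.neg_smul, ne_eq, not_true_eq_false] at h1 h2 hε <;>
      constructor <;> linarith
  obtain ⟨rfl, rfl⟩ := hxy
  exact ⟨0, 0, fun _ => rfl, by cases i <;> simp [pairOp], by cases i <;> simp [pairOp]⟩

/-- The norm vanishes because `T² = -1`, so every pair is a cocycle. The map `T - 1` has determinant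
`1 - εε' = 2`, and its image consists of the pairs with even sum. -/
theorem local_quarter_odd (hε : R.ε v ≠ R.ε (R.rV v)) {i : ℕ}
    (hn : n = R.degV v + (i + 1)) (hi : Even i) : R.LocalCohomology ℤ n v (ZMod 2) := by
  have hi' : ¬ Even (i + 1) := by simpa [Nat.even_add_one] using hi
  have h0 : n - R.degV v = i + 1 := by lia
  have hv : R.rV v ≠ v := fun h => hε (by rw [h])
  have hεε : R.ε v * R.ε (R.rV v) = -1 := by
    obtain hu | hu := Int.units_eq_one_or (R.ε v) <;>
      obtain hw | hw := Int.units_eq_one_or (R.ε (R.rV v)) <;>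
      simp [hu, hw] at hε ⊢
  refine R.localCohomology_of_hom (by lia) ((Int.castAddHom (ZMod 2)).comp
      (AddMonoidHom.fst ℤ ℤ + AddMonoidHom.snd ℤ ℤ))
    (fun y => ⟨((y.val : ℤ), 0), ?_, by simp⟩) fun p hp => ?_
  · rw [h0]
    refine ⟨fun h => (hv h).elim, ?_, ?_⟩
    · rw [pairOp, if_neg hi', hεε, Units.neg_smul, one_smul, add_neg_cancel]
    · rw [pairOp, if_neg hi', R.rV_rV, mul_comm, hεε, Units.neg_smul, one_smul, add_neg_cancel]
  · rw [h0] at hp ⊢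
    obtain ⟨x, y⟩ := p
    change ((x + y : ℤ) : ZMod 2) = 0 ↔ _
    rw [ZMod.intCast_zmod_eq_zero_iff_dvd]
    simp only [IsPairBoundary, pairOp, hi, if_true, hv, R.rV_rV]
    obtain hu | hu := Int.units_eq_one_or (R.ε v) <;>
      obtain hw | hw := Int.units_eq_one_or (R.ε (R.rV v)) <;>
      simp only [hu, hw, one_smul, Units.neg_smul, ne_eq, not_true_eq_false] at hε ⊢
    · constructor
      · rintro ⟨m, hm⟩
        push_cast at hm
        exact ⟨-m, x - m, fun h => h.elim, by ring, by linarith⟩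
      · rintro ⟨a, b, h, h1, h2⟩
        exact ⟨-a, by push_cast; linarith⟩
    · constructor
      · rintro ⟨m, hm⟩
        push_cast at hm
        exact ⟨-(x - m), -m, fun h => h.elim, by ring, by linarith⟩
      · rintro ⟨a, b, h, h1, h2⟩
        exact ⟨-b, by push_cast; linarith⟩

theorem localCohomology_integral [DecidableEq V] (n : ℕ) (v : V) :
    R.LocalCohomology ℤ n v ((R.integralFactor n v).Group ℤ) := by
  by_cases h0 : n < R.degV v
  · rw [integralFactor, if_pos h0]
    exact R.localCohomology_of_lt h0
  obtain ⟨i, hn⟩ : ∃ i, n = R.degV v + i := ⟨n - R.degV v, by lia⟩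
  have hi0 : n - R.degV v = i := by lia
  rw [integralFactor, if_neg h0, hi0]
  by_cases hv : R.rV v = v
  · rw [if_pos hv]
    obtain hε | hε := Int.units_eq_one_or (R.ε v)
    · rw [if_pos hε]
      by_cases hd : n = R.degV v
      · rw [if_pos hd]
        exact R.localCohomology_free ℤ hd (by rw [hv]) fun _ => hε
      · rw [if_neg hd]
        obtain ⟨i, rfl⟩ : ∃ j, i = j + 1 := Nat.exists_eq_succ_of_ne_zero (by lia)
        by_cases hi : Even (i + 1)
        · rw [if_pos hi]
          exact R.local_fixed_even hv hε hn (by simpa [Nat.even_add_one] using hi)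
        · rw [if_neg hi]
          exact R.local_fixed_odd hv hε hn hi
    · rw [if_neg (by rw [hε]; decide)]
      by_cases hi : Even i
      · rw [if_pos hi]
        exact R.local_sign_even hv hε hn hi
      · rw [if_neg hi]
        obtain ⟨i, rfl⟩ : ∃ j, i = j + 1 := Nat.exists_eq_succ_of_ne_zero (by rintro rfl; simp at hi)
        exact R.local_sign_odd hv hε hn (by simpa [Nat.even_add_one] using hi)
  · rw [if_neg hv]
    by_cases hε : R.ε v = R.ε (R.rV v)
    · rw [if_pos hε]
      by_cases hd : n = R.degV v
      · rw [if_pos hd]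
        exact R.localCohomology_free ℤ hd hε fun h => (hv h).elim
      · rw [if_neg hd]
        obtain ⟨i, rfl⟩ : ∃ j, i = j + 1 := Nat.exists_eq_succ_of_ne_zero (by lia)
        by_cases hi : Even (i + 1)
        · rw [if_pos hi]
          exact R.local_swap_even hv hε hn (by simpa [Nat.even_add_one] using hi)
        · rw [if_neg hi]
          exact R.local_swap_odd hv hε hn (by simpa [Nat.even_add_one] using hi)
    · rw [if_neg hε]
      by_cases hi : Even i
      · rw [if_pos hi]
        exact R.local_quarter_even hε hn hi
      · rw [if_neg hi]
        obtain ⟨i, rfl⟩ : ∃ j, i = j + 1 := Nat.exists_eq_succ_of_ne_zero (by rintro rfl; simp at hi)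
        exact R.local_quarter_odd hε hn (by simpa [Nat.even_add_one] using hi)

end integral

end Rotation

/-! ### Coefficients in the circle, in degree two -/

theorem exists_add_self_eq (x : Additive Circle) : ∃ y, y + y = x := by
  refine ⟨Additive.ofMul (Circle.exp (Complex.arg x.toMul / 2)), ?_⟩
  rw [← ofMul_mul, ← Circle.exp_add, add_halves, Circle.exp_arg]
  rfl

/-- Exactly one nontrivial element of order two: the source of the `ℤ/2` summands among flat gerbes.
-/
theorem exists_two_torsion : ∃ a : Additive Circle, a ≠ 0 ∧ a + a = 0 ∧
    ∀ x : Additive Circle, x + x = 0 → x = 0 ∨ x = a := by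
  have h1 : ∀ z : Circle, z * z = 1 ↔ ((z : ℂ) = 1 ∨ (z : ℂ) = -1) := fun z => by
    rw [← mul_self_eq_one_iff, ← Circle.coe_mul, ← Circle.coe_one, Circle.ext_iff]
  have h2 : ((Circle.exp Real.pi : Circle) : ℂ) = -1 := by
    rw [Circle.coe_exp, Complex.exp_pi_mul_I]
  refine ⟨Additive.ofMul (Circle.exp Real.pi), fun h => ?_, ?_, fun x hx => ?_⟩
  · have h3 : Circle.exp Real.pi = 1 := h
    rw [h3, Circle.coe_one] at h2
    norm_num at h2
  · exact (h1 _).2 (Or.inr h2)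
  · obtain h | h := (h1 x.toMul).1 hx
    · exact Or.inl (Circle.ext h)
    · exact Or.inr (Circle.ext (h.trans h2.symm))

namespace Rotation

variable {X V : Type} [AddCommGroup X] {C : ContractedComplex X} (R : Rotation C V)

/-- The contribution of an orbit to cohomology of degree two with coefficients in the circle. -/
def circleFactor (v : V) : Factor :=
  if R.degV v = 2 then if R.ε v = R.ε (R.rV v) then .free else .two else .zero

/-! ### Vanishing of higher contributions for two-divisible coefficients -/

section divisible

variable {A : Type} [AddCommGroup A] (hA : ∀ x : A, ∃ y, y + y = x) {n : ℕ} {v : V}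
  {G : Type} [AddCommGroup G] [Subsingleton G]

include hA

/-- The norm is multiplication by four, which is surjective after halving twice. -/
theorem divisible_fixed_even (hv : R.rV v = v) (hε : R.ε v = 1) {i : ℕ}
    (hn : n = R.degV v + (i + 1)) (hi : ¬ Even i) : R.LocalCohomology A n v G := by
  have h0 : n - R.degV v = i + 1 := by lia
  refine R.localCohomology_of_exact (by lia) fun p hp => ?_
  rw [h0] at hp ⊢
  obtain ⟨h1, -, -⟩ := hp
  obtain ⟨x, y⟩ := p
  obtain rfl : x = y := h1 hv
  obtain ⟨a, rfl⟩ := hA x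
  obtain ⟨b, rfl⟩ := hA a
  simp only [IsPairBoundary, pairOp, hi, if_false, hv, hε, one_smul, mul_one]
  exact ⟨b, b, fun _ => rfl, rfl, rfl⟩

theorem divisible_sign_odd (hv : R.rV v = v) (hε : R.ε v = -1) {i : ℕ}
    (hn : n = R.degV v + (i + 1)) (hi : Even i) : R.LocalCohomology A n v G := by
  have h0 : n - R.degV v = i + 1 := by lia
  refine R.localCohomology_of_exact (by lia) fun p hp => ?_
  rw [h0] at hp ⊢
  obtain ⟨h1, -, -⟩ := hp
  obtain ⟨x, y⟩ := p
  obtain rfl : x = y := h1 hv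
  obtain ⟨a, rfl⟩ := hA x
  simp only [IsPairBoundary, pairOp, hi, if_true, hv, hε, one_smul, Units.neg_smul]
  exact ⟨-a, -a, fun _ => rfl, by abel, by abel⟩

theorem divisible_swap_even (hv : R.rV v ≠ v) (hε : R.ε v = R.ε (R.rV v)) {i : ℕ}
    (hn : n = R.degV v + (i + 1)) (hi : ¬ Even i) : R.LocalCohomology A n v G := by
  have hi' : Even (i + 1) := by simpa [Nat.even_add_one] using hi
  have h0 : n - R.degV v = i + 1 := by lia
  refine R.localCohomology_of_exact (by lia) fun p hp => ?_
  rw [h0] at hp ⊢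
  obtain ⟨-, -, h2⟩ := hp
  obtain ⟨x, y⟩ := p
  simp only [pairOp, hi', if_true, ← hε, sub_eq_zero] at h2
  subst h2
  obtain ⟨a, rfl⟩ := hA x
  simp only [IsPairBoundary, pairOp, hi, if_false, hv, ← hε, R.rV_rV, Int.units_mul_self, one_smul]
  exact ⟨a, 0, fun h => h.elim, by simp, by simp⟩

/-- Solving `(T - 1)(a, b) = (x, y)` needs only one division by two, in accordance with the
determinant `2`. -/
theorem divisible_quarter_odd (hε : R.ε v ≠ R.ε (R.rV v)) {i : ℕ}
    (hn : n = R.degV v + (i + 1)) (hi : Even i) : R.LocalCohomology A n v G := by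
  have h0 : n - R.degV v = i + 1 := by lia
  have hv : R.rV v ≠ v := fun h => hε (by rw [h])
  refine R.localCohomology_of_exact (by lia) fun p _ => ?_
  rw [h0]
  obtain ⟨x, y⟩ := p
  simp only [IsPairBoundary, pairOp, hi, if_true, hv, R.rV_rV]
  obtain ⟨b, hb⟩ := hA (x - y)
  obtain hu | hu := Int.units_eq_one_or (R.ε v) <;>
    obtain hw | hw := Int.units_eq_one_or (R.ε (R.rV v)) <;>
    simp only [hu, hw, one_smul, Units.neg_smul, ne_eq, not_true_eq_false] at hε ⊢
  · refine ⟨b - x, b, fun h => h.elim, by abel, ?_⟩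
    rw [← sub_eq_zero] at hb ⊢
    rw [← neg_eq_zero, ← hb]
    abel
  · refine ⟨-b, -b - y, fun h => h.elim, ?_, by abel⟩
    rw [← sub_eq_zero] at hb ⊢
    rw [← hb]
    abel

end divisible

/-- An invariant pair is determined by its first entry `x`, and `T² = -1` forces `2x = 0`. -/
theorem circle_quarter_zero {v : V} (hε : R.ε v ≠ R.ε (R.rV v)) :
    R.LocalCohomology (Additive Circle) (R.degV v) v (ZMod 2) := by
  classical
  have h0 : R.degV v - R.degV v = 0 := Nat.sub_self _
  have hv : R.rV v ≠ v := fun h => hε (by rw [h])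
  obtain ⟨a, ha, haa, hor⟩ := exists_two_torsion
  have key : ∀ p : Additive Circle × Additive Circle, p ∈ R.pairs (Additive Circle) v 0 ↔
      p.1 + p.1 = 0 ∧ p.2 = R.ε (R.rV v) • p.1 := by
    rintro ⟨x, y⟩
    have h : (x, y) ∈ R.pairs (Additive Circle) v 0 ↔
        R.ε v • y = x ∧ R.ε (R.rV v) • x = y := by
      change (_ ∧ R.pairOp v 1 x y = 0 ∧ R.pairOp (R.rV v) 1 y x = 0) ↔ _
      simp [pairOp, hv, sub_eq_zero]
    rw [h]
    obtain hu | hu := Int.units_eq_one_or (R.ε v) <;>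
      obtain hw | hw := Int.units_eq_one_or (R.ε (R.rV v)) <;>
      simp only [hu, hw, one_smul, Units.neg_smul, ne_eq, not_true_eq_false] at hε ⊢
    · constructor
      · rintro ⟨rfl, h⟩
        exact ⟨by nth_rewrite 1 [← h]; abel, h.symm⟩
      · rintro ⟨h', rfl⟩
        exact ⟨neg_eq_of_add_eq_zero_left h', rfl⟩
    · constructor
      · rintro ⟨h, rfl⟩
        exact ⟨by nth_rewrite 1 [← h]; abel, rfl⟩
      · rintro ⟨h', rfl⟩
        exact ⟨neg_eq_of_add_eq_zero_left h', rfl⟩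
  refine Or.inr ⟨le_rfl, ?_⟩
  rw [h0]
  refine ⟨AddMonoidHom.mk' (fun p => if p.1.1 = 0 then 0 else 1) ?_, fun y => ?_, fun p => ?_⟩
  · rintro ⟨⟨x, y⟩, hp⟩ ⟨⟨x', y'⟩, hp'⟩
    change (if x + x' = 0 then (0 : ZMod 2) else 1) =
      (if x = 0 then 0 else 1) + (if x' = 0 then 0 else 1)
    obtain rfl | rfl := hor x ((key _).1 hp).1 <;> obtain rfl | rfl := hor x' ((key _).1 hp').1
    · simp
    · simp [ha]
    · simp [ha]
    · rw [if_pos haa, if_neg ha]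
      rfl
  · have hy : y = 0 ∨ y = 1 := by revert y; decide
    obtain rfl | rfl := hy
    · exact ⟨0, if_pos rfl⟩
    · exact ⟨⟨(a, R.ε (R.rV v) • a), (key _).2 ⟨haa, rfl⟩⟩, if_neg ha⟩
  · have hp := (key _).1 p.2
    change (if p.1.1 = 0 then (0 : ZMod 2) else 1) = 0 ↔ _
    rw [ite_eq_left_iff, not_imp_comm, imp_iff_right (by decide)]
    constructor
    · intro h
      exact ⟨0, 0, fun _ => rfl, h.symm, by rw [hp.2, h, smul_zero]; rfl⟩
    · rintro ⟨x, y, -, h, -⟩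
      exact h.symm

/-- Cells of dimension zero enter through cyclic degree two, where divisibility kills them. Edges
enter through degree one, where they vanish because `h1` makes their signs nontrivial. Only
invariants of 2-cells are left; `h2` rules out fixed 2-cells of sign `-1`, which `circleFactor`
would misread as free. -/
theorem localCohomology_circle (h0 : ∀ v, R.degV v = 0 → R.rV v = v ∨ R.ε v = R.ε (R.rV v))
    (h1 : ∀ v, R.degV v = 1 → R.rV v = v ∧ R.ε v = -1 ∨ R.ε v ≠ R.ε (R.rV v))
    (h2 : ∀ v, R.degV v = 2 → R.rV v = v → R.ε v = 1) (v : V) :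
    R.LocalCohomology (Additive Circle) 2 v ((R.circleFactor v).Group (Additive Circle)) := by
  rw [circleFactor]
  by_cases hd : R.degV v = 2
  · rw [if_pos hd]
    by_cases hε : R.ε v = R.ε (R.rV v)
    · rw [if_pos hε]
      exact R.localCohomology_free _ hd.symm hε (h2 v hd)
    · rw [if_neg hε, ← hd]
      exact R.circle_quarter_zero hε
  · rw [if_neg hd]
    rcases Nat.lt_or_ge 2 (R.degV v) with h | h
    · exact R.localCohomology_of_lt h
    · obtain h | h : R.degV v = 0 ∨ R.degV v = 1 := by lia
      · by_cases hv : R.rV v = v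
        · exact R.divisible_fixed_even exists_add_self_eq hv (R.ε_of_degV v h) (i := 1) (by lia)
            (by decide)
        · exact R.divisible_swap_even exists_add_self_eq hv ((h0 v h).resolve_left hv) (i := 1)
            (by lia) (by decide)
      · obtain ⟨hv, hε⟩ | hε := h1 v h
        · exact R.divisible_sign_odd exists_add_self_eq hv hε (i := 0) (by lia) (by decide)
        · exact R.divisible_quarter_odd exists_add_self_eq hε (i := 0) (by lia) (by decide)

end Rotation

/-! ### Counting orbits -/

namespace Factor

variable (A : Type) [AddCommGroup A]

/-- Identifies the contribution when the factor is known. -/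
def groupCongr {F F' : Factor} (h : F = F') : F.Group A ≃+ F'.Group A := by
  subst h
  exact AddEquiv.refl _

theorem pi_equiv {I : Type} [Fintype I] (F : I → Factor) {a b c : ℕ}
    (ha : Fintype.card {i // F i = free} = a) (hb : Fintype.card {i // F i = four} = b)
    (hc : Fintype.card {i // F i = two} = c) :
    Nonempty ((∀ i, (F i).Group A) ≃+ (Fin a → A) × (Fin b → ZMod 4) × (Fin c → ZMod 2)) := by
  have ea := Fintype.equivFinOfCardEq ha
  have eb := Fintype.equivFinOfCardEq hb
  have ec := Fintype.equivFinOfCardEq hc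
  let Φ : (∀ i, (F i).Group A) →+ (Fin a → free.Group A) × (Fin b → four.Group A) ×
      (Fin c → two.Group A) := AddMonoidHom.mk' (fun g =>
    (fun k => groupCongr A (ea.symm k).2 (g _), fun k => groupCongr A (eb.symm k).2 (g _),
      fun k => groupCongr A (ec.symm k).2 (g _))) fun g g' => by
    refine Prod.ext (funext fun k => ?_) (Prod.ext (funext fun k => ?_) (funext fun k => ?_)) <;>
      exact map_add _ _ _
  have hF : ∀ i, F i = zero ∨ F i = free ∨ F i = four ∨ F i = two := fun i => by
    cases F i <;> simp
  refine ⟨AddEquiv.ofBijective Φ ⟨(injective_iff_map_eq_zero Φ).2 fun g hg => ?_, ?_⟩⟩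
  · have h1 := congrArg Prod.fst hg
    have h2 := congrArg (fun y => y.2.1) hg
    have h3 := congrArg (fun y => y.2.2) hg
    funext i
    obtain h | h | h | h := hF i
    · exact (groupCongr A h).injective (Subsingleton.elim _ _)
    · have := congrFun h1 (ea ⟨i, h⟩)
      change groupCongr A (ea.symm (ea ⟨i, h⟩)).2 (g (ea.symm (ea ⟨i, h⟩)).1) = 0 at this
      rw [ea.symm_apply_apply] at this
      exact (map_eq_zero_iff _ (groupCongr A h).injective).1 this
    · have := congrFun h2 (eb ⟨i, h⟩)
      change groupCongr A (eb.symm (eb ⟨i, h⟩)).2 (g (eb.symm (eb ⟨i, h⟩)).1) = 0 at this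
      rw [eb.symm_apply_apply] at this
      exact (map_eq_zero_iff _ (groupCongr A h).injective).1 this
    · have := congrFun h3 (ec ⟨i, h⟩)
      change groupCongr A (ec.symm (ec ⟨i, h⟩)).2 (g (ec.symm (ec ⟨i, h⟩)).1) = 0 at this
      rw [ec.symm_apply_apply] at this
      exact (map_eq_zero_iff _ (groupCongr A h).injective).1 this
  · rintro ⟨x, y, z⟩
    have : ∀ i, ∃ g : (F i).Group A, (∀ h, groupCongr A h g = x (ea ⟨i, h⟩)) ∧
        (∀ h, groupCongr A h g = y (eb ⟨i, h⟩)) ∧ ∀ h, groupCongr A h g = z (ec ⟨i, h⟩) := by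
      intro i
      obtain h | h | h | h := hF i
      · exact ⟨0, fun h' => by simp [h] at h', fun h' => by simp [h] at h',
          fun h' => by simp [h] at h'⟩
      · exact ⟨(groupCongr A h).symm (x (ea ⟨i, h⟩)), fun h' => AddEquiv.apply_symm_apply _ _,
          fun h' => by simp [h] at h', fun h' => by simp [h] at h'⟩
      · exact ⟨(groupCongr A h).symm (y (eb ⟨i, h⟩)), fun h' => by simp [h] at h',
          fun h' => AddEquiv.apply_symm_apply _ _, fun h' => by simp [h] at h'⟩
      · exact ⟨(groupCongr A h).symm (z (ec ⟨i, h⟩)), fun h' => by simp [h] at h',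
          fun h' => by simp [h] at h', fun h' => AddEquiv.apply_symm_apply _ _⟩
    choose g hx hy hz using this
    refine ⟨g, Prod.ext (funext fun k => ?_) (Prod.ext (funext fun k => ?_) (funext fun k => ?_))⟩
    · exact (hx _ _).trans (congrArg x (ea.apply_symm_apply k))
    · exact (hy _ _).trans (congrArg y (eb.apply_symm_apply k))
    · exact (hz _ _).trans (congrArg z (ec.apply_symm_apply k))

end Factor

/-- The representative of the orbit of a reduced cell. -/
def orbitRep (v : TorusCells) : TorusCells :=
  -- The half-turn factor is never moved. The first quarter-turn factor that is an edge decides, and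
  -- the vertical edge `(0, 1)` is replaced by the horizontal one.
  if v.2.1 = (0, 1) ∨ v.2.1.1 = v.2.1.2 ∧ v.2.2 = (0, 1) then torusRotation.rV v else v

theorem orbitRep_rV : ∀ v, orbitRep (torusRotation.rV v) = orbitRep v := by decide +kernel

theorem orbitRep_eq_or : ∀ v, orbitRep v = v ∨ orbitRep v = torusRotation.rV v := by
  decide +kernel

/-- The number of orbits with a given contribution. -/
def factorCount (F : TorusCells → Factor) (K : Factor) : ℕ :=
  Fintype.card {v : {v // orbitRep v = v} // F v = K}

theorem groupCohomology_equiv (A : Type) [AddCommGroup A] (n : ℕ) (F : TorusCells → Factor)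
    (hF : ∀ v, torusRotation.LocalCohomology A n v ((F v).Group A)) {a b c : ℕ}
    (ha : factorCount F .free = a) (hb : factorCount F .four = b) (hc : factorCount F .two = c) :
    Nonempty (groupCohomology (Rep.trivial ℤ Gamma A) n ≃+
      (Fin a → A) × (Fin b → ZMod 4) × (Fin c → ZMod 2)) := by
  obtain ⟨Θ, hΘ, hker⟩ := torusRotation.exists_globalHom A orbitRep orbitRep_rV orbitRep_eq_or
    (fun v => (F v).Group A) fun v => hF v
  obtain ⟨e⟩ := torusRotation.homology_equiv latticeCoords latticeCoords_latticeAut n Θ hΘ hker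
  obtain ⟨e'⟩ := Factor.pi_equiv A (fun v : {v // orbitRep v = v} => F v) ha hb hc
  exact ⟨((groupCohomologyIso (Rep.trivial ℤ Gamma A) n
    gammaResolution).toLinearEquiv.toAddEquiv.trans e).trans e'⟩

/-- Cohomology of `ℤ/4` is two-periodic in positive degree. The bound is strict because the 6-cell
still gives a free summand in degree six. -/
theorem integralFactor_add_two {n : ℕ} (hn : 6 < n) :
    torusRotation.integralFactor (n + 2) = torusRotation.integralFactor n := by
  have hdeg : ∀ v, torusRotation.degV v ≤ 6 := by decide +kernel
  funext v
  have h := hdeg v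
  have h1 : n + 2 - torusRotation.degV v = n - torusRotation.degV v + 2 := by lia
  have h2 : ¬ n + 2 < torusRotation.degV v := by lia
  have h3 : ¬ n < torusRotation.degV v := by lia
  have h4 : n + 2 ≠ torusRotation.degV v := by lia
  have h5 : n ≠ torusRotation.degV v := by lia
  simp only [Rotation.integralFactor, h1, h2, h3, h4, h5, if_false, Nat.even_add, even_two, iff_true]

theorem HGamma_equiv (n : ℕ) {a b c : ℕ}
    (ha : factorCount (torusRotation.integralFactor n) .free = a)
    (hb : factorCount (torusRotation.integralFactor n) .four = b)
    (hc : factorCount (torusRotation.integralFactor n) .two = c) :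
    Nonempty (HGamma n ≃+ (Fin a → ℤ) × (Fin b → ZMod 4) × (Fin c → ZMod 2)) :=
  groupCohomology_equiv ℤ n _ (torusRotation.localCohomology_integral n) ha hb hc

theorem circleCohomology_equiv :
    Nonempty (groupCohomology (Rep.trivial ℤ Gamma (Additive Circle)) 2 ≃+
      (Fin 5 → Additive Circle) × (Fin 0 → ZMod 4) × (Fin 4 → ZMod 2)) :=
  groupCohomology_equiv _ 2 _ (torusRotation.localCohomology_circle (by decide +kernel)
    (by decide +kernel) (by decide +kernel)) (by decide +kernel) (by decide +kernel)
    (by decide +kernel)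

theorem HGamma_odd_equiv (m : ℕ) :
    Nonempty (HGamma (2 * m + 7) ≃+ (Fin 0 → ℤ) × (Fin 0 → ZMod 4) × (Fin 12 → ZMod 2)) := by
  have h : torusRotation.integralFactor (2 * m + 7) = torusRotation.integralFactor 7 := by
    induction m with
    | zero => rfl
    | succ m ih => exact (integralFactor_add_two (n := 2 * m + 7) (by lia)).trans ih
  refine HGamma_equiv _ ?_ ?_ ?_ <;> rw [h] <;> decide +kernel

theorem HGamma_even_equiv (m : ℕ) :
    Nonempty (HGamma (2 * m + 8) ≃+ (Fin 0 → ℤ) × (Fin 8 → ZMod 4) × (Fin 20 → ZMod 2)) := by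
  have h : torusRotation.integralFactor (2 * m + 8) = torusRotation.integralFactor 8 := by
    induction m with
    | zero => rfl
    | succ m ih => exact (integralFactor_add_two (n := 2 * m + 8) (by lia)).trans ih
  refine HGamma_equiv _ ?_ ?_ ?_ <;> rw [h] <;> decide +kernel

end ToroidalOrbifold

end

theorem mainTheorem5 :
    (Nonempty (ToroidalOrbifold.HGamma 0 ≃+ ℤ) ∧
      Subsingleton (ToroidalOrbifold.HGamma 1) ∧
      Nonempty (ToroidalOrbifold.HGamma 2 ≃+
        (Fin 5 → ℤ) × ZMod 4 × (Fin 4 → ZMod 2)) ∧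
      Nonempty (ToroidalOrbifold.HGamma 3 ≃+ (Fin 4 → ℤ) × (Fin 4 → ZMod 2)) ∧
      Nonempty (ToroidalOrbifold.HGamma 4 ≃+
        (Fin 5 → ℤ) × (Fin 4 → ZMod 4) × (Fin 14 → ZMod 2)) ∧
      Nonempty (ToroidalOrbifold.HGamma 5 ≃+ (Fin 12 → ZMod 2)) ∧
      Nonempty (ToroidalOrbifold.HGamma 6 ≃+
        ℤ × (Fin 7 → ZMod 4) × (Fin 20 → ZMod 2)) ∧
      (∀ k : ℕ, 1 < k →
        Nonempty (ToroidalOrbifold.HGamma (2 * k + 1) ≃+ (Fin 12 → ZMod 2))) ∧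
      (∀ k : ℕ, 3 < k →
        Nonempty (ToroidalOrbifold.HGamma (2 * k) ≃+
          (Fin 8 → ZMod 4) × (Fin 20 → ZMod 2)))) ∧
    (∀ (E : Type) [TopologicalSpace E] [MulAction ToroidalOrbifold.C4 E],
      ToroidalOrbifold.IsUniversalSpace ToroidalOrbifold.C4 E →
        Nonempty (ToroidalOrbifold.FGb ToroidalOrbifold.C4 E ToroidalOrbifold.Torus ≃+
          (Fin 5 → Additive Circle) × (Fin 4 → ZMod 2)) ∧
        Nonempty (ToroidalOrbifold.Gb ToroidalOrbifold.C4 E ToroidalOrbifold.Torus ≃+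
          (Fin 4 → ℤ) × (Fin 4 → ZMod 2))) := by
  open ToroidalOrbifold in
  have h0 : Nonempty (HGamma 0 ≃+ (Fin 1 → ℤ) × (Fin 0 → ZMod 4) × (Fin 0 → ZMod 2)) :=
    HGamma_equiv 0 (by decide +kernel) (by decide +kernel) (by decide +kernel)
  have h1 : Nonempty (HGamma 1 ≃+ (Fin 0 → ℤ) × (Fin 0 → ZMod 4) × (Fin 0 → ZMod 2)) :=
    HGamma_equiv 1 (by decide +kernel) (by decide +kernel) (by decide +kernel)
  have h2 : Nonempty (HGamma 2 ≃+ (Fin 5 → ℤ) × (Fin 1 → ZMod 4) × (Fin 4 → ZMod 2)) :=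
    HGamma_equiv 2 (by decide +kernel) (by decide +kernel) (by decide +kernel)
  have h3 : Nonempty (HGamma 3 ≃+ (Fin 4 → ℤ) × (Fin 0 → ZMod 4) × (Fin 4 → ZMod 2)) :=
    HGamma_equiv 3 (by decide +kernel) (by decide +kernel) (by decide +kernel)
  have h4 : Nonempty (HGamma 4 ≃+ (Fin 5 → ℤ) × (Fin 4 → ZMod 4) × (Fin 14 → ZMod 2)) :=
    HGamma_equiv 4 (by decide +kernel) (by decide +kernel) (by decide +kernel)
  have h5 : Nonempty (HGamma 5 ≃+ (Fin 0 → ℤ) × (Fin 0 → ZMod 4) × (Fin 12 → ZMod 2)) :=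
    HGamma_equiv 5 (by decide +kernel) (by decide +kernel) (by decide +kernel)
  have h6 : Nonempty (HGamma 6 ≃+ (Fin 1 → ℤ) × (Fin 7 → ZMod 4) × (Fin 20 → ZMod 2)) :=
    HGamma_equiv 6 (by decide +kernel) (by decide +kernel) (by decide +kernel)
  have one (M : Type) [AddCommGroup M] : (Fin 1 → M) ≃+ M := AddEquiv.piUnique _
  have e3 : Nonempty (HGamma 3 ≃+ (Fin 4 → ℤ) × (Fin 4 → ZMod 2)) :=
    h3.map fun e => e.trans (AddEquiv.prodCongr (AddEquiv.refl _) AddEquiv.uniqueProd)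
  have drop (n : ℕ) :
      HGamma n ≃+ (Fin 0 → ℤ) × (Fin 0 → ZMod 4) × (Fin 12 → ZMod 2) →
        HGamma n ≃+ (Fin 12 → ZMod 2) :=
    fun e => e.trans (AddEquiv.uniqueProd.trans AddEquiv.uniqueProd)
  refine ⟨⟨?_, ?_, ?_, e3, h4, ?_, ?_, ?_, ?_⟩, fun E _ _ hE => ⟨?_, ?_⟩⟩
  · exact h0.map fun e => e.trans
      ((AddEquiv.prodCongr (one ℤ) AddEquiv.uniqueProd).trans AddEquiv.prodUnique)
  · exact h1.elim fun e => e.toEquiv.subsingleton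
  · exact h2.map fun e => e.trans
      (AddEquiv.prodCongr (AddEquiv.refl _) (AddEquiv.prodCongr (one _) (AddEquiv.refl _)))
  · exact h5.map (drop 5)
  · exact h6.map fun e => e.trans (AddEquiv.prodCongr (one ℤ) (AddEquiv.refl _))
  · intro k hk
    -- Degree five lies below the periodic range but has the same value.
    obtain rfl | ⟨m, rfl⟩ : k = 2 ∨ ∃ m, k = m + 3 := by
      rcases k with _ | _ | _ | k
      · lia
      · lia
      · exact Or.inl rfl
      · exact Or.inr ⟨k, rfl⟩
    · exact h5.map (drop 5)
    · exact (HGamma_odd_equiv m).map (drop (2 * m + 7))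
  · intro k hk
    obtain ⟨m, rfl⟩ : ∃ m, k = m + 4 := ⟨k - 4, by lia⟩
    exact (HGamma_even_equiv m).map fun e => e.trans AddEquiv.uniqueProd
  · obtain ⟨e⟩ := singularCohomology_borel_equiv E hE (Additive Circle) 2
    obtain ⟨e'⟩ := circleCohomology_equiv
    exact ⟨e.trans (e'.trans (AddEquiv.prodCongr (AddEquiv.refl _) AddEquiv.uniqueProd))⟩
  · obtain ⟨e⟩ := singularCohomology_borel_equiv E hE ℤ 3
    obtain ⟨e'⟩ := e3
    exact ⟨e.trans e'⟩
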